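/- All Lie algebras and modules are finite-dimensional over $\mathbb{C}$. For $n\ge 0$ let $V(n)$ be the irreducible $\mathfrak{sl}(2)$-module of highest weight $n$. Let $m\ge 1$ and let $\mathfrak g=\mathfrak{sl}(2)\ltimes V(m)$, where $V(m)$ is an abelian ideal. A $\mathfrak g$-module $V$ is uniserial if its submodules form a chain. Its socle series is defined by $\mathrm{soc}^0(V)=0$ and $\mathrm{soc}^{i}(V)/\mathrm{soc}^{i-1}(V)=\mathrm{soc}(V/\mathrm{soc}^{i-1}(V))$, where the socle is the sum of all irreducible submodules; $V$ has socle factors $V(a_1),\dots,V(a_n)$ if $\mathrm{soc}^n(V)=V$ and $\mathrm{soc}^{i}(V)/\mathrm{soc}^{i-1}(V)\cong V(a_i)$ as $\mathfrak{sl}(2)$-modules for $1\le i\le n$. Then: 1. If $\ell\ge 0$, $\ell\le 2m$ and $\ell\equiv 2m \pmod 4$, then there is, up to isomorphism, one and only one uniserial $\mathfrak g$-module with socle factors $V(0),V(m),V(\ell)$, and its dual module is uniserial with socle factors $V(\ell),V(m),V(0)$. 2. There is a uniserial $\mathfrak g$-module with socle factors $V(0),V(m),V(0)$ if and only if $m$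 is even, and it is then unique up to isomorphism. 3. If $m\equiv 0\pmod 4$, then the isomorphism classes of uniserial $\mathfrak g$-modules with socle factors $V(0),V(m),V(m),V(0)$ are parametrized by $\mathbb{C}$: there is a family $(M_z)_{z\in\mathbb{C}}$ of uniserial $\mathfrak g$-modules with these socle factors such that $M_z\cong M_{z'}$ only if $z=z'$, every uniserial $\mathfrak g$-module with these socle factors is isomorphic to some $M_z$, and, in suitable bases, each $x\in\mathfrak g$ acts on $M_z$ by a matrix of the form $A(x)+z\,C(x)$ with $A(x),C(x)$ independent of $z$. -/

import Mathlib

noncomputable section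

/-! ### The Lie algebra `sl(2)` and its irreducible modules `V(n)` -/

/-- The complex Lie algebra `sl(2)` of traceless `2 × 2` matrices. -/
abbrev Sl2 : Type := LieAlgebra.SpecialLinear.sl (Fin 2) ℂ

/-- The diagonal matrix `diag(n, n-2, …, -n)`. -/
def Hmat (n : ℕ) : Matrix (Fin (n + 1)) (Fin (n + 1)) ℂ :=
  Matrix.of fun i j => if i = j then (n : ℂ) - 2 * (i : ℕ) else 0

/-- The matrix with first superdiagonal `(n, …, 2, 1)` and zeros elsewhere. -/
def Emat (n : ℕ) : Matrix (Fin (n + 1)) (Fin (n + 1)) ℂ :=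
  Matrix.of fun i j => if (j : ℕ) = i + 1 then (n : ℂ) - (i : ℕ) else 0

/-- The matrix with first subdiagonal `(1, 2, …, n)` and zeros elsewhere. -/
def Fmat (n : ℕ) : Matrix (Fin (n + 1)) (Fin (n + 1)) ℂ :=
  Matrix.of fun i j => if (i : ℕ) = j + 1 then ((i : ℕ) : ℂ) else 0

/-- The matrix by which `x = a h + b e + c f` in `sl(2)` acts on `V(n)`. -/
def sl2Mat (n : ℕ) (x : Matrix (Fin 2) (Fin 2) ℂ) :
    Matrix (Fin (n + 1)) (Fin (n + 1)) ℂ :=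
  x 0 0 • Hmat n + x 0 1 • Emat n + x 1 0 • Fmat n

/-- The space of the irreducible `sl(2)`-module `V(n)` of highest weight `n`, in coordinates with
respect to a basis `v₀, …, vₙ` on which `h vᵢ = (n - 2i) vᵢ`, `e vᵢ = (n - i + 1) vᵢ₋₁`,
`f vᵢ = (i + 1) vᵢ₊₁`. -/
def Irr (n : ℕ) : Type := Fin (n + 1) → ℂ

namespace Irr

instance (n : ℕ) : AddCommGroup (Irr n) := inferInstanceAs (AddCommGroup (Fin (n + 1) → ℂ))

instance (n : ℕ) : Module ℂ (Irr n) := inferInstanceAs (Module ℂ (Fin (n + 1) → ℂ))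

instance (n : ℕ) : FiniteDimensional ℂ (Irr n) :=
  inferInstanceAs (FiniteDimensional ℂ (Fin (n + 1) → ℂ))

end Irr

/-- The linear action of a `2 × 2` matrix on `V(n)` through `sl2Mat`. -/
def sl2Act (n : ℕ) (x : Matrix (Fin 2) (Fin 2) ℂ) : Irr n →ₗ[ℂ] Irr n :=
  (sl2Mat n x).mulVecLin

theorem Hmat_mul_apply (n : ℕ) (A : Matrix (Fin (n + 1)) (Fin (n + 1)) ℂ) (i j : Fin (n + 1)) :
    (Hmat n * A) i j = ((n : ℂ) - 2 * (i : ℕ)) * A i j := by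
  simp [Matrix.mul_apply, Hmat]

theorem Emat_mul_apply (n : ℕ) (A : Matrix (Fin (n + 1)) (Fin (n + 1)) ℂ) (i j : Fin (n + 1)) :
    (Emat n * A) i j =
      if h : (i : ℕ) + 1 < n + 1 then ((n : ℂ) - (i : ℕ)) * A ⟨i + 1, h⟩ j else 0 := by
  rw [Matrix.mul_apply]
  split_ifs with h
  · rw [Finset.sum_eq_single ⟨i + 1, h⟩]
    · simp [Emat]
    · intro k _ hk
      have : (k : ℕ) ≠ i + 1 := fun hh => hk (Fin.ext hh)
      simp [Emat, this]
    · simp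
  · refine Finset.sum_eq_zero fun k _ => ?_
    have : (k : ℕ) ≠ i + 1 := by have := k.2; omega
    simp [Emat, this]

theorem Fmat_mul_apply (n : ℕ) (A : Matrix (Fin (n + 1)) (Fin (n + 1)) ℂ) (i j : Fin (n + 1)) :
    (Fmat n * A) i j =
      if 0 < (i : ℕ) then ((i : ℕ) : ℂ) * A ⟨i - 1, by have := i.2; omega⟩ j else 0 := by
  rw [Matrix.mul_apply]
  split_ifs with h
  · rw [Finset.sum_eq_single ⟨i - 1, by have := i.2; omega⟩]
    · have : (i : ℕ) = i - 1 + 1 := by omega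
      simp [Fmat, ← this]
    · intro k _ hk
      have : ¬ (i : ℕ) = k + 1 := fun hh => hk (Fin.ext (by simp; omega))
      simp [Fmat, this]
    · simp
  · refine Finset.sum_eq_zero fun k _ => ?_
    have : ¬ (i : ℕ) = k + 1 := by omega
    simp [Fmat, this]

theorem Hmat_Emat (n : ℕ) : Hmat n * Emat n - Emat n * Hmat n = (2 : ℂ) • Emat n := by
  ext i j
  rw [Matrix.sub_apply, Hmat_mul_apply, Emat_mul_apply]
  by_cases h : (j : ℕ) = i + 1
  · have hi : (i : ℕ) + 1 < n + 1 := by have := j.2; omega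
    simp [Emat, Hmat, h, hi, Fin.ext_iff]
    ring
  · have h' : ¬ (i : ℕ) + 1 = j := fun hh => h hh.symm
    simp [Emat, Hmat, h, h', Fin.ext_iff]

theorem Hmat_Fmat (n : ℕ) : Hmat n * Fmat n - Fmat n * Hmat n = (-2 : ℂ) • Fmat n := by
  ext i j
  rw [Matrix.sub_apply, Hmat_mul_apply, Fmat_mul_apply]
  by_cases h : (i : ℕ) = j + 1
  · simp [Fmat, Hmat, h]
    ring
  · by_cases h0 : 0 < (i : ℕ)
    · have h' : ¬ (i : ℕ) - 1 = j := by omega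
      simp [Fmat, Hmat, h, h', Fin.ext_iff]
    · simp [Fmat, h, h0]

theorem Emat_Fmat (n : ℕ) : Emat n * Fmat n - Fmat n * Emat n = Hmat n := by
  ext i j
  rw [Matrix.sub_apply, Emat_mul_apply, Fmat_mul_apply]
  by_cases h : i = j
  · subst h
    obtain ⟨i, hi⟩ := i
    rcases Nat.eq_zero_or_pos i with rfl | h0
    · by_cases hn : n = 0
      · subst hn; simp [Hmat]
      · simp [Fmat, Hmat, Nat.pos_of_ne_zero hn]
    · obtain ⟨i, rfl⟩ : ∃ k, i = k + 1 := ⟨i - 1, by omega⟩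
      by_cases hn : i + 1 = n
      · subst hn; simp [Emat, Hmat]; ring
      · have : i + 1 < n := by omega
        simp [Fmat, Emat, Hmat, this]; ring
  · have h1 : ¬ (i : ℕ) = j := fun hh => h (Fin.ext hh)
    have h2 : 0 < (i : ℕ) → ¬ (j : ℕ) = i - 1 + 1 := by omega
    have h3 : (if 0 < (i : ℕ) then
        ((i : ℕ) : ℂ) * Emat n ⟨i - 1, by have := i.2; omega⟩ j else 0) = 0 := by
      split_ifs with h0
      · simp [Emat, h2 h0]
      · rfl
    rw [h3]
    simp [Fmat, Hmat, h, h1]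

theorem sl2Mat_lie (n : ℕ) (x y : Sl2) :
    sl2Mat n (⁅x, y⁆ : Sl2).val =
      sl2Mat n x.val * sl2Mat n y.val - sl2Mat n y.val * sl2Mat n x.val := by
  have hx : x.val 1 1 = -x.val 0 0 := by
    have : Matrix.trace x.val = 0 := x.2
    rw [Matrix.trace_fin_two] at this
    linear_combination this
  have hy : y.val 1 1 = -y.val 0 0 := by
    have : Matrix.trace y.val = 0 := y.2
    rw [Matrix.trace_fin_two] at this
    linear_combination this
  have h1 := Hmat_Emat n
  have h2 := Hmat_Fmat n
  have h3 := Emat_Fmat n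
  rw [sub_eq_iff_eq_add] at h1 h2 h3
  rw [LieAlgebra.SpecialLinear.sl_bracket]
  simp only [sl2Mat, Matrix.sub_apply, Matrix.mul_apply, Fin.sum_univ_two, hx, hy]
  simp only [mul_add, add_mul, Matrix.smul_mul, Matrix.mul_smul, smul_smul, h1, h2, h3]
  module

instance (n : ℕ) : LieRingModule Sl2 (Irr n) where
  bracket x v := sl2Act n x.val v
  add_lie x y v := by
    have : sl2Mat n (x + y).val = sl2Mat n x.val + sl2Mat n y.val := by
      change (x.val 0 0 + y.val 0 0) • _ + (x.val 0 1 + y.val 0 1) • _ +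
        (x.val 1 0 + y.val 1 0) • _ = _
      simp only [sl2Mat]
      module
    exact (congrArg (Matrix.mulVec · v) this).trans (Matrix.add_mulVec _ _ _)
  lie_add x v w := map_add _ v w
  leibniz_lie x y v := by
    have h : sl2Mat n x.val * sl2Mat n y.val =
        sl2Mat n (⁅x, y⁆ : Sl2).val + sl2Mat n y.val * sl2Mat n x.val := by
      rw [sl2Mat_lie]; abel
    have key : ∀ w : Fin (n + 1) → ℂ, (sl2Mat n x.val).mulVec ((sl2Mat n y.val).mulVec w) =
        (sl2Mat n (⁅x, y⁆ : Sl2).val).mulVec w +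
          (sl2Mat n y.val).mulVec ((sl2Mat n x.val).mulVec w) := by
      intro w
      rw [Matrix.mulVec_mulVec, h, Matrix.add_mulVec, Matrix.mulVec_mulVec]
    exact key v

theorem Irr.lie_def (n : ℕ) (x : Sl2) (v : Irr n) : ⁅x, v⁆ = sl2Act n x.val v := rfl

instance (n : ℕ) : LieModule ℂ Sl2 (Irr n) where
  smul_lie t x v := by
    have : sl2Mat n (t • x).val = t • sl2Mat n x.val := by
      change (t * x.val 0 0) • _ + (t * x.val 0 1) • _ + (t * x.val 1 0) • _ = _
      simp only [sl2Mat]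
      module
    exact (congrArg (Matrix.mulVec · v) this).trans (Matrix.smul_mulVec _ _ _)
  lie_smul t x v := map_smul _ t v

/-! ### The Lie algebra `sl(2) ⋉ V(m)` -/

/-- `V(n)` as an abelian Lie algebra. -/
instance (n : ℕ) : LieRing (Irr n) where
  bracket _ _ := 0
  add_lie _ _ _ := (add_zero 0).symm
  lie_add _ _ _ := (add_zero 0).symm
  lie_self _ := rfl
  leibniz_lie _ _ _ := (add_zero 0).symm

instance (n : ℕ) : LieAlgebra ℂ (Irr n) where
  lie_smul t _ _ := (smul_zero t).symm

theorem Irr.lie_eq_zero (n : ℕ) (v w : Irr n) : ⁅v, w⁆ = 0 := rfl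

/-- The action of `sl(2)` on the abelian Lie algebra `V(n)` by derivations. -/
def sl2Der (n : ℕ) : Sl2 →ₗ⁅ℂ⁆ LieDerivation ℂ (Irr n) (Irr n) where
  toFun x :=
    { toLinearMap := LieModule.toEnd ℂ Sl2 (Irr n) x
      leibniz' := fun v w => by
        simp [Irr.lie_eq_zero] }
  map_add' x y := by
    ext v; simp
  map_smul' t x := by
    ext v; simp
  map_lie' := by
    intro x y
    ext v
    simp

/-- The Lie algebra `sl(2) ⋉ V(m)`, with `V(m)` an abelian ideal. -/
abbrev Sl2V (m : ℕ) : Type := LieAlgebra.SemiDirectSum (Irr m) Sl2 (sl2Der m)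

/-- The inclusion of `sl(2)` into `sl(2) ⋉ V(m)`. -/
abbrev inclSl2 (m : ℕ) : Sl2 →ₗ⁅ℂ⁆ Sl2V m := LieAlgebra.SemiDirectSum.inr (sl2Der m)

/-! ### Socle series and uniserial modules -/

section Socle

variable (L : Type*) [LieRing L] [LieAlgebra ℂ L]
variable (V : Type*) [AddCommGroup V] [Module ℂ V] [LieRingModule L V] [LieModule ℂ L V]

/-- The socle: the sum of all irreducible (that is, minimal nonzero) submodules. -/
def socle : LieSubmodule ℂ L V := sSup {N | IsAtom N}

/-- The socle series: `soc⁰ V = 0`, and `socⁱ⁺¹ V / socⁱ V` is the socle of `V / socⁱ V`. -/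
def socleSeries : ℕ → LieSubmodule ℂ L V
  | 0 => ⊥
  | i + 1 => (socle L (V ⧸ socleSeries i)).comap (LieSubmodule.Quotient.mk' (socleSeries i))

/-- A module is uniserial if its submodules form a chain. -/
def IsUniserial : Prop := ∀ N N' : LieSubmodule ℂ L V, N ≤ N' ∨ N' ≤ N

end Socle

/-- A finite-dimensional complex module over a complex Lie algebra. -/
structure FDModule.{u, v} (L : Type v) [LieRing L] [LieAlgebra ℂ L] where
  carrier : Type u
  [addCommGroup : AddCommGroup carrier]
  [module : Module ℂ carrier]
  [lieRingModule : LieRingModule L carrier]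
  [lieModule : LieModule ℂ L carrier]
  [finiteDimensional : FiniteDimensional ℂ carrier]

namespace FDModule

instance (L : Type*) [LieRing L] [LieAlgebra ℂ L] : CoeSort (FDModule L) (Type _) :=
  ⟨FDModule.carrier⟩

attribute [instance] FDModule.addCommGroup FDModule.module FDModule.lieRingModule
  FDModule.lieModule FDModule.finiteDimensional

/-- The dual module `V*`, with `(x f)(v) = - f (x v)`. -/
def dual {L : Type*} [LieRing L] [LieAlgebra ℂ L] (V : FDModule L) : FDModule L where
  carrier := V →ₗ[ℂ] ℂ

/-- Isomorphism of modules. -/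
def Iso {L : Type*} [LieRing L] [LieAlgebra ℂ L] (V : FDModule L) (W : FDModule L) : Prop :=
  Nonempty (V ≃ₗ⁅ℂ,L⁆ W)

end FDModule

/-- `V` has socle factors `V(a₁), …, V(aₙ)`: the socle series reaches `V` in `n` steps, and its
`i`-th factor, the socle of `V / socⁱ⁻¹ V`, is isomorphic to `V(aᵢ)` over `sl(2)`. -/
def HasSocleFactors {m : ℕ} (V : FDModule (Sl2V m)) (a : List ℕ) : Prop :=
  socleSeries (Sl2V m) V a.length = ⊤ ∧
    ∀ i : Fin a.length,
      ∃ φ : socle (Sl2V m) (V ⧸ socleSeries (Sl2V m) V i) ≃ₗ[ℂ] Irr (a.get i),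
        ∀ (s : Sl2) (x : socle (Sl2V m) (V ⧸ socleSeries (Sl2V m) V i)),
          φ ⁅inclSl2 m s, x⁆ = ⁅s, φ x⁆

/-- `V` is a uniserial `sl(2) ⋉ V(m)`-module with socle factors `V(a₁), …, V(aₙ)`. -/
def IsUniserialWith {m : ℕ} (V : FDModule (Sl2V m)) (a : List ℕ) : Prop :=
  IsUniserial (Sl2V m) V ∧ HasSocleFactors V a

/-- Up to isomorphism there is one and only one uniserial `sl(2) ⋉ V(m)`-module with socle factors
`V(a₁), …, V(aₙ)` (one exists in `Type`, and those in any universe are isomorphic to it). -/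
def ExistsUniqueUniserial.{u} (m : ℕ) (a : List ℕ) : Prop :=
  ∃ V : FDModule.{0} (Sl2V m), IsUniserialWith V a ∧
    ∀ W : FDModule.{u} (Sl2V m), IsUniserialWith W a → W.Iso V

end

universe u

-- Over `sl(2)` a module with the given socle factors is the direct sum of the V(aᵢ). Its structure
-- therefore lies in the action of V(m), which consists of equivariant maps V(m) × V(aⱼ) → V(aᵢ)
-- with i < j; the only further condition is that the operators of V(m) commute.
--
-- Equivariant maps are controlled by two facts. First, v₀ ⊗ v_b generates V(m) ⊗ V(b), and the
-- weight spaces of V(c) are lines, so equivariant maps V(m) × V(b) → V(c) are unique up to a scalar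
-- (`IsEquivariant.exists_eq_smul`). Second, for ℓ = 2m - 2k with k ≤ m the k-th transvectant yields
-- a nonzero T : V(m) × V(ℓ) → V(m). With B the invariant form, the trilinear form B(s, T(r, q)) has
-- parity (-1)ᵏ in r, s, and k is even exactly when ℓ ≡ 2m mod 4 (`exists_symmetric_map`).
--
-- On V(0) ⊕ V(m) ⊕ V(ℓ) put r(a, p, q) = (B(r, p), T(r, q), 0). The operators commute because of
-- that symmetry. Rescaling the lifts of the factors, and correcting the lift of V(ℓ) by a map to
-- V(m), brings every module to this form, hence uniqueness. For ℓ = 0 commutation means that B is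
-- symmetric; since B has parity (-1)ᵐ, this forces m to be even.
--
-- For V(0), V(m), V(m), V(0) with 4 ∣ m, the form B(s, T(r, q)) is symmetric in all three arguments
-- (`symmetric_of_trilinear`). The same normalisation leaves one scalar z, the coefficient of B on
-- the third summand: the correction that could remove it is already fixed by normalising the action
-- on the last V(0). An isomorphism between two normal forms acts on all layers by one common
-- scalar, so z is an invariant (`eq_of_intertwines_action₄`).
--
-- Socle series are handled through `UniserialChain`: the factors are irreducible over `sl(2)`, V(m)
-- lowers the chain by one step and not always by two. Such a chain contains every submodule, so it
-- is the socle series; conversely the socle series of a module with the prescribed factors is such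
-- a chain. Annihilators carry chains to the dual module. The only semisimplicity needed is the
-- splitting of surjections onto V(n), obtained from the Casimir operator.

universe v

/-! ### The standard triple of `sl(2)` and the standard basis of `V(n)` -/

/-- The standard basis element `h` of `sl(2)`. -/
def slH : Sl2 := ⟨!![1, 0; 0, -1],
  (by simp [Matrix.trace_fin_two] : Matrix.trace !![(1 : ℂ), 0; 0, -1] = 0)⟩

/-- The standard basis element `e` of `sl(2)`. -/
def slE : Sl2 := ⟨!![0, 1; 0, 0],
  (by simp [Matrix.trace_fin_two] : Matrix.trace !![(0 : ℂ), 1; 0, 0] = 0)⟩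

/-- The standard basis element `f` of `sl(2)`. -/
def slF : Sl2 := ⟨!![0, 0; 1, 0],
  (by simp [Matrix.trace_fin_two] : Matrix.trace !![(0 : ℂ), 0; 1, 0] = 0)⟩

theorem sl2_decomp (s : Sl2) : s = s.val 0 0 • slH + s.val 0 1 • slE + s.val 1 0 • slF := by
  have hs : s.val 1 1 = -s.val 0 0 := by
    have : Matrix.trace s.val = 0 := s.2
    rw [Matrix.trace_fin_two] at this
    linear_combination this
  apply Subtype.ext
  ext i j
  change s.val i j = (s.val 0 0 • !![1, 0; 0, -1] + s.val 0 1 • !![0, 1; 0, 0] +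
    s.val 1 0 • !![0, 0; 1, 0] : Matrix (Fin 2) (Fin 2) ℂ) i j
  fin_cases i <;> fin_cases j <;> simp [hs]

theorem isSl2Triple : IsSl2Triple slH slE slF where
  h_ne_zero h := by
    have := congrArg (fun s : Sl2 => s.val 0 0) h
    simp [slH] at this
  lie_e_f := by
    apply Subtype.ext
    rw [LieAlgebra.SpecialLinear.sl_bracket]
    ext i j
    fin_cases i <;> fin_cases j <;> simp [slH, slE, slF]
  lie_h_e_nsmul := by
    apply Subtype.ext
    rw [LieAlgebra.SpecialLinear.sl_bracket, two_nsmul]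
    change _ = slE.val + slE.val
    ext i j
    fin_cases i <;> fin_cases j <;> simp [slH, slE]
  lie_h_f_nsmul := by
    apply Subtype.ext
    rw [LieAlgebra.SpecialLinear.sl_bracket, two_nsmul]
    change _ = -(slF.val + slF.val)
    ext i j
    fin_cases i <;> fin_cases j <;> simp [slH, slF]
    norm_num

/-- A linear map that commutes with `h`, `e`, `f` is a homomorphism of `sl(2)`-modules. -/
theorem sl2_equivariant {M N : Type*} [AddCommGroup M] [Module ℂ M] [LieRingModule Sl2 M]
    [LieModule ℂ Sl2 M] [AddCommGroup N] [Module ℂ N] [LieRingModule Sl2 N] [LieModule ℂ Sl2 N]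
    (φ : M →ₗ[ℂ] N) (h : ∀ v, φ ⁅slH, v⁆ = ⁅slH, φ v⁆) (e : ∀ v, φ ⁅slE, v⁆ = ⁅slE, φ v⁆)
    (f : ∀ v, φ ⁅slF, v⁆ = ⁅slF, φ v⁆) (s : Sl2) (v : M) : φ ⁅s, v⁆ = ⁅s, φ v⁆ := by
  rw [sl2_decomp s]
  simp only [add_lie, smul_lie, map_add, map_smul, h, e, f]

namespace Irr

variable {n : ℕ}

/-- The coordinates of a vector of `V(n)`, extended by zero. -/
def coord (n i : ℕ) : Irr n →ₗ[ℂ] ℂ where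
  toFun v := if h : i < n + 1 then v ⟨i, h⟩ else 0
  map_add' v w := by
    split_ifs with h
    · rfl
    · simp
  map_smul' t v := by
    split_ifs with h
    · rfl
    · simp

theorem coord_of_lt {i : ℕ} (h : i < n + 1) (v : Irr n) : coord n i v = v ⟨i, h⟩ := by
  simp [coord, h]

theorem coord_of_gt {i : ℕ} (h : n < i) (v : Irr n) : coord n i v = 0 := by
  have : ¬ i < n + 1 := by omega
  simp [coord, this]

theorem ext_coord {v w : Irr n} (h : ∀ i ≤ n, coord n i v = coord n i w) : v = w := by
  funext i
  have := h i (by omega)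
  rwa [coord_of_lt i.2, coord_of_lt i.2] at this

/-- The standard basis vector `vᵢ` of `V(n)`, zero for `i > n`. -/
def vec (n i : ℕ) : Irr n := fun j => if (j : ℕ) = i then 1 else 0

theorem coord_vec {i j : ℕ} (hj : j ≤ n) : coord n j (vec n i) = if j = i then 1 else 0 := by
  rw [coord_of_lt (by omega)]
  rfl

theorem coord_vec_self {i : ℕ} (hi : i ≤ n) : coord n i (vec n i) = 1 := by
  simp [coord_vec hi]

theorem vec_of_gt {i : ℕ} (h : n < i) : vec n i = 0 :=
  ext_coord fun j hj => by rw [coord_vec hj, if_neg (by omega), map_zero]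

theorem vec_ne_zero {i : ℕ} (hi : i ≤ n) : vec n i ≠ 0 := fun h => by
  have := coord_vec_self hi
  rw [h, map_zero] at this
  exact zero_ne_one this

theorem eq_sum (v : Irr n) : v = ∑ i ∈ Finset.range (n + 1), coord n i v • vec n i := by
  refine ext_coord fun j hj => ?_
  rw [map_sum, Finset.sum_eq_single j]
  · simp [coord_vec_self hj]
  · intro i _ hij
    simp [coord_vec hj, hij.symm]
  · intro h
    exact absurd (Finset.mem_range.2 (by omega)) h

theorem lie_apply (s : Sl2) (v : Irr n) (i : Fin (n + 1)) :
    ⁅s, v⁆ i = ∑ j, sl2Mat n s.val i j * v j := rfl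

theorem coord_h (v : Irr n) (i : ℕ) : coord n i ⁅slH, v⁆ = ((n : ℂ) - 2 * i) * coord n i v := by
  by_cases hi : i < n + 1
  · rw [coord_of_lt hi, coord_of_lt hi, lie_apply, Finset.sum_eq_single ⟨i, hi⟩]
    · simp [slH, sl2Mat, Hmat]
    · intro j _ hj
      simp [slH, sl2Mat, Hmat, hj.symm]
    · simp
  · rw [coord_of_gt (by omega), coord_of_gt (by omega), mul_zero]

theorem coord_e (v : Irr n) (i : ℕ) :
    coord n i ⁅slE, v⁆ = ((n : ℂ) - i) * coord n (i + 1) v := by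
  by_cases hi : i < n + 1
  · rw [coord_of_lt hi, lie_apply]
    by_cases hi' : i + 1 < n + 1
    · rw [coord_of_lt hi', Finset.sum_eq_single ⟨i + 1, hi'⟩]
      · simp [slE, sl2Mat, Emat]
      · intro j _ hj
        have : (j : ℕ) ≠ i + 1 := fun h => hj (Fin.ext h)
        simp [slE, sl2Mat, Emat, this]
      · simp
    · rw [coord_of_gt (by omega), mul_zero]
      refine Finset.sum_eq_zero fun j _ => ?_
      have : (j : ℕ) ≠ i + 1 := by omega
      simp [slE, sl2Mat, Emat, this]
  · rw [coord_of_gt (by omega), coord_of_gt (by omega), mul_zero]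

theorem coord_f_zero (v : Irr n) : coord n 0 ⁅slF, v⁆ = 0 := by
  rw [coord_of_lt (by omega), lie_apply]
  refine Finset.sum_eq_zero fun j _ => ?_
  simp [slF, sl2Mat, Fmat]

theorem coord_f_succ (v : Irr n) {i : ℕ} (hi : i + 1 ≤ n) :
    coord n (i + 1) ⁅slF, v⁆ = (i + 1) * coord n i v := by
  rw [coord_of_lt (by omega), coord_of_lt (by omega), lie_apply,
    Finset.sum_eq_single ⟨i, by omega⟩]
  · simp [slF, sl2Mat, Fmat]
  · intro j _ hj
    have : i ≠ (j : ℕ) := fun h => hj (Fin.ext h.symm)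
    simp [slF, sl2Mat, Fmat, this]
  · simp

theorem h_vec (i : ℕ) : ⁅slH, vec n i⁆ = ((n : ℂ) - 2 * i) • vec n i := by
  refine ext_coord fun j hj => ?_
  rw [coord_h, map_smul, smul_eq_mul, coord_vec hj]
  split_ifs with h
  · rw [h]
  · simp

theorem e_vec_zero : ⁅slE, vec n 0⁆ = 0 := by
  refine ext_coord fun j hj => ?_
  rw [coord_e, map_zero]
  rcases hj.eq_or_lt with rfl | hj
  · simp
  · simp [coord_vec (show j + 1 ≤ n from hj)]

theorem e_vec_succ (i : ℕ) : ⁅slE, vec n (i + 1)⁆ = ((n : ℂ) - i) • vec n i := by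
  refine ext_coord fun j hj => ?_
  rw [coord_e, map_smul, smul_eq_mul, coord_vec hj]
  rcases hj.eq_or_lt with rfl | hj
  · split_ifs with h <;> simp [h]
  · rw [coord_vec (show j + 1 ≤ n from hj)]
    by_cases h : j = i <;> simp [h]

theorem f_vec (i : ℕ) : ⁅slF, vec n i⁆ = ((i : ℂ) + 1) • vec n (i + 1) := by
  refine ext_coord fun j hj => ?_
  rw [map_smul, smul_eq_mul, coord_vec hj]
  cases j with
  | zero => simp [coord_f_zero]
  | succ j =>
    rw [coord_f_succ _ hj, coord_vec (by omega)]
    by_cases h : j = i <;> simp [h]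

theorem eq_top_of_vec_mem {K : Submodule ℂ (Irr n)} (h : ∀ i ≤ n, vec n i ∈ K) : K = ⊤ := by
  rw [eq_top_iff]
  intro v _
  rw [eq_sum v]
  exact K.sum_mem fun i hi => K.smul_mem _ (h i (by have := Finset.mem_range.1 hi; omega))

/-- The highest weight vector generates `V(n)` under `f`. -/
theorem eq_top_of_vec_zero_mem {K : Submodule ℂ (Irr n)} (hf : ∀ v ∈ K, ⁅slF, v⁆ ∈ K)
    (h0 : vec n 0 ∈ K) : K = ⊤ := by
  refine eq_top_of_vec_mem fun i _ => ?_
  induction i with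
  | zero => exact h0
  | succ i ih =>
    have := hf _ (ih (by omega))
    rw [f_vec] at this
    exact (K.smul_mem_iff (Nat.cast_add_one_ne_zero i)).1 this

/-- The lowest weight vector generates `V(n)` under `e`. -/
theorem eq_top_of_vec_last_mem {K : Submodule ℂ (Irr n)} (he : ∀ v ∈ K, ⁅slE, v⁆ ∈ K)
    (h0 : vec n n ∈ K) : K = ⊤ := by
  have key : ∀ k ≤ n, vec n (n - k) ∈ K := by
    intro k hk
    induction k with
    | zero => exact h0
    | succ k ih =>
      have := he _ (ih (by omega))
      rw [show n - k = n - (k + 1) + 1 by omega, e_vec_succ] at this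
      refine (K.smul_mem_iff ?_).1 this
      rw [← Nat.cast_sub (by omega)]
      exact Nat.cast_ne_zero.2 (by omega)
  refine eq_top_of_vec_mem fun i hi => ?_
  have := key (n - i) (by omega)
  rwa [Nat.sub_sub_self hi] at this

/-- `V(n)` is irreducible. -/
theorem eq_top_of_ne_bot {K : Submodule ℂ (Irr n)} (he : ∀ v ∈ K, ⁅slE, v⁆ ∈ K)
    (hf : ∀ v ∈ K, ⁅slF, v⁆ ∈ K) (hK : K ≠ ⊥) : K = ⊤ := by
  -- Here i is the last index with a nonzero coordinate. Applying e lowers it by one, until a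
  -- multiple of v₀ remains.
  have key : ∀ i ≤ n, ∀ v ∈ K, coord n i v ≠ 0 → (∀ j, i < j → coord n j v = 0) →
      vec n 0 ∈ K := by
    intro i
    induction i with
    | zero =>
      intro _ v hv h0 hj
      have : v = coord n 0 v • vec n 0 := by
        refine ext_coord fun j hjn => ?_
        rw [map_smul, smul_eq_mul, coord_vec hjn]
        split_ifs with h
        · simp [h]
        · rw [hj j (by omega), mul_zero]
      rw [this] at hv
      exact (K.smul_mem_iff h0).1 hv
    | succ i ih =>
      intro hi v hv h0 hj
      refine ih (by omega) _ (he v hv) ?_ ?_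
      · rw [coord_e]
        refine mul_ne_zero ?_ h0
        rw [← Nat.cast_sub (by omega)]
        exact Nat.cast_ne_zero.2 (by omega)
      · intro j hij
        rw [coord_e, hj _ (by omega), mul_zero]
  obtain ⟨v, hv, hv0⟩ := K.ne_bot_iff.1 hK
  refine eq_top_of_vec_zero_mem hf ?_
  have hex : ∃ i, i ≤ n ∧ coord n i v ≠ 0 := by
    by_contra! hcon
    exact hv0 (ext_coord fun i hi => by rw [hcon i hi, map_zero])
  obtain ⟨i, hi⟩ := hex
  have hmax := Nat.findGreatest_spec (P := fun i => coord n i v ≠ 0) hi.1 hi.2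
  refine key _ (Nat.findGreatest_le n) v hv hmax fun j hj => ?_
  by_cases hjn : j ≤ n
  · by_contra hne
    exact absurd (Nat.le_findGreatest (P := fun i => coord n i v ≠ 0) hjn hne) (by omega)
  · exact coord_of_gt (by omega) v

/-- The weight spaces of `V(n)` are spanned by the `vᵢ`. -/
theorem eq_smul_vec_of_weight {v : Irr n} {i : ℕ} (hv : ⁅slH, v⁆ = ((n : ℂ) - 2 * i) • v) :
    v = coord n i v • vec n i := by
  refine ext_coord fun j hj => ?_
  rw [map_smul, smul_eq_mul, coord_vec hj]
  split_ifs with h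
  · simp [h]
  · have := congrArg (coord n j) hv
    rw [coord_h, map_smul, smul_eq_mul] at this
    have h' : ((i : ℂ) - j) * coord n j v = 0 := by linear_combination this / 2
    rcases mul_eq_zero.1 h' with h' | h'
    · exact absurd (by exact_mod_cast (sub_eq_zero.1 h').symm) h
    · simp [h']

/-- The weights of `V(n)` are `n, n - 2, …, -n`. -/
theorem exists_weight {v : Irr n} (hv0 : v ≠ 0) {μ : ℂ} (hv : ⁅slH, v⁆ = μ • v) :
    ∃ i ≤ n, μ = (n : ℂ) - 2 * i := by
  by_contra! hcon
  refine hv0 (ext_coord fun i hi => ?_)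
  have := congrArg (coord n i) hv
  rw [coord_h, map_smul, smul_eq_mul] at this
  have h' : (μ - ((n : ℂ) - 2 * i)) * coord n i v = 0 := by linear_combination -this
  rw [map_zero]
  exact (mul_eq_zero.1 h').resolve_left (sub_ne_zero.2 (hcon i hi))

section Hom

variable {M : Type*} [AddCommGroup M] [Module ℂ M] [LieRingModule Sl2 M]

theorem hom_ext {φ ψ : Irr n →ₗ⁅ℂ,Sl2⁆ M} (h : φ (vec n 0) = ψ (vec n 0)) : φ = ψ := by
  have : LinearMap.eqLocus (φ : Irr n →ₗ[ℂ] M) (ψ : Irr n →ₗ[ℂ] M) = ⊤ := by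
    refine eq_top_of_vec_zero_mem (fun v hv => ?_) h
    have hv : φ v = ψ v := hv
    change φ ⁅slF, v⁆ = ψ ⁅slF, v⁆
    rw [LieModuleHom.map_lie, LieModuleHom.map_lie, hv]
  ext v
  exact (this ▸ Submodule.mem_top : v ∈ LinearMap.eqLocus (φ : Irr n →ₗ[ℂ] M) ψ)

variable [LieModule ℂ Sl2 M]

/-- The linear map `V(n) → M` that sends `vᵢ` to `fⁱ w / i!`. -/
noncomputable def lift (n : ℕ) (w : M) : Irr n →ₗ[ℂ] M :=
  ∑ i ∈ Finset.range (n + 1),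
    (coord n i).smulRight ((i.factorial : ℂ)⁻¹ • ((LieModule.toEnd ℂ Sl2 M slF) ^ i) w)

theorem lift_vec (w : M) {i : ℕ} (hi : i ≤ n) :
    lift n w (vec n i) = (i.factorial : ℂ)⁻¹ • ((LieModule.toEnd ℂ Sl2 M slF) ^ i) w := by
  rw [lift, LinearMap.sum_apply, Finset.sum_eq_single i]
  · simp [coord_vec_self hi]
  · intro j hj hji
    have : j ≤ n := by have := Finset.mem_range.1 hj; omega
    simp [coord_vec this, hji]
  · intro h
    exact absurd (Finset.mem_range.2 (by omega)) h

/-- A highest weight vector of weight `n` is the image of `v₀` under a homomorphism. -/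
theorem exists_hom [FiniteDimensional ℂ M] {w : M} (hh : ⁅slH, w⁆ = (n : ℂ) • w)
    (he : ⁅slE, w⁆ = 0) : ∃ φ : Irr n →ₗ⁅ℂ,Sl2⁆ M, φ (vec n 0) = w := by
  by_cases hw : w = 0
  · exact ⟨0, by simp [hw]⟩
  have P : isSl2Triple.HasPrimitiveVectorWith w (n : ℂ) := ⟨hw, hh, he⟩
  have hz : ∀ i, n < i → ((LieModule.toEnd ℂ Sl2 M slF) ^ i) w = 0 := by
    intro i hi
    obtain ⟨k, rfl⟩ := Nat.exists_eq_add_of_lt hi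
    rw [show n + k + 1 = k + (n + 1) by ring, pow_add, Module.End.mul_apply,
      P.pow_toEnd_f_eq_zero_of_eq_nat rfl, map_zero]
  -- Both sides vanish for i > n, so the formula holds for all i and the action of f on the last
  -- basis vector needs no separate case.
  have hlift : ∀ i, lift n w (vec n i) =
      (i.factorial : ℂ)⁻¹ • ((LieModule.toEnd ℂ Sl2 M slF) ^ i) w := by
    intro i
    by_cases hi : i ≤ n
    · exact lift_vec w hi
    · rw [hz i (by omega), vec_of_gt (by omega)]
      simp
  have hfac : ∀ i : ℕ, (((i + 1).factorial : ℕ) : ℂ)⁻¹ * ((i : ℂ) + 1) = (i.factorial : ℂ)⁻¹ := by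
    intro i
    have h1 : (i.factorial : ℂ) ≠ 0 := Nat.cast_ne_zero.2 i.factorial_ne_zero
    have h2 : (i : ℂ) + 1 ≠ 0 := Nat.cast_add_one_ne_zero i
    rw [Nat.factorial_succ]
    push_cast
    field_simp
  have ext_vec : ∀ A B : Irr n →ₗ[ℂ] M, (∀ i, A (vec n i) = B (vec n i)) → A = B := by
    intro A B h
    ext v
    rw [eq_sum v]
    simp only [map_sum, map_smul, h]
  have key : ∀ x : Sl2, (∀ i, lift n w ⁅x, vec n i⁆ = ⁅x, lift n w (vec n i)⁆) →
      ∀ v, lift n w ⁅x, v⁆ = ⁅x, lift n w v⁆ := fun x hx =>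
    LinearMap.congr_fun (ext_vec (lift n w ∘ₗ LieModule.toEnd ℂ Sl2 (Irr n) x)
      (LieModule.toEnd ℂ Sl2 M x ∘ₗ lift n w) hx)
  have hH := key slH fun i => by
    rw [h_vec, map_smul, hlift, lie_smul, P.lie_h_pow_toEnd_f, smul_comm]
  have hE := key slE fun i => by
    rw [hlift i]
    cases i with
    | zero => simp [e_vec_zero, he]
    | succ i =>
      rw [e_vec_succ, map_smul, hlift, lie_smul, P.lie_e_pow_succ_toEnd_f, smul_smul,
        smul_smul, ← mul_assoc, hfac, mul_comm]
  have hF := key slF fun i => by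
    rw [f_vec, map_smul, hlift, hlift, lie_smul, P.lie_f_pow_toEnd_f, smul_smul,
      mul_comm, hfac]
  refine ⟨{ lift n w with map_lie' := fun {s v} => sl2_equivariant _ hH hE hF s v }, ?_⟩
  change lift n w (vec n 0) = w
  rw [hlift]
  simp

end Hom

end Irr

/-! ### Splitting of surjections onto `V(n)` -/

section Operators

open Polynomial

variable {M : Type*} [AddCommGroup M] [Module ℂ M]

theorem eq_zero_of_aeval_coprime {H : Module.End ℂ M} {p q : ℂ[X]} (hpq : IsCoprime p q) {u : M}
    (hp : aeval H p u = 0) (hq : aeval H q u = 0) : u = 0 := by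
  have := Polynomial.disjoint_ker_aeval_of_isCoprime H hpq
  exact (Submodule.disjoint_def.1 this) u hp hq

theorem isCoprime_X_sub_C {a b : ℂ} (h : a ≠ b) : IsCoprime (X - C a) (X - C b) :=
  isCoprime_X_sub_C_of_isUnit_sub (sub_ne_zero.2 h).isUnit

theorem aeval_X_sub_C (H : Module.End ℂ M) (μ : ℂ) :
    aeval H (X - C μ) = H - algebraMap ℂ (Module.End ℂ M) μ := by simp

theorem commute_aeval_right {A B : Module.End ℂ M} (h : Commute A B) (q : ℂ[X]) :
    Commute A (aeval B q) := by
  induction q using Polynomial.induction_on' with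
  | add q r hq hr => simpa using hq.add_right hr
  | monomial n c =>
    rw [aeval_monomial]
    exact (Algebra.commute_algebraMap_right _ _).mul_right (h.pow_right n)

/-- Each factor E shifts generalised eigenvalues of H by c: the relation says (H - μ - c) E = E (H -
μ). -/
theorem semiconjBy_pow_shift {H E : Module.End ℂ M} {c : ℂ} (h : H * E = E * H + c • E) (μ : ℂ)
    (j k : ℕ) : SemiconjBy (E ^ j) (aeval H ((X - C μ) ^ k)) (aeval H ((X - C (μ + c * j)) ^ k)) := by
  rw [map_pow, map_pow, aeval_X_sub_C, aeval_X_sub_C]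
  refine SemiconjBy.pow_right ?_ k
  induction j with
  | zero => simp [SemiconjBy]
  | succ j ih =>
    rw [pow_succ']
    refine SemiconjBy.mul_left ?_ ih
    rw [SemiconjBy, sub_mul, mul_sub, h, ← Algebra.commutes, ← sub_eq_zero]
    simp only [Algebra.algebraMap_eq_smul_one, smul_mul_assoc, one_mul]
    push_cast
    module

/-- An operator `E` with `[H, E] = c E`, `c ≠ 0`, acts nilpotently on generalized eigenvectors
of `H`. -/
theorem exists_pow_apply_eq_zero [FiniteDimensional ℂ M] {H E : Module.End ℂ M} {c : ℂ} (hc : c ≠ 0)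
    (h : H * E = E * H + c • E) {μ : ℂ} {k : ℕ} {w : M} (hw : aeval H ((X - C μ) ^ k) w = 0) :
    ∃ N, ∀ j, N ≤ j → (E ^ j) w = 0 := by
  have hne : minpoly ℂ H ≠ 0 := minpoly.ne_zero (Algebra.IsIntegral.isIntegral H)
  have hinf : (Set.range fun j : ℕ => μ + c * j).Infinite :=
    Set.infinite_range_of_injective fun i j hij => by
      have := mul_left_cancel₀ hc (add_left_cancel hij)
      exact_mod_cast this
  -- The vector Eᴺ w is a generalised eigenvector for μ + cN. The minimal polynomial of H has
  -- finitely many roots, so N can be chosen to miss them, and then Eᴺ w = 0.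
  obtain ⟨_, ⟨N, rfl⟩, hN⟩ := hinf.exists_notMem_finset (minpoly ℂ H).roots.toFinset
  have hN : ¬ (minpoly ℂ H).IsRoot (μ + c * N) := by
    simpa [hne] using hN
  have h0 : (E ^ N) w = 0 := by
    refine eq_zero_of_aeval_coprime (H := H) (p := (X - C (μ + c * N)) ^ k) (q := minpoly ℂ H)
      ?_ ?_ ?_
    · refine IsCoprime.pow_left ?_
      exact (irreducible_X_sub_C _).coprime_iff_not_dvd.2 fun hd => hN (dvd_iff_isRoot.1 hd)
    · have := (semiconjBy_pow_shift h μ N k).eq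
      have := LinearMap.congr_fun this w
      rw [Module.End.mul_apply, Module.End.mul_apply, hw, map_zero] at this
      exact this.symm
    · rw [minpoly.aeval]
      rfl
  refine ⟨N, fun j hj => ?_⟩
  rw [← Nat.sub_add_cancel hj, pow_add, Module.End.mul_apply, h0, map_zero]

/-- A lift of an eigenvector can be projected to a generalized eigenvector. -/
theorem exists_generalized_lift [FiniteDimensional ℂ M] {N : Type*} [AddCommGroup N] [Module ℂ N] (p : M →ₗ[ℂ] N)
    {T : Module.End ℂ M} {S : Module.End ℂ N} (hp : ∀ x, p (T x) = S (p x)) {μ : ℂ} (w : M)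
    (hw : S (p w) = μ • p w) :
    ∃ (q : ℂ[X]) (k : ℕ), p (aeval T q w) = p w ∧ aeval T ((X - C μ) ^ k) (aeval T q w) = 0 := by
  have hne : minpoly ℂ T ≠ 0 := minpoly.ne_zero (Algebra.IsIntegral.isIntegral T)
  obtain ⟨g, hg, hgd⟩ := exists_eq_pow_rootMultiplicity_mul_and_not_dvd _ hne μ
  have hg0 : g.eval μ ≠ 0 := fun h0 => hgd (dvd_iff_isRoot.2 h0)
  have hev : ∀ q : ℂ[X], p (aeval T q w) = q.eval μ • p w := by
    intro q
    induction q using Polynomial.induction_on' with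
    | add q r hq hr => simp [hq, hr, add_smul]
    | monomial n c =>
      rw [aeval_monomial, eval_monomial, mul_smul]
      simp only [Module.End.mul_apply, Module.algebraMap_end_apply, map_smul]
      congr 1
      induction n with
      | zero => simp
      | succ n ih => rw [pow_succ', Module.End.mul_apply, hp, ih, map_smul, hw, smul_smul, pow_succ]
  -- The cofactor g of the power of X - μ in the minimal polynomial projects to the generalised
  -- eigenspace; it acts on `p w` by g(μ) ≠ 0, which is divided out.
  refine ⟨C (g.eval μ)⁻¹ * g, (minpoly ℂ T).rootMultiplicity μ, ?_, ?_⟩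
  · rw [hev]
    simp [hg0]
  · rw [← Module.End.mul_apply, ← map_mul, mul_left_comm, ← hg, map_mul, minpoly.aeval]
    simp

variable {H E F : Module.End ℂ M}

/-- On ker E one has E Fⁿ⁺¹ = (n + 1) Fⁿ (H - n), and H - n preserves ker E, so the factors come off
one at a time. The use is to turn nilpotency of F into a polynomial in H with simple roots that
kills w. -/
theorem pow_mul_pow_apply (hHE : H * E = E * H + (2 : ℂ) • E) (hHF : H * F = F * H + (-2 : ℂ) • F)
    (hEF : E * F = F * E + H) (n : ℕ) (w : M) (hw : E w = 0) :
    (E ^ n) ((F ^ n) w) =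
      (n.factorial : ℂ) • aeval H (∏ j ∈ Finset.range n, (X - C (j : ℂ))) w := by
  have hHFn : ∀ n : ℕ, H * F ^ n = F ^ n * H + (-2 * n : ℂ) • F ^ n := by
    intro n
    induction n with
    | zero => simp
    | succ n ih =>
      rw [pow_succ, ← mul_assoc, ih, add_mul, mul_assoc, hHF, smul_mul_assoc]
      push_cast
      simp only [mul_add, mul_smul_comm, mul_assoc]
      module
  have hEFn : ∀ n : ℕ, ∀ w : M, E w = 0 →
      E ((F ^ (n + 1)) w) = ((n : ℂ) + 1) • (F ^ n) ((H - algebraMap ℂ _ (n : ℂ)) w) := by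
    intro n
    induction n with
    | zero =>
      intro w hw
      have := LinearMap.congr_fun hEF w
      simp only [Module.End.mul_apply, LinearMap.add_apply, hw, map_zero, zero_add] at this
      simp [this]
    | succ n ih =>
      intro w hw
      have h1 := LinearMap.congr_fun hEF ((F ^ (n + 1)) w)
      have h2 := LinearMap.congr_fun (hHFn (n + 1)) w
      simp only [Module.End.mul_apply, LinearMap.add_apply, LinearMap.smul_apply] at h1 h2
      rw [pow_succ' F (n + 1), Module.End.mul_apply, h1, ih w hw, h2, map_smul,
        ← Module.End.mul_apply F, ← pow_succ']
      simp only [LinearMap.sub_apply, Module.algebraMap_end_apply, map_sub, map_smul]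
      push_cast
      module
  induction n generalizing w with
  | zero => simp
  | succ n ih =>
    have hk : E ((H - algebraMap ℂ _ (n : ℂ)) w) = 0 := by
      have := LinearMap.congr_fun hHE w
      simp only [Module.End.mul_apply, LinearMap.add_apply, LinearMap.smul_apply, hw, map_zero,
        smul_zero, add_zero] at this
      simp [← this, hw]
    rw [pow_succ, Module.End.mul_apply, hEFn n w hw, map_smul, ih _ hk, Finset.prod_range_succ,
      map_mul, Module.End.mul_apply, aeval_X_sub_C, smul_smul, Nat.factorial_succ]
    push_cast
    rfl

/-- On a highest weight vector, generalized weights are weights. -/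
theorem apply_eq_smul_of_generalized [FiniteDimensional ℂ M] (hHE : H * E = E * H + (2 : ℂ) • E)
    (hHF : H * F = F * H + (-2 : ℂ) • F) (hEF : E * F = F * E + H) {a k : ℕ} {w : M}
    (hw : E w = 0) (hk : aeval H ((X - C (a : ℂ)) ^ k) w = 0) : H w = (a : ℂ) • w := by
  obtain ⟨N, hN⟩ := exists_pow_apply_eq_zero (by norm_num) hHF hk
  -- The exponent is large enough to kill w under F and to put j = a among the factors. The other
  -- factors are coprime to (X - a)ᵏ, so H - a alone kills w.
  have h0 := pow_mul_pow_apply hHE hHF hEF (max N (a + 1)) w hw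
  rw [hN _ (le_max_left _ _), map_zero, eq_comm,
    smul_eq_zero_iff_right (Nat.cast_ne_zero.2 (Nat.factorial_ne_zero _)),
    ← Finset.prod_erase_mul _ _ (Finset.mem_range.2 (show a < max N (a + 1) by omega)),
    map_mul, Module.End.mul_apply] at h0
  have hu : aeval H (X - C (a : ℂ)) w = 0 := by
    refine eq_zero_of_aeval_coprime (H := H) (q := (X - C (a : ℂ)) ^ k) ?_ h0 ?_
    · refine IsCoprime.pow_right (IsCoprime.prod_left fun j hj => isCoprime_X_sub_C ?_)
      exact_mod_cast (Finset.mem_erase.1 hj).1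
    · rw [← Module.End.mul_apply, ← map_mul, mul_comm, map_mul, Module.End.mul_apply, hk, map_zero]
  rwa [aeval_X_sub_C, LinearMap.sub_apply, Module.algebraMap_end_apply, sub_eq_zero] at hu

/-- The Casimir operator of an `sl(2)`-triple of operators. -/
def casimirOp (H E F : Module.End ℂ M) : Module.End ℂ M :=
  H * H + (2 : ℂ) • H + (4 : ℂ) • (F * E)

theorem commute_casimirOp_e (hHE : H * E = E * H + (2 : ℂ) • E) (hEF : E * F = F * E + H) :
    Commute E (casimirOp H E F) := by
  have h1 : E * H = H * E - (2 : ℂ) • E := by rw [hHE]; abel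
  have e1 : E * (H * H) = H * (H * E) - (4 : ℂ) • (H * E) + (4 : ℂ) • E := by
    rw [← mul_assoc, h1, sub_mul, mul_assoc, h1, mul_sub, smul_mul_assoc, h1, mul_smul_comm]
    module
  have e2 : E * (F * E) = F * (E * E) + H * E := by
    rw [← mul_assoc, hEF, add_mul, mul_assoc]
  rw [Commute, SemiconjBy, casimirOp, mul_add, mul_add, mul_smul_comm, mul_smul_comm, e1, e2, h1,
    add_mul, add_mul, smul_mul_assoc, smul_mul_assoc, mul_assoc, mul_assoc]
  module

theorem commute_casimirOp_h (hHE : H * E = E * H + (2 : ℂ) • E)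
    (hHF : H * F = F * H + (-2 : ℂ) • F) : Commute H (casimirOp H E F) := by
  have e2 : H * (F * E) = F * E * H := by
    rw [← mul_assoc, hHF, add_mul, mul_assoc, hHE, mul_add, smul_mul_assoc, mul_smul_comm,
      mul_assoc]
    module
  rw [Commute, SemiconjBy, casimirOp, mul_add, mul_add, mul_smul_comm, mul_smul_comm, e2,
    add_mul, add_mul, smul_mul_assoc, smul_mul_assoc, mul_assoc H H H]

/-- On ker E the term `F * E` drops out, and H preserves that kernel. -/
theorem aeval_casimirOp_apply (hHE : H * E = E * H + (2 : ℂ) • E) (μ : ℂ) (k : ℕ) {u : M}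
    (hu : E u = 0) : aeval (casimirOp H E F) ((X - C μ) ^ k) u =
      aeval H ((X * X + C 2 * X - C μ) ^ k) u := by
  induction k generalizing u with
  | zero => simp
  | succ k ih =>
    have hEH : E (H u) = 0 := by
      have := LinearMap.congr_fun hHE u
      simpa [hu] using this.symm
    have hEHH : E (H (H u)) = 0 := by
      have := LinearMap.congr_fun hHE (H u)
      simpa [hEH] using this.symm
    have h1 : aeval (casimirOp H E F) (X - C μ) u = aeval H (X * X + C 2 * X - C μ) u := by
      simp [casimirOp, hu, Algebra.algebraMap_eq_smul_one]
    rw [pow_succ, pow_succ, map_mul, map_mul, Module.End.mul_apply, Module.End.mul_apply, ← ih, h1]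
    simp [Algebra.algebraMap_eq_smul_one, hEH, hEHH, hu]

/-- A vector of generalized weight `a` in the block of `V(a)` is a highest weight vector. -/
theorem apply_e_eq_zero_of_casimirOp [FiniteDimensional ℂ M] (hHE : H * E = E * H + (2 : ℂ) • E)
    (hEF : E * F = F * E + H) {a k l : ℕ} {w : M} (hk : aeval H ((X - C (a : ℂ)) ^ k) w = 0)
    (hl : aeval (casimirOp H E F) ((X - C (a * (a + 2) : ℂ)) ^ l) w = 0) : E w = 0 := by
  -- The vector u = Eʲ w is killed by E, so the Casimir condition allows it only the generalised
  -- weights a and -(a + 2). By the shift it has generalised weight a + 2j, which is neither, so u =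
  -- 0.
  have key : ∀ j, 1 ≤ j → (E ^ (j + 1)) w = 0 → (E ^ j) w = 0 := by
    intro j hj h0
    have hE : E ((E ^ j) w) = 0 := by rwa [pow_succ', Module.End.mul_apply] at h0
    refine eq_zero_of_aeval_coprime (H := H) (p := (X * X + C 2 * X - C (a * (a + 2) : ℂ)) ^ l)
      (q := (X - C (a + 2 * j : ℂ)) ^ k) ?_ ?_ ?_
    · refine IsCoprime.pow ?_
      have : (X * X + C 2 * X - C (a * (a + 2) : ℂ)) = (X - C (a : ℂ)) * (X - C (-(a + 2) : ℂ)) := by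
        simp only [map_mul, map_neg, map_add]
        ring
      rw [this]
      refine IsCoprime.mul_left (isCoprime_X_sub_C fun h => ?_) (isCoprime_X_sub_C fun h => ?_)
      · have : a = a + 2 * j := by exact_mod_cast h
        omega
      · have h' : ((a + 2 * j + (a + 2) : ℕ) : ℂ) = 0 := by push_cast; rw [← h]; ring
        have := Nat.cast_eq_zero.1 h'
        omega
    · rw [← aeval_casimirOp_apply hHE _ l hE, ← Module.End.mul_apply]
      have hc : Commute (E ^ j) (aeval (casimirOp H E F) ((X - C (a * (a + 2) : ℂ)) ^ l)) := by
        rw [map_pow, aeval_X_sub_C]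
        exact ((((commute_casimirOp_e hHE hEF).sub_right
          (Algebra.commute_algebraMap_right _ _)).pow_right l).pow_left j)
      rw [← hc.eq, Module.End.mul_apply, hl, map_zero]
    · have := LinearMap.congr_fun (semiconjBy_pow_shift hHE (a : ℂ) j k).eq w
      rw [Module.End.mul_apply, Module.End.mul_apply, hk, map_zero] at this
      exact this.symm
  obtain ⟨N, hN⟩ := exists_pow_apply_eq_zero (by norm_num) hHE hk
  have : ∀ i, (E ^ (N + 1 - i)) w = 0 ∨ N ≤ i := by
    intro i
    induction i with
    | zero => exact Or.inl (hN _ (by omega))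
    | succ i ih =>
      by_cases hi : N ≤ i + 1
      · exact Or.inr hi
      · refine Or.inl (key _ (by omega) ?_)
        rw [show N + 1 - (i + 1) + 1 = N + 1 - i by omega]
        exact ih.resolve_right (by omega)
  rcases Nat.lt_or_ge N 2 with h2 | h2
  · simpa using hN 1 (by omega)
  · have h3 := (this (N - 1)).resolve_right (by omega)
    rw [show N + 1 - (N - 1) = 1 + 1 by omega] at h3
    simpa using key 1 le_rfl h3

end Operators

namespace Irr

variable {M : Type*} [AddCommGroup M] [Module ℂ M] [LieRingModule Sl2 M] [LieModule ℂ Sl2 M]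

/-- A homomorphism from a finite-dimensional `sl(2)`-module onto `V(n)` has a section. -/
theorem exists_section [FiniteDimensional ℂ M] {n : ℕ} (p : M →ₗ⁅ℂ,Sl2⁆ Irr n)
    (hp : Function.Surjective p) : ∃ σ : Irr n →ₗ⁅ℂ,Sl2⁆ M, ∀ x, p (σ x) = x := by
  set H := LieModule.toEnd ℂ Sl2 M slH with hH
  set E := LieModule.toEnd ℂ Sl2 M slE with hE
  set F := LieModule.toEnd ℂ Sl2 M slF with hF
  have hHE : H * E = E * H + (2 : ℂ) • E := by
    ext v
    change ⁅slH, ⁅slE, v⁆⁆ = ⁅slE, ⁅slH, v⁆⁆ + (2 : ℂ) • ⁅slE, v⁆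
    rw [leibniz_lie, isSl2Triple.lie_h_e_smul ℂ, smul_lie, add_comm]
  have hHF : H * F = F * H + (-2 : ℂ) • F := by
    ext v
    change ⁅slH, ⁅slF, v⁆⁆ = ⁅slF, ⁅slH, v⁆⁆ + (-2 : ℂ) • ⁅slF, v⁆
    rw [leibniz_lie, isSl2Triple.lie_lie_smul_f ℂ, neg_lie, smul_lie, add_comm, neg_smul]
  have hEF : E * F = F * E + H := by
    ext v
    change ⁅slE, ⁅slF, v⁆⁆ = ⁅slF, ⁅slE, v⁆⁆ + ⁅slH, v⁆
    rw [leibniz_lie, isSl2Triple.lie_e_f, add_comm]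
  -- A preimage of v₀ is projected to the generalised eigenspace of the Casimir operator for n(n +
  -- 2), then to generalised weight n. Since H commutes with the Casimir operator, the second
  -- projection preserves the first property, and the result is a highest weight vector above v₀.
  obtain ⟨w₀, hw₀⟩ := hp (vec n 0)
  have hpH : ∀ x, p (H x) = LieModule.toEnd ℂ Sl2 (Irr n) slH (p x) := fun x => p.map_lie _ _
  have hpC : ∀ x, p (casimirOp H E F x) =
      casimirOp (LieModule.toEnd ℂ Sl2 (Irr n) slH) (LieModule.toEnd ℂ Sl2 (Irr n) slE)
        (LieModule.toEnd ℂ Sl2 (Irr n) slF) (p x) := by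
    intro x
    simp [casimirOp, hH, hE, hF]
  obtain ⟨q₁, l, hq₁, hl⟩ := exists_generalized_lift (p : M →ₗ[ℂ] Irr n) hpC
    (μ := (n * (n + 2) : ℂ)) w₀ (by
      change casimirOp _ _ _ (p w₀) = _ • p w₀
      rw [hw₀]
      simp only [casimirOp, LinearMap.add_apply, Module.End.mul_apply, LinearMap.smul_apply,
        LieModule.toEnd_apply_apply, e_vec_zero, h_vec, lie_smul, smul_smul, lie_zero, smul_zero,
        add_zero, ← add_smul]
      congr 1
      push_cast
      ring)
  set w₁ := Polynomial.aeval (casimirOp H E F) q₁ w₀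
  have hw₁ : p w₁ = vec n 0 := hq₁.trans hw₀
  obtain ⟨q₂, k, hq₂, hk⟩ := exists_generalized_lift (p : M →ₗ[ℂ] Irr n) hpH (μ := (n : ℂ)) w₁ (by
      change ⁅slH, p w₁⁆ = _ • p w₁
      rw [hw₁, h_vec]
      simp)
  set w₂ := Polynomial.aeval H q₂ w₁
  have hw₂ : p w₂ = vec n 0 := hq₂.trans hw₁
  have hl₂ : Polynomial.aeval (casimirOp H E F)
      ((Polynomial.X - Polynomial.C (n * (n + 2) : ℂ)) ^ l) w₂ = 0 := by
    have hc : ∀ r s : Polynomial ℂ, Commute (Polynomial.aeval H r)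
        (Polynomial.aeval (casimirOp H E F) s) := fun r s =>
      commute_aeval_right (commute_aeval_right (commute_casimirOp_h hHE hHF) s).symm r |>.symm
    rw [← Module.End.mul_apply, ← (hc _ _).eq, Module.End.mul_apply, hl, map_zero]
  have hE₂ : E w₂ = 0 := apply_e_eq_zero_of_casimirOp hHE hEF hk hl₂
  have hH₂ : H w₂ = (n : ℂ) • w₂ := apply_eq_smul_of_generalized hHE hHF hEF hE₂ hk
  obtain ⟨σ, hσ⟩ := exists_hom hH₂ hE₂
  refine ⟨σ, fun x => ?_⟩
  have : p.comp σ = LieModuleHom.id := hom_ext (by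
    change p (σ (vec n 0)) = vec n 0
    rw [hσ, hw₂])
  exact LieModuleHom.congr_fun this x

end Irr

/-! ### Equivariant bilinear maps between the modules `V(n)` -/

section Equivariant

variable {m b c : ℕ} {M : Type*} [AddCommGroup M] [Module ℂ M] [LieRingModule Sl2 M]

/-- Equivariance of a bilinear map `V(m) × V(b) → M`. -/
def IsEquivariant (A : Irr m →ₗ[ℂ] Irr b →ₗ[ℂ] M) : Prop :=
  ∀ (s : Sl2) (x : Irr m) (y : Irr b), ⁅s, A x y⁆ = A ⁅s, x⁆ y + A x ⁅s, y⁆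

namespace IsEquivariant

/-- The vector v₀ ⊗ v_b generates V(m) ⊗ V(b): since e v₀ = 0, applying e gives all v₀ ⊗ y, and
applying f then moves the first factor through V(m). This replaces the Clebsch-Gordan decomposition.
-/
theorem eq_zero_of_apply_eq_zero {A : Irr m →ₗ[ℂ] Irr b →ₗ[ℂ] M} (hA : IsEquivariant A)
    (h0 : A (Irr.vec m 0) (Irr.vec b b) = 0) : A = 0 := by
  have h1 : LinearMap.ker (A (Irr.vec m 0)) = ⊤ := by
    refine Irr.eq_top_of_vec_last_mem (fun v hv => ?_) h0
    have := hA slE (Irr.vec m 0) v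
    rw [LinearMap.mem_ker.1 hv, Irr.e_vec_zero, lie_zero, map_zero, LinearMap.zero_apply,
      zero_add] at this
    exact this.symm
  have h2 : LinearMap.ker A = ⊤ := by
    refine Irr.eq_top_of_vec_zero_mem (fun v hv => ?_) (LinearMap.ker_eq_top.1 h1)
    refine LinearMap.ext fun y => ?_
    have := hA slF v y
    rw [LinearMap.mem_ker.1 hv, LinearMap.zero_apply, LinearMap.zero_apply, lie_zero,
      add_zero] at this
    exact this.symm
  exact LinearMap.ker_eq_top.1 h2

theorem lie_h_apply {A : Irr m →ₗ[ℂ] Irr b →ₗ[ℂ] M} (hA : IsEquivariant A) :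
    ⁅slH, A (Irr.vec m 0) (Irr.vec b b)⁆ =
      ((m : ℂ) - b) • A (Irr.vec m 0) (Irr.vec b b) := by
  rw [hA, Irr.h_vec, Irr.h_vec]
  simp only [map_smul, LinearMap.smul_apply]
  push_cast
  module

theorem add {A A' : Irr m →ₗ[ℂ] Irr b →ₗ[ℂ] M} (hA : IsEquivariant A) (hA' : IsEquivariant A') :
    IsEquivariant (A + A') := by
  intro s x y
  simp only [LinearMap.add_apply, lie_add, hA s x y, hA' s x y]
  abel

theorem flip {A : Irr m →ₗ[ℂ] Irr b →ₗ[ℂ] M} (hA : IsEquivariant A) : IsEquivariant A.flip := by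
  intro s x y
  simp only [LinearMap.flip_apply, hA s y x]
  abel

theorem smul [LieModule ℂ Sl2 M] {A : Irr m →ₗ[ℂ] Irr b →ₗ[ℂ] M} (hA : IsEquivariant A) (t : ℂ) :
    IsEquivariant (t • A) := by
  intro s x y
  simp only [LinearMap.smul_apply, lie_smul, hA s x y, smul_add]

/-- A weight argument: a nonzero equivariant map `V(m) × V(b) → V(c)` forces `m - b` to be a weight
of `V(c)`. -/
theorem exists_weight {A : Irr m →ₗ[ℂ] Irr b →ₗ[ℂ] Irr c} (hA : IsEquivariant A) (h0 : A ≠ 0) :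
    ∃ i ≤ c, (m : ℂ) - b = c - 2 * i :=
  Irr.exists_weight (fun h => h0 (hA.eq_zero_of_apply_eq_zero h)) hA.lie_h_apply

/-- Equivariant maps `V(m) × V(b) → V(c)` form a space of dimension at most one. -/
theorem exists_eq_smul {A A' : Irr m →ₗ[ℂ] Irr b →ₗ[ℂ] Irr c} (hA : IsEquivariant A)
    (hA' : IsEquivariant A') (h0 : A' ≠ 0) : ∃ t : ℂ, A = t • A' := by
  obtain ⟨i, hi, hw⟩ := hA'.exists_weight h0
  have h1 := Irr.eq_smul_vec_of_weight (hw ▸ hA.lie_h_apply)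
  have h2 := Irr.eq_smul_vec_of_weight (hw ▸ hA'.lie_h_apply)
  set α := Irr.coord c i (A (Irr.vec m 0) (Irr.vec b b))
  set α' := Irr.coord c i (A' (Irr.vec m 0) (Irr.vec b b))
  have h3 : α' ≠ 0 := fun h => h0 (hA'.eq_zero_of_apply_eq_zero (by rw [h2, h, zero_smul]))
  refine ⟨α / α', sub_eq_zero.1 ?_⟩
  have : A - (α / α') • A' = A + (-(α / α')) • A' := by module
  rw [this]
  refine (hA.add (hA'.smul _)).eq_zero_of_apply_eq_zero ?_
  rw [LinearMap.add_apply, LinearMap.add_apply, LinearMap.smul_apply, LinearMap.smul_apply, h1, h2,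
    smul_smul, ← add_smul, neg_mul, div_mul_cancel₀ _ h3, add_neg_cancel, zero_smul]

end IsEquivariant

theorem Irr.lie_zero_right (s : Sl2) (x : Irr 0) : ⁅s, x⁆ = 0 := by
  have h : ∀ x : Irr 0, x = coord 0 0 x • vec 0 0 := fun x => by
    simpa using eq_sum x
  have hH : ⁅slH, vec 0 0⁆ = 0 := by simp [h_vec]
  have hF : ⁅slF, vec 0 0⁆ = 0 := by rw [f_vec, vec_of_gt (by omega), smul_zero]
  rw [h x, lie_smul, sl2_decomp s]
  simp only [add_lie, smul_lie, hH, hF, e_vec_zero, smul_zero, add_zero]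

end Equivariant

/-! ### Transvectants -/

/-- The bilinear form `∑ (-1)ⁱ (k choose i) xᵐ⁻ⁱ yᵐ⁻ᵏ⁺ⁱ` on `V(m)`. -/
def pairing (m k : ℕ) : Irr m →ₗ[ℂ] Irr m →ₗ[ℂ] ℂ :=
  ∑ i ∈ Finset.range (k + 1), ((-1 : ℂ) ^ i * (k.choose i : ℂ)) •
    (Irr.coord m (m - i)).smulRight (Irr.coord m (m - (k - i)))

section Pairing

variable {m k : ℕ}

theorem pairing_apply (x y : Irr m) : pairing m k x y =
    ∑ i ∈ Finset.range (k + 1), (-1 : ℂ) ^ i * (k.choose i : ℂ) *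
      (Irr.coord m (m - i) x * Irr.coord m (m - (k - i)) y) := by
  simp [pairing, LinearMap.sum_apply]

theorem pairing_swap (x y : Irr m) : pairing m k y x = (-1 : ℂ) ^ k * pairing m k x y := by
  rw [pairing_apply, pairing_apply, ← Finset.sum_flip, Finset.mul_sum]
  refine Finset.sum_congr rfl fun i hi => ?_
  have hi : i ≤ k := by have := Finset.mem_range.1 hi; omega
  have hs : (-1 : ℂ) ^ (k - i) = (-1) ^ k * (-1) ^ i := by
    obtain ⟨j, rfl⟩ := Nat.exists_eq_add_of_le hi
    rw [Nat.add_sub_cancel_left, pow_add, mul_right_comm, ← pow_add, Even.neg_one_pow ⟨i, rfl⟩,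
      one_mul]
  rw [Nat.choose_symm hi, Nat.sub_sub_self hi, hs]
  ring

theorem pairing_h (hk : k ≤ m) (x y : Irr m) :
    pairing m k ⁅slH, x⁆ y + pairing m k x ⁅slH, y⁆ = -(2 * m - 2 * k : ℂ) * pairing m k x y := by
  rw [pairing_apply, pairing_apply, pairing_apply, ← Finset.sum_add_distrib, Finset.mul_sum]
  refine Finset.sum_congr rfl fun i hi => ?_
  have hi : i ≤ k := by have := Finset.mem_range.1 hi; omega
  rw [Irr.coord_h, Irr.coord_h, Nat.cast_sub (hi.trans hk), Nat.cast_sub (by omega : k - i ≤ m),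
    Nat.cast_sub hi]
  ring

/-- The two sums telescope through (i + 1) C(k, i + 1) = (k - i) C(k, i), with opposite signs; the
end terms involve the coordinate of index m + 1, which is zero. -/
theorem pairing_e (hk : k ≤ m) (x y : Irr m) :
    pairing m k ⁅slE, x⁆ y + pairing m k x ⁅slE, y⁆ = 0 := by
  rw [pairing_apply, pairing_apply, Finset.sum_range_succ', Finset.sum_range_succ]
  have h1 : Irr.coord m (m - 0) ⁅slE, x⁆ = 0 := by
    rw [Irr.coord_e, Irr.coord_of_gt (by omega), mul_zero]
  have h2 : Irr.coord m (m - (k - k)) ⁅slE, y⁆ = 0 := by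
    rw [Irr.coord_e, Irr.coord_of_gt (by omega), mul_zero]
  rw [h1, h2, zero_mul, mul_zero, mul_zero, mul_zero, add_zero, add_zero,
    ← Finset.sum_add_distrib]
  refine Finset.sum_eq_zero fun i hi => ?_
  have hi : i < k := Finset.mem_range.1 hi
  have hc : ((k.choose (i + 1) : ℕ) : ℂ) * (i + 1) = (k.choose i : ℂ) * (k - i) := by
    have := Nat.choose_succ_right_eq k i
    rw [← Nat.cast_sub hi.le]
    exact_mod_cast this
  rw [Irr.coord_e, Irr.coord_e, show m - (i + 1) + 1 = m - i by omega,
    show m - (k - i) + 1 = m - (k - (i + 1)) by omega, Nat.cast_sub (by omega : i + 1 ≤ m),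
    Nat.cast_sub (by omega : k - i ≤ m), Nat.cast_sub hi.le, pow_succ]
  push_cast
  linear_combination (-(-1 : ℂ) ^ i * (Irr.coord m (m - i) x *
    Irr.coord m (m - (k - (i + 1))) y)) * hc

/-- The form `pairing m k` is a highest weight vector of weight `2 m - 2 k`. -/
theorem exists_hom_pairing (hk : k ≤ m) :
    ∃ τ : Irr (2 * m - 2 * k) →ₗ⁅ℂ,Sl2⁆ (Irr m →ₗ[ℂ] Irr m →ₗ[ℂ] ℂ),
      τ (Irr.vec _ 0) = pairing m k := by
  refine Irr.exists_hom ?_ ?_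
  · refine LinearMap.ext fun x => LinearMap.ext fun y => ?_
    have := pairing_h hk x y
    simp only [LieHom.lie_apply, Module.Dual.lie_apply, LinearMap.sub_apply,
      LinearMap.smul_apply, smul_eq_mul]
    rw [Nat.cast_sub (by omega)]
    push_cast
    linear_combination -this
  · refine LinearMap.ext fun x => LinearMap.ext fun y => ?_
    have := pairing_e hk x y
    simp only [LieHom.lie_apply, Module.Dual.lie_apply, LinearMap.sub_apply,
      LinearMap.zero_apply]
    linear_combination -this

end Pairing

/-- The invariant form on `V(m)`. -/
def invForm (m : ℕ) : Irr m →ₗ[ℂ] Irr m →ₗ[ℂ] ℂ := pairing m m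

section InvForm

variable {m : ℕ}

theorem invForm_swap (x y : Irr m) : invForm m y x = (-1 : ℂ) ^ m * invForm m x y :=
  pairing_swap x y

/-- For k = m the transvectant is a highest weight vector of weight 0, hence the image of a vector
of the trivial module V(0). -/
theorem invForm_lie (s : Sl2) (x y : Irr m) :
    invForm m ⁅s, x⁆ y + invForm m x ⁅s, y⁆ = 0 := by
  -- The index l is kept free because `2 * m - 2 * m` cannot be replaced by 0 directly in the type
  -- of τ.
  have h : ∀ l, l = 0 → (∃ τ : Irr l →ₗ⁅ℂ,Sl2⁆ (Irr m →ₗ[ℂ] Irr m →ₗ[ℂ] ℂ),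
      τ (Irr.vec l 0) = pairing m m) → ⁅s, invForm m⁆ = 0 := by
    rintro _ rfl ⟨τ, hτ⟩
    rw [invForm, ← hτ, ← LieModuleHom.map_lie, Irr.lie_zero_right, map_zero]
  have := LinearMap.congr_fun₂ (h _ (Nat.sub_self _) (exists_hom_pairing le_rfl)) x y
  simp only [LieHom.lie_apply, Module.Dual.lie_apply, LinearMap.sub_apply,
    LinearMap.zero_apply] at this
  linear_combination -this

theorem invForm_lie_left (s : Sl2) (x y : Irr m) :
    invForm m ⁅s, x⁆ y = -invForm m x ⁅s, y⁆ :=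
  eq_neg_of_add_eq_zero_left (invForm_lie s x y)

theorem invForm_vec : invForm m (Irr.vec m 0) (Irr.vec m m) ≠ 0 := by
  rw [invForm, pairing_apply, Finset.sum_eq_single m]
  · simp [Irr.coord_vec]
  · intro i hi him
    have : i ≤ m := by have := Finset.mem_range.1 hi; omega
    rw [Irr.coord_vec (by omega), if_neg (by omega), zero_mul, mul_zero]
  · intro h
    exact absurd (Finset.mem_range.2 (by omega)) h

theorem invForm_ker : LinearMap.ker (invForm m) = ⊥ := by
  have hst : ∀ s : Sl2, ∀ v ∈ LinearMap.ker (invForm m), ⁅s, v⁆ ∈ LinearMap.ker (invForm m) := by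
    intro s v hv
    refine LinearMap.ext fun y => ?_
    rw [invForm_lie_left, LinearMap.mem_ker.1 hv, LinearMap.zero_apply, LinearMap.zero_apply,
      neg_zero]
  by_contra hne
  have := Irr.eq_top_of_ne_bot (hst slE) (hst slF) hne
  rw [LinearMap.ker_eq_top] at this
  exact invForm_vec (by rw [this, LinearMap.zero_apply, LinearMap.zero_apply])

/-- The isomorphism `V(m) ≅ V(m)*` given by the invariant form. -/
noncomputable def dualEquiv (m : ℕ) : Irr m ≃ₗ[ℂ] (Irr m →ₗ[ℂ] ℂ) :=
  LinearEquiv.ofInjectiveOfFinrankEq (invForm m) (LinearMap.ker_eq_bot.1 invForm_ker)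
    Subspace.dual_finrank_eq.symm

theorem dualEquiv_apply (x y : Irr m) : dualEquiv m x y = invForm m x y := rfl

theorem invForm_symm_apply (φ : Irr m →ₗ[ℂ] ℂ) (y : Irr m) :
    invForm m ((dualEquiv m).symm φ) y = φ y := by
  rw [← dualEquiv_apply, LinearEquiv.apply_symm_apply]

theorem eq_of_invForm {x x' : Irr m} (h : ∀ y, invForm m x y = invForm m x' y) : x = x' :=
  LinearMap.ker_eq_bot.1 invForm_ker (LinearMap.ext h)

/-- The invariant form as a map to `V(0)`. -/
def invForm₀ (m : ℕ) : Irr m →ₗ[ℂ] Irr m →ₗ[ℂ] Irr 0 :=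
  (invForm m).compr₂ (LinearMap.toSpanSingleton ℂ (Irr 0) (Irr.vec 0 0))

theorem invForm₀_apply (x y : Irr m) : invForm₀ m x y = invForm m x y • Irr.vec 0 0 := rfl

theorem isEquivariant_invForm₀ : IsEquivariant (invForm₀ m) := by
  intro s x y
  rw [Irr.lie_zero_right, invForm₀_apply, invForm₀_apply, ← add_smul, invForm_lie, zero_smul]

theorem invForm₀_ne_zero : invForm₀ m ≠ 0 := by
  intro h
  have := LinearMap.congr_fun₂ h (Irr.vec m 0) (Irr.vec m m)
  rw [invForm₀_apply, LinearMap.zero_apply, LinearMap.zero_apply, smul_eq_zero] at this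
  exact this.elim invForm_vec (Irr.vec_ne_zero le_rfl)

/-- Scalar multiplication as a map `V(m) × V(0) → V(m)`. -/
def scalarMap (m : ℕ) : Irr m →ₗ[ℂ] Irr 0 →ₗ[ℂ] Irr m :=
  ((LinearMap.lsmul ℂ (Irr m)).comp (Irr.coord 0 0)).flip

theorem scalarMap_apply (r : Irr m) (c : Irr 0) : scalarMap m r c = Irr.coord 0 0 c • r := rfl

theorem scalarMap_vec (r : Irr m) : scalarMap m r (Irr.vec 0 0) = r := by
  rw [scalarMap_apply, Irr.coord_vec_self le_rfl, one_smul]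

theorem isEquivariant_scalarMap : IsEquivariant (scalarMap m) := by
  intro s x y
  rw [Irr.lie_zero_right, map_zero, add_zero, scalarMap_apply, scalarMap_apply, lie_smul]

theorem scalarMap_ne_zero : scalarMap m ≠ 0 := by
  intro h
  have := LinearMap.congr_fun₂ h (Irr.vec m 0) (Irr.vec 0 0)
  rw [scalarMap_vec] at this
  exact Irr.vec_ne_zero (Nat.zero_le m) this

end InvForm

/-- For `ℓ ≤ 2 m`, `ℓ ≡ 2 m` modulo `4`, there is a nonzero equivariant map
`V(m) × V(ℓ) → V(m)` whose associated trilinear form is symmetric in its arguments in `V(m)`. -/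
theorem exists_symmetric_map {m l : ℕ} (hl : l ≤ 2 * m) (hlm : l ≡ 2 * m [MOD 4]) :
    ∃ T : Irr m →ₗ[ℂ] Irr l →ₗ[ℂ] Irr m, IsEquivariant T ∧ T ≠ 0 ∧
      ∀ r s q, invForm m s (T r q) = invForm m r (T s q) := by
  -- The congruence modulo 4 says precisely that half of 2m - ℓ is even.
  obtain ⟨k, hk, rfl, j, rfl⟩ : ∃ k, k ≤ m ∧ l = 2 * m - 2 * k ∧ Even k := by
    unfold Nat.ModEq at hlm
    exact ⟨(2 * m - l) / 2, by omega, by omega, by rw [Nat.even_iff]; omega⟩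
  obtain ⟨τ, hτ⟩ := exists_hom_pairing hk
  -- The q for which τ q is symmetric form a subspace stable under f. It contains v₀, because
  -- `pairing m k` is symmetric for even k.
  have hsym : ∀ q r s, τ q r s = τ q s r := by
    let K : Submodule ℂ (Irr (2 * m - 2 * (j + j))) :=
      LinearMap.eqLocus (τ : _ →ₗ[ℂ] Irr m →ₗ[ℂ] Irr m →ₗ[ℂ] ℂ)
        (LinearMap.lflip.toLinearMap ∘ₗ (τ : _ →ₗ[ℂ] Irr m →ₗ[ℂ] Irr m →ₗ[ℂ] ℂ))
    have hK : ∀ q, q ∈ K ↔ ∀ r s, τ q r s = τ q s r := fun q =>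
      ⟨fun h r s => LinearMap.congr_fun₂ h r s, fun h => LinearMap.ext₂ h⟩
    have : K = ⊤ := by
      refine Irr.eq_top_of_vec_zero_mem (fun q hq => ?_) ?_
      · rw [hK] at hq ⊢
        intro r s
        simp only [LieModuleHom.map_lie, LieHom.lie_apply, Module.Dual.lie_apply,
          LinearMap.sub_apply, hq r, hq ⁅slF, r⁆]
        ring
      · rw [hK, hτ]
        intro r s
        rw [pairing_swap s r, Even.neg_one_pow ⟨j, rfl⟩, one_mul]
    intro q
    exact (hK q).1 (this ▸ Submodule.mem_top)
  let T : Irr m →ₗ[ℂ] Irr (2 * m - 2 * (j + j)) →ₗ[ℂ] Irr m :=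
    ((τ : _ →ₗ[ℂ] Irr m →ₗ[ℂ] Irr m →ₗ[ℂ] ℂ).compr₂ (dualEquiv m).symm.toLinearMap).flip
  have hT : ∀ r q t, invForm m (T r q) t = τ q r t := fun r q t => invForm_symm_apply _ _
  refine ⟨T, ?_, ?_, ?_⟩
  · intro s r q
    refine eq_of_invForm fun t => ?_
    rw [map_add, LinearMap.add_apply, invForm_lie_left, hT, hT, hT]
    simp only [LieModuleHom.map_lie, LieHom.lie_apply, Module.Dual.lie_apply,
      LinearMap.sub_apply]
    ring
  · intro h
    have h1 : pairing m (j + j) = 0 := by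
      refine LinearMap.ext₂ fun r t => ?_
      rw [← hτ, ← hT, h]
      simp
    -- At (v_m, v_{m-k}) only the summand i = 0 of the pairing survives, and it equals 1.
    have h2 := LinearMap.congr_fun₂ h1 (Irr.vec m m) (Irr.vec m (m - (j + j)))
    rw [pairing_apply, Finset.sum_eq_single 0] at h2
    · simp [Irr.coord_vec] at h2
    · intro i hi hi0
      have : i ≤ j + j := by have := Finset.mem_range.1 hi; omega
      rw [Irr.coord_vec (by omega), if_neg (by omega), zero_mul, mul_zero]
    · simp
  · intro r s q
    rw [invForm_swap (T r q) s, invForm_swap (T s q) r, hT, hT, hsym]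

/-- The map of `exists_symmetric_map` is symmetric if `ℓ = m`. -/
theorem symmetric_of_trilinear {m : ℕ} {T : Irr m →ₗ[ℂ] Irr m →ₗ[ℂ] Irr m} (hT : IsEquivariant T)
    (hT0 : T ≠ 0) (hs : ∀ r s q, invForm m s (T r q) = invForm m r (T s q)) (r s : Irr m) :
    T r s = T s r := by
  obtain ⟨t, ht⟩ := hT.flip.exists_eq_smul hT hT0
  have h1 : ∀ a b, T b a = t • T a b := fun a b => LinearMap.congr_fun₂ ht a b
  -- Exchanging the first two arguments fixes B(a, T(b, c)), and exchanging the last two multiplies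
  -- it by t. The braid relation between these transpositions gives t² = t.
  have h2 : ∀ a b c, (t * t - t) * invForm m a (T b c) = 0 := by
    intro a b c
    have e1 : invForm m b (T c a) = t * invForm m a (T b c) := by
      rw [h1 a c, map_smul, smul_eq_mul, hs a b c]
    have e2 : invForm m c (T a b) = t * invForm m c (T b a) := by
      rw [h1 b a, map_smul, smul_eq_mul]
    have e3 : invForm m a (T c b) = t * invForm m a (T b c) := by
      rw [h1 b c, map_smul, smul_eq_mul]
    have e4 := hs c b a
    have e5 := hs a c b
    linear_combination -t * e1 + t * e4 - e2 + e5 + e3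
  have h3 : t * t - t = 0 := by
    by_contra hne
    refine hT0 (LinearMap.ext₂ fun b c => ?_)
    refine eq_of_invForm fun a => ?_
    rw [invForm_swap a, (mul_eq_zero.1 (h2 a b c)).resolve_left hne]
    simp
  have h4 : t ≠ 0 := by
    rintro rfl
    refine hT0 (LinearMap.ext₂ fun b c => ?_)
    rw [h1 c b, zero_smul]
    rfl
  have h5 : t = 1 := by
    have : t * (t - 1) = 0 := by linear_combination h3
    exact sub_eq_zero.1 ((mul_eq_zero.1 this).resolve_left h4)
  rw [h1 s r, h5, one_smul]

/-! ### Modules of `sl(2) ⋉ V(m)` -/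

/-- The inclusion of `V(m)` into `sl(2) ⋉ V(m)`. -/
abbrev inclRad (m : ℕ) : Irr m →ₗ⁅ℂ⁆ Sl2V m := LieAlgebra.SemiDirectSum.inl (sl2Der m)

section SemiDirect

variable {m : ℕ}

theorem eq_inclRad_add_inclSl2 (x : Sl2V m) : x = inclRad m x.left + inclSl2 m x.right := by
  simp

theorem inclSl2_lie_inclRad (s : Sl2) (r : Irr m) :
    ⁅inclSl2 m s, inclRad m r⁆ = inclRad m ⁅s, r⁆ := by
  have : (sl2Der m) s r = ⁅s, r⁆ := rfl
  simp [this]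

theorem inclRad_lie_inclRad (r r' : Irr m) : ⁅inclRad m r, inclRad m r'⁆ = 0 := by
  simp [Irr.lie_eq_zero]

variable {X : Type*} [AddCommGroup X] [LieRingModule (Sl2V m) X]

theorem inclSl2_lie_lie (s : Sl2) (r : Irr m) (x : X) :
    ⁅inclSl2 m s, ⁅inclRad m r, x⁆⁆ =
      ⁅inclRad m ⁅s, r⁆, x⁆ + ⁅inclRad m r, ⁅inclSl2 m s, x⁆⁆ := by
  rw [leibniz_lie, inclSl2_lie_inclRad]

theorem inclRad_lie_lie (r r' : Irr m) (x : X) :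
    ⁅inclRad m r, ⁅inclRad m r', x⁆⁆ = ⁅inclRad m r', ⁅inclRad m r, x⁆⁆ := by
  rw [leibniz_lie, inclRad_lie_inclRad, zero_lie, zero_add]

variable [Module ℂ X]

/-- A subspace stable under `V(m)` and `sl(2)` as a submodule. -/
def lieSubmoduleOfStable (K : Submodule ℂ X) (hr : ∀ r, ∀ x ∈ K, ⁅inclRad m r, x⁆ ∈ K)
    (hs : ∀ s, ∀ x ∈ K, ⁅inclSl2 m s, x⁆ ∈ K) : LieSubmodule ℂ (Sl2V m) X :=
  { K with
    lie_mem := fun {x v} hv => by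
      rw [eq_inclRad_add_inclSl2 x, add_lie]
      exact K.add_mem (hr _ v hv) (hs _ v hv) }

theorem mem_lieSubmoduleOfStable {K : Submodule ℂ X} {hr : ∀ r, ∀ x ∈ K, ⁅inclRad m r, x⁆ ∈ K}
    {hs : ∀ s, ∀ x ∈ K, ⁅inclSl2 m s, x⁆ ∈ K} {x : X} :
    x ∈ lieSubmoduleOfStable K hr hs ↔ x ∈ K := Iff.rfl

theorem eq_bot_or_eq_top_of_equiv [LieModule ℂ (Sl2V m) X] {b : ℕ} (φ : X ≃ₗ[ℂ] Irr b)
    (hφ : ∀ (s : Sl2) (x : X), φ ⁅inclSl2 m s, x⁆ = ⁅s, φ x⁆) (N : LieSubmodule ℂ (Sl2V m) X) :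
    N = ⊥ ∨ N = ⊤ := by
  rw [or_iff_not_imp_left]
  intro hN
  have hst : ∀ s : Sl2, ∀ v ∈ N.toSubmodule.map (φ : X →ₗ[ℂ] Irr b),
      ⁅s, v⁆ ∈ N.toSubmodule.map (φ : X →ₗ[ℂ] Irr b) := by
    rintro s _ ⟨x, hx, rfl⟩
    exact ⟨⁅inclSl2 m s, x⁆, N.lie_mem hx, hφ s x⟩
  have htop := Irr.eq_top_of_ne_bot (hst slE) (hst slF) (fun h => hN (by
    rw [Submodule.map_eq_bot_iff] at h
    · exact (LieSubmodule.toSubmodule_eq_bot N).1 (by simpa using h)))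
  rw [← LieSubmodule.toSubmodule_eq_top]
  refine eq_top_iff.2 fun x _ => ?_
  have : φ x ∈ N.toSubmodule.map (φ : X →ₗ[ℂ] Irr b) := htop ▸ Submodule.mem_top
  obtain ⟨y, hy, hyx⟩ := this
  exact φ.injective hyx ▸ hy

/-- The abelian ideal `V(m)` acts trivially on modules that are irreducible over `sl(2)`. -/
theorem inclRad_lie_eq_zero (hm : 1 ≤ m) [LieModule ℂ (Sl2V m) X] {b : ℕ} (φ : X ≃ₗ[ℂ] Irr b)
    (hφ : ∀ (s : Sl2) (x : X), φ ⁅inclSl2 m s, x⁆ = ⁅s, φ x⁆) (r : Irr m) (x : X) :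
    ⁅inclRad m r, x⁆ = 0 := by
  have : FiniteDimensional ℂ X := φ.symm.finiteDimensional
  have : Nontrivial X := ⟨φ.symm (Irr.vec b 0), 0, fun h => Irr.vec_ne_zero (Nat.zero_le b) (by
    have := congrArg φ h
    simpa using this)⟩
  let I : LieIdeal ℂ (Sl2V m) := (LieAlgebra.SemiDirectSum.projr (sl2Der m)).ker
  have hI : ∀ r, inclRad m r ∈ I := fun r => by
    rw [LieHom.mem_ker]
    rfl
  have hIr : ∀ z : I, (z : Sl2V m) = inclRad m (z : Sl2V m).left := fun z => by
    have h : (z : Sl2V m).right = 0 := z.2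
    conv_lhs => rw [eq_inclRad_add_inclSl2 (z : Sl2V m), h, map_zero, add_zero]
  have : IsLieAbelian I := ⟨fun y z => Subtype.ext (by
    change ⁅(y : Sl2V m), (z : Sl2V m)⁆ = 0
    rw [hIr y, hIr z, inclRad_lie_inclRad])⟩
  -- Lie's theorem gives a common eigenvector of the ideal. Its weight space is a submodule for the
  -- whole algebra, so by irreducibility V(m) acts by scalars.
  obtain ⟨χ, hχ⟩ := LieModule.exists_nontrivial_weightSpace_of_isSolvable ℂ I X
  have htop : LieModule.weightSpaceOfIsLieTower ℂ X χ = (⊤ : LieSubmodule ℂ (Sl2V m) X) := by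
    refine (eq_bot_or_eq_top_of_equiv φ hφ _).resolve_left fun h => ?_
    obtain ⟨y, hy⟩ := exists_ne (0 : LieModule.weightSpace X χ)
    have : (y : X) ∈ LieModule.weightSpaceOfIsLieTower (L := Sl2V m) ℂ X χ := y.2
    rw [h] at this
    exact hy (Subtype.ext this)
  have hact : ∀ r (x : X), ⁅inclRad m r, x⁆ = χ ⟨inclRad m r, hI r⟩ • x := by
    intro r x
    have : x ∈ LieModule.weightSpaceOfIsLieTower (L := Sl2V m) ℂ X χ := htop ▸ LieSubmodule.mem_top x
    exact (LieModule.mem_weightSpace χ x).1 this ⟨inclRad m r, hI r⟩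
  let K : Submodule ℂ (Irr m) :=
    { carrier := {r | ∀ x : X, ⁅inclRad m r, x⁆ = 0}
      add_mem' := fun hr hr' x => by rw [map_add, add_lie, hr, hr', add_zero]
      zero_mem' := fun x => by rw [map_zero, zero_lie]
      smul_mem' := fun t r hr x => by rw [map_smul, smul_lie, hr, smul_zero] }
  -- The bracket [s, r] acts by a commutator with a scalar operator, hence by zero. Since m ≥ 1, v₀
  -- is a multiple of [h, v₀], and such brackets exhaust V(m).
  have hlie : ∀ (s : Sl2) r, ⁅s, r⁆ ∈ K := by
    intro s r x
    have := inclSl2_lie_lie s r x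
    rw [hact r, hact r, lie_smul] at this
    exact right_eq_add.1 this
  have h0 : Irr.vec m 0 ∈ K := by
    have := hlie slH (Irr.vec m 0)
    rw [Irr.h_vec] at this
    refine (K.smul_mem_iff ?_).1 this
    simpa using (show m ≠ 0 by omega)
  have := Irr.eq_top_of_vec_zero_mem (fun v _ => hlie slF v) h0
  exact (this ▸ Submodule.mem_top : r ∈ K) x

end SemiDirect

/-! ### Socle series -/

section SocleSeries

variable {L : Type*} [LieRing L] [LieAlgebra ℂ L]
variable {V : Type*} [AddCommGroup V] [Module ℂ V] [LieRingModule L V] [LieModule ℂ L V]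

theorem comap_map_mk' {F G : LieSubmodule ℂ L V} (h : F ≤ G) :
    (G.map (LieSubmodule.Quotient.mk' F)).comap (LieSubmodule.Quotient.mk' F) = G := by
  refine le_antisymm (fun x hx => ?_) (LieSubmodule.le_comap_map _ _)
  obtain ⟨y, hy, hyx⟩ := (LieSubmodule.mem_map _).1 (LieSubmodule.mem_comap.1 hx)
  have : x - y ∈ F := by
    rw [← LieSubmodule.Quotient.mk_eq_zero, map_sub, hyx, sub_self]
  have := G.add_mem (h this) hy
  rwa [sub_add_cancel] at this

theorem map_comap_mk' (F : LieSubmodule ℂ L V) (N : LieSubmodule ℂ L (V ⧸ F)) :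
    (N.comap (LieSubmodule.Quotient.mk' F)).map (LieSubmodule.Quotient.mk' F) = N := by
  refine le_antisymm (LieSubmodule.map_comap_le _ _) (fun x hx => ?_)
  obtain ⟨y, rfl⟩ := LieSubmodule.Quotient.surjective_mk' F x
  exact (LieSubmodule.mem_map _).2 ⟨y, hx, rfl⟩

theorem le_comap_mk' (F : LieSubmodule ℂ L V) (N : LieSubmodule ℂ L (V ⧸ F)) :
    F ≤ N.comap (LieSubmodule.Quotient.mk' F) := fun x hx => by
  rw [LieSubmodule.mem_comap, (LieSubmodule.Quotient.mk_eq_zero F).2 hx]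
  exact N.zero_mem

theorem comap_mk'_bot (F : LieSubmodule ℂ L V) :
    (⊥ : LieSubmodule ℂ L (V ⧸ F)).comap (LieSubmodule.Quotient.mk' F) = F := by
  ext x
  rw [LieSubmodule.mem_comap, LieSubmodule.mem_bot, LieSubmodule.Quotient.mk_eq_zero]

theorem comap_mk'_injective (F : LieSubmodule ℂ L V) : Function.Injective
    fun N : LieSubmodule ℂ L (V ⧸ F) => N.comap (LieSubmodule.Quotient.mk' F) :=
  fun N N' h => by rw [← map_comap_mk' F N, ← map_comap_mk' F N', show N.comap _ = N'.comap _ from h]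

theorem comap_mk'_mono (F : LieSubmodule ℂ L V) : Monotone
    fun N : LieSubmodule ℂ L (V ⧸ F) => N.comap (LieSubmodule.Quotient.mk' F) :=
  fun _ _ h _ hx => h hx

/-- Irreducible submodules of V / F correspond to the submodules of V that cover F, so that the
socle series can be studied inside V. -/
theorem isAtom_map_mk' {F G : LieSubmodule ℂ L V} (h : F ⋖ G) :
    IsAtom (G.map (LieSubmodule.Quotient.mk' F)) := by
  constructor
  · intro h0
    have := comap_map_mk' h.le
    rw [h0, comap_mk'_bot] at this
    exact h.lt.ne this
  · intro N hN
    have h1 : N.comap (LieSubmodule.Quotient.mk' F) ≤ G := by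
      rw [← comap_map_mk' h.le]
      exact comap_mk'_mono F hN.le
    rcases h.eq_or_eq (le_comap_mk' F N) h1 with h2 | h2
    · exact comap_mk'_injective F (h2.trans (comap_mk'_bot F).symm)
    · exact absurd (by rw [← h2, map_comap_mk'] : G.map _ = N) hN.ne'

theorem covBy_comap_mk' {F : LieSubmodule ℂ L V} {N : LieSubmodule ℂ L (V ⧸ F)} (h : IsAtom N) :
    F ⋖ N.comap (LieSubmodule.Quotient.mk' F) := by
  refine ⟨lt_of_le_of_ne (le_comap_mk' F N) fun hF => h.1 ?_, fun K hFK hKN => ?_⟩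
  · exact comap_mk'_injective F (hF.symm.trans (comap_mk'_bot F).symm)
  · have h1 : K.map (LieSubmodule.Quotient.mk' F) < N := by
      refine lt_of_le_of_ne ?_ fun h2 => hKN.ne ?_
      · rw [← map_comap_mk' F N]
        exact LieSubmodule.map_mono hKN.le
      · rw [← h2, comap_map_mk' hFK.le]
    have h3 := comap_map_mk' hFK.le
    rw [h.2 _ h1, comap_mk'_bot] at h3
    exact hFK.ne h3

theorem le_comap_socle {F G : LieSubmodule ℂ L V} (h : F ⋖ G) :
    G ≤ (socle L (V ⧸ F)).comap (LieSubmodule.Quotient.mk' F) := by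
  rw [← LieSubmodule.map_le_iff_le_comap]
  exact le_sSup (isAtom_map_mk' h)

theorem comap_socle_le {F G : LieSubmodule ℂ L V} (hFG : F ≤ G) (h : ∀ N, F ⋖ N → N ≤ G) :
    (socle L (V ⧸ F)).comap (LieSubmodule.Quotient.mk' F) ≤ G := by
  rw [← comap_map_mk' hFG]
  refine comap_mk'_mono F (sSup_le fun N hN => ?_)
  rw [← map_comap_mk' F N]
  exact LieSubmodule.map_mono (h _ (covBy_comap_mk' hN))

end SocleSeries

/-! ### Chains of submodules with irreducible factors -/

section Factor

variable {m : ℕ} {V : Type*} [AddCommGroup V] [Module ℂ V] [LieRingModule (Sl2V m) V]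

/-- Submodules `F ≤ G` of a `sl(2) ⋉ V(m)`-module together with an isomorphism `G / F ≅ V(b)` over
`sl(2)`, given as a map from `G` onto `V(b)` with kernel `F`. -/
structure FactorMap (F G : LieSubmodule ℂ (Sl2V m) V) (b : ℕ) where
  /-- The projection from `G` onto `V(b)`. -/
  toFun : G →ₗ[ℂ] Irr b
  le : F ≤ G
  surj : Function.Surjective toFun
  ker : ∀ x, toFun x = 0 ↔ (x : V) ∈ F
  equivariant : ∀ (s : Sl2) (x : G), toFun ⁅inclSl2 m s, x⁆ = ⁅s, toFun x⁆

namespace FactorMap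

variable {F G : LieSubmodule ℂ (Sl2V m) V} {b : ℕ}

theorem covBy (p : FactorMap F G b) : F ⋖ G := by
  refine ⟨lt_of_le_of_ne p.le fun h => ?_, fun K hFK hKG => ?_⟩
  · obtain ⟨x, hx⟩ := p.surj (Irr.vec b 0)
    have : p.toFun x = 0 := (p.ker x).2 (h ▸ x.2)
    exact Irr.vec_ne_zero (Nat.zero_le b) (hx.symm.trans this)
  · let K' : Submodule ℂ (Irr b) :=
      (K.toSubmodule.comap G.toSubmodule.subtype).map p.toFun
    have hst : ∀ s : Sl2, ∀ v ∈ K', ⁅s, v⁆ ∈ K' := by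
      rintro s _ ⟨x, hx, rfl⟩
      exact ⟨⁅inclSl2 m s, x⁆, K.lie_mem hx, p.equivariant s x⟩
    obtain ⟨x, hxK, hxF⟩ := SetLike.exists_of_lt hFK
    have htop : K' = ⊤ := by
      refine Irr.eq_top_of_ne_bot (hst slE) (hst slF) fun h => hxF ?_
      have hx : p.toFun ⟨x, hKG.le hxK⟩ ∈ K' := ⟨⟨x, hKG.le hxK⟩, hxK, rfl⟩
      rw [h, Submodule.mem_bot] at hx
      exact (p.ker _).1 hx
    refine hKG.not_ge fun y hy => ?_
    have : p.toFun ⟨y, hy⟩ ∈ K' := htop ▸ Submodule.mem_top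
    obtain ⟨z, hz, hzy⟩ := this
    have hd : p.toFun (⟨y, hy⟩ - z) = 0 := by rw [map_sub, hzy, sub_self]
    have h1 : y - z ∈ K := hFK.le ((p.ker _).1 hd)
    have h2 := K.add_mem h1 hz
    change y - (z : V) + (z : V) ∈ K at h2
    rwa [sub_add_cancel] at h2

/-- An `sl(2)`-equivariant section of a factor. -/
theorem exists_section [LieModule ℂ (Sl2V m) V] [FiniteDimensional ℂ V]
    (p : FactorMap F G b) :
    ∃ (σ : Irr b →ₗ[ℂ] V) (hσ : ∀ x, σ x ∈ G), (∀ x, p.toFun ⟨σ x, hσ x⟩ = x) ∧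
      ∀ (s : Sl2) x, σ ⁅s, x⁆ = ⁅inclSl2 m s, σ x⁆ := by
  let _ : LieRingModule Sl2 G := LieRingModule.compLieHom G (inclSl2 m)
  have _ : LieModule ℂ Sl2 G := LieModule.compLieHom G (inclSl2 m)
  have _ : FiniteDimensional ℂ G := inferInstanceAs (FiniteDimensional ℂ G.toSubmodule)
  let p' : G →ₗ⁅ℂ,Sl2⁆ Irr b := { p.toFun with map_lie' := fun {s x} => p.equivariant s x }
  obtain ⟨σ, hσ⟩ := Irr.exists_section p' p.surj
  refine ⟨G.toSubmodule.subtype ∘ₗ (σ : Irr b →ₗ[ℂ] G), fun x => (σ x).2, hσ, fun s x => ?_⟩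
  exact congrArg Subtype.val (σ.map_lie s x)

end FactorMap

end Factor

/-- A chain of submodules with factors `V(a₁), …, V(aₙ)` over `sl(2)` such that `V(m)` maps each
member of the chain into the previous one, but not into the one before. -/
structure UniserialChain {m : ℕ} (V : FDModule.{u} (Sl2V m)) (a : List ℕ)
    (F : ℕ → LieSubmodule ℂ (Sl2V m) V) : Prop where
  zero : F 0 = ⊥
  top : F a.length = ⊤
  factor : ∀ i : Fin a.length, Nonempty (FactorMap (F i) (F (i + 1)) (a.get i))
  rad : ∀ i < a.length, ∀ r, ∀ x ∈ F (i + 1), ⁅inclRad m r, x⁆ ∈ F i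
  not_rad : ∀ i, i + 1 < a.length → ∃ r, ∃ x ∈ F (i + 2), ⁅inclRad m r, x⁆ ∉ F i

namespace UniserialChain

variable {m : ℕ} {V : FDModule.{u} (Sl2V m)} {a : List ℕ} {F : ℕ → LieSubmodule ℂ (Sl2V m) V}

theorem covBy (c : UniserialChain V a F) {i : ℕ} (hi : i < a.length) : F i ⋖ F (i + 1) :=
  (c.factor ⟨i, hi⟩).some.covBy

theorem mono (c : UniserialChain V a F) {i j : ℕ} (hij : i ≤ j) (hj : j ≤ a.length) :
    F i ≤ F j := by
  induction j, hij using Nat.le_induction with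
  | base => exact le_rfl
  | succ j _ ih => exact (ih (by omega)).trans (c.covBy (by omega)).le

/-- Suppose N ≤ F (i + 1) is not contained in F i, so that N + F i = F (i + 1). If N did not contain
F i, with i = k + 1, then by induction N ∩ F (k + 1) would lie in F k. As V(m) maps N into this
intersection and F (k + 1) into F k, it would map F (k + 2) into F k, which `not_rad` excludes. -/
theorem exists_eq_of_le (c : UniserialChain V a F) : ∀ i ≤ a.length,
    ∀ N : LieSubmodule ℂ (Sl2V m) V, N ≤ F i → ∃ j ≤ i, N = F j := by
  intro i
  induction i with
  | zero =>
    intro _ N hN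
    rw [c.zero, le_bot_iff] at hN
    exact ⟨0, le_rfl, hN.trans c.zero.symm⟩
  | succ i ih =>
    intro hi N hN
    by_cases hNi : N ≤ F i
    · obtain ⟨j, hj, h⟩ := ih (by omega) N hNi
      exact ⟨j, by omega, h⟩
    have hsup : F i ⊔ N = F (i + 1) := by
      refine ((c.covBy (by omega)).eq_or_eq le_sup_left (sup_le (c.covBy (by omega)).le hN)
        ).resolve_left fun h => hNi (h ▸ le_sup_right)
    suffices h : F i ≤ N from ⟨i + 1, le_rfl, by rw [← hsup, sup_eq_right.2 h]⟩
    cases i with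
    | zero => rw [c.zero]; exact bot_le
    | succ k =>
      obtain ⟨j, hj, hNj⟩ := ih (by omega) (N ⊓ F (k + 1)) inf_le_right
      rcases hj.eq_or_lt with rfl | hj
      · exact inf_eq_right.1 hNj
      exfalso
      have hNk : N ⊓ F (k + 1) ≤ F k := hNj ▸ c.mono (by omega) (by omega)
      obtain ⟨r, x, hx, hrx⟩ := c.not_rad k (by omega)
      have hx' := hx
      rw [← hsup, LieSubmodule.mem_sup] at hx'
      obtain ⟨z, hz, y, hy, rfl⟩ := hx'
      refine hrx ?_
      rw [lie_add]
      exact (F k).add_mem (c.rad k (by omega) r z hz)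
        (hNk ⟨N.lie_mem hy, c.rad (k + 1) (by omega) r y (hN hy)⟩)

theorem exists_eq (c : UniserialChain V a F) (N : LieSubmodule ℂ (Sl2V m) V) :
    ∃ j ≤ a.length, N = F j :=
  c.exists_eq_of_le _ le_rfl N (c.top ▸ le_top)

theorem isUniserial (c : UniserialChain V a F) : IsUniserial (Sl2V m) V := by
  intro N N'
  obtain ⟨j, hj, rfl⟩ := c.exists_eq N
  obtain ⟨j', hj', rfl⟩ := c.exists_eq N'
  rcases le_total j j' with h | h
  · exact Or.inl (c.mono h hj')
  · exact Or.inr (c.mono h hj)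

theorem comap_socle (c : UniserialChain V a F) {i : ℕ} (hi : i < a.length) :
    (socle (Sl2V m) (V ⧸ F i)).comap (LieSubmodule.Quotient.mk' (F i)) = F (i + 1) := by
  refine le_antisymm (comap_socle_le (c.covBy hi).le fun N hN => ?_) (le_comap_socle (c.covBy hi))
  obtain ⟨j, hj, rfl⟩ := c.exists_eq N
  by_contra hcon
  have hj' : i + 1 < j := by
    by_contra h
    exact hcon (c.mono (by omega) (by omega))
  exact hN.2 (c.covBy hi).lt
    ((c.covBy (show i + 1 < a.length by omega)).lt.trans_le (c.mono hj' hj))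

theorem socleSeries_eq (c : UniserialChain V a F) {i : ℕ} (hi : i ≤ a.length) :
    socleSeries (Sl2V m) V i = F i := by
  induction i with
  | zero => exact c.zero.symm
  | succ i ih =>
    have h := ih (by omega)
    have hc := c.comap_socle (show i < a.length by omega)
    rw [← h] at hc
    exact hc

end UniserialChain

/-! ### Chains and socle series -/

section SocleFactor

variable {m : ℕ} {V : Type*} [AddCommGroup V] [Module ℂ V] [LieRingModule (Sl2V m) V]
  [LieModule ℂ (Sl2V m) V]

theorem FactorMap.exists_socle_equiv {F G : LieSubmodule ℂ (Sl2V m) V} {b : ℕ}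
    (p : FactorMap F G b)
    (hG : (socle (Sl2V m) (V ⧸ F)).comap (LieSubmodule.Quotient.mk' F) = G) :
    ∃ φ : socle (Sl2V m) (V ⧸ F) ≃ₗ[ℂ] Irr b,
      ∀ (s : Sl2) (x : socle (Sl2V m) (V ⧸ F)), φ ⁅inclSl2 m s, x⁆ = ⁅s, φ x⁆ := by
  have hmem : ∀ x : G, LieSubmodule.Quotient.mk' F (x : V) ∈ socle (Sl2V m) (V ⧸ F) :=
    fun x => hG.ge x.2
  let e : G →ₗ[ℂ] socle (Sl2V m) (V ⧸ F) :=
    { toFun := fun x => ⟨LieSubmodule.Quotient.mk' F (x : V), hmem x⟩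
      map_add' := fun x y => Subtype.ext (map_add (LieSubmodule.Quotient.mk' F) (x : V) (y : V))
      map_smul' := fun t x => Subtype.ext (map_smul (LieSubmodule.Quotient.mk' F) t (x : V)) }
  have he : Function.Surjective e := by
    rintro ⟨y, hy⟩
    obtain ⟨x, rfl⟩ := LieSubmodule.Quotient.surjective_mk' F y
    exact ⟨⟨x, hG ▸ hy⟩, rfl⟩
  have hker : LinearMap.ker e = LinearMap.ker p.toFun := by
    ext x
    rw [LinearMap.mem_ker, LinearMap.mem_ker, p.ker, ← LieSubmodule.Quotient.mk_eq_zero]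
    exact Subtype.ext_iff
  let φ : socle (Sl2V m) (V ⧸ F) ≃ₗ[ℂ] Irr b :=
    (e.quotKerEquivOfSurjective he).symm ≪≫ₗ Submodule.quotEquivOfEq _ _ hker ≪≫ₗ
      p.toFun.quotKerEquivOfSurjective p.surj
  have hφ : ∀ x, φ (e x) = p.toFun x := by
    intro x
    have : (e.quotKerEquivOfSurjective he).symm (e x) = Submodule.Quotient.mk x := by
      rw [LinearEquiv.symm_apply_eq]
      rfl
    change p.toFun.quotKerEquivOfSurjective p.surj (Submodule.quotEquivOfEq _ _ hker
      ((e.quotKerEquivOfSurjective he).symm (e x))) = _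
    rw [this]
    rfl
  refine ⟨φ, fun s y => ?_⟩
  obtain ⟨x, rfl⟩ := he y
  have : ⁅inclSl2 m s, e x⁆ = e ⁅inclSl2 m s, x⁆ :=
    Subtype.ext ((LieSubmodule.Quotient.mk' F).map_lie (inclSl2 m s) (x : V)).symm
  rw [this, hφ, hφ, p.equivariant]

theorem exists_factorMap_of_socle_equiv {F : LieSubmodule ℂ (Sl2V m) V} {b : ℕ}
    (φ : socle (Sl2V m) (V ⧸ F) ≃ₗ[ℂ] Irr b)
    (hφ : ∀ (s : Sl2) (x : socle (Sl2V m) (V ⧸ F)), φ ⁅inclSl2 m s, x⁆ = ⁅s, φ x⁆) :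
    Nonempty (FactorMap F ((socle (Sl2V m) (V ⧸ F)).comap (LieSubmodule.Quotient.mk' F)) b) := by
  let e : (socle (Sl2V m) (V ⧸ F)).comap (LieSubmodule.Quotient.mk' F) →ₗ[ℂ]
      socle (Sl2V m) (V ⧸ F) :=
    { toFun := fun x => ⟨LieSubmodule.Quotient.mk' F (x : V), x.2⟩
      map_add' := fun x y => Subtype.ext (map_add (LieSubmodule.Quotient.mk' F) (x : V) (y : V))
      map_smul' := fun t x => Subtype.ext (map_smul (LieSubmodule.Quotient.mk' F) t (x : V)) }
  refine ⟨⟨φ ∘ₗ e, le_comap_mk' F _, fun y => ?_, fun x => ?_, fun s x => ?_⟩⟩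
  · obtain ⟨x, hx⟩ := LieSubmodule.Quotient.surjective_mk' F (φ.symm y : V ⧸ F)
    have hmem : x ∈ (socle (Sl2V m) (V ⧸ F)).comap (LieSubmodule.Quotient.mk' F) := by
      rw [LieSubmodule.mem_comap, hx]
      exact (φ.symm y).2
    refine ⟨⟨x, hmem⟩, ?_⟩
    have : e ⟨x, hmem⟩ = φ.symm y := Subtype.ext hx
    rw [LinearMap.comp_apply, this]
    exact φ.apply_symm_apply y
  · rw [LinearMap.comp_apply, ← LieSubmodule.Quotient.mk_eq_zero]
    exact φ.map_eq_zero_iff.trans Subtype.ext_iff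
  · have : e ⁅inclSl2 m s, x⁆ = ⁅inclSl2 m s, e x⁆ :=
      Subtype.ext ((LieSubmodule.Quotient.mk' F).map_lie (inclSl2 m s) (x : V))
    rw [LinearMap.comp_apply, this]
    exact hφ s (e x)

end SocleFactor

section Criterion

variable {m : ℕ} {V : FDModule.{u} (Sl2V m)} {a : List ℕ}

theorem UniserialChain.isUniserialWith {F : ℕ → LieSubmodule ℂ (Sl2V m) V}
    (c : UniserialChain V a F) : IsUniserialWith V a := by
  refine ⟨c.isUniserial, (c.socleSeries_eq le_rfl).trans c.top, fun i => ?_⟩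
  have h := c.factor i
  have h1 := c.comap_socle i.2
  rw [← c.socleSeries_eq i.2.le] at h h1
  exact h.some.exists_socle_equiv h1

/-- V(m) kills each factor because the factor is irreducible over `sl(2)`. If V(m) lowered two steps
at level i + 2, the image of an `sl(2)`-section of that factor together with level i would be a
submodule with irreducible quotient by level i. It would then lie in level i + 1, where the section
has only zero. -/
theorem HasSocleFactors.uniserialChain (hm : 1 ≤ m) (h : HasSocleFactors V a) :
    UniserialChain V a (socleSeries (Sl2V m) V) := by
  have hf : ∀ i : Fin a.length, Nonempty (FactorMap (socleSeries (Sl2V m) V i)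
      (socleSeries (Sl2V m) V (i + 1)) (a.get i)) := fun i => by
    obtain ⟨φ, hφ⟩ := h.2 i
    exact exists_factorMap_of_socle_equiv φ hφ
  refine ⟨rfl, h.1, hf, fun i hi r x hx => ?_, fun i hi => ?_⟩
  · obtain ⟨φ, hφ⟩ := h.2 ⟨i, hi⟩
    have := inclRad_lie_eq_zero hm φ hφ r
      ⟨LieSubmodule.Quotient.mk' (socleSeries (Sl2V m) V i) x, hx⟩
    rw [← LieSubmodule.Quotient.mk_eq_zero, LieModuleHom.map_lie]
    exact congrArg Subtype.val this
  · by_contra! hcon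
    obtain ⟨p⟩ := hf ⟨i + 1, hi⟩
    obtain ⟨σ, hσ, hpσ, hσs⟩ := p.exists_section
    have hle : socleSeries (Sl2V m) V i ≤ socleSeries (Sl2V m) V (i + 1) :=
      (hf ⟨i, by omega⟩).some.le
    let N : LieSubmodule ℂ (Sl2V m) V := lieSubmoduleOfStable
      ((socleSeries (Sl2V m) V i).toSubmodule ⊔ LinearMap.range σ) (by
        intro r x hx
        refine Submodule.mem_sup_left (hcon r x ?_)
        obtain ⟨y, hy, _, ⟨z, rfl⟩, rfl⟩ := Submodule.mem_sup.1 hx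
        exact (socleSeries (Sl2V m) V (i + 2)).add_mem (p.le (hle hy)) (hσ z)) (by
        intro s x hx
        obtain ⟨y, hy, _, ⟨z, rfl⟩, rfl⟩ := Submodule.mem_sup.1 hx
        rw [lie_add]
        exact Submodule.add_mem_sup ((socleSeries (Sl2V m) V i).lie_mem hy) ⟨⁅s, z⁆, hσs s z⟩)
    have hN : N ≤ socleSeries (Sl2V m) V (i + 1 + 1) := by
      intro x hx
      obtain ⟨y, hy, _, ⟨z, rfl⟩, rfl⟩ := Submodule.mem_sup.1 hx
      exact (socleSeries (Sl2V m) V (i + 2)).add_mem (p.le (hle hy)) (hσ z)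
    let q : FactorMap (socleSeries (Sl2V m) V i) N (a.get ⟨i + 1, hi⟩) :=
      { toFun := p.toFun ∘ₗ Submodule.inclusion hN
        le := fun x hx => Submodule.mem_sup_left hx
        surj := fun x => ⟨⟨σ x, Submodule.mem_sup_right ⟨x, rfl⟩⟩, hpσ x⟩
        ker := fun x => by
          have hx : p.toFun (Submodule.inclusion hN x) = 0 ↔
            (x : V) ∈ socleSeries (Sl2V m) V (i + 1) := p.ker _
          rw [LinearMap.comp_apply, hx]
          refine ⟨fun hx' => ?_, fun h => hle h⟩
          obtain ⟨y, hy, _, ⟨z, rfl⟩, hyz⟩ := Submodule.mem_sup.1 x.2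
          have h1 : σ z ∈ socleSeries (Sl2V m) V (i + 1) := by
            rw [← hyz] at hx'
            exact (add_mem_cancel_left (hle hy)).1 hx'
          have h2 := (p.ker ⟨σ z, hσ z⟩).2 h1
          rw [hpσ] at h2
          rw [← hyz, h2, map_zero, add_zero]
          exact hy
        equivariant := fun s x => p.equivariant s ⟨x, hN x.2⟩ }
    have hmem := le_comap_socle q.covBy
      (show σ (Irr.vec _ 0) ∈ N from Submodule.mem_sup_right ⟨_, rfl⟩)
    have h0 := (p.ker ⟨σ (Irr.vec _ 0), hσ _⟩).2 hmem
    rw [hpσ] at h0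
    exact Irr.vec_ne_zero (Nat.zero_le _) h0

end Criterion

/-! ### Dual modules -/

section Dual

variable {m : ℕ} {V : FDModule.{u} (Sl2V m)}

/-- The submodule of functionals that vanish on `F`. -/
def annihilator (F : LieSubmodule ℂ (Sl2V m) V) : LieSubmodule ℂ (Sl2V m) V.dual :=
  { F.toSubmodule.dualAnnihilator with
    lie_mem := fun {x f} hf => by
      refine (Submodule.mem_dualAnnihilator _).2 fun w hw => ?_
      have h := (Submodule.mem_dualAnnihilator f).1 hf ⁅x, w⁆ (F.lie_mem hw)
      exact neg_eq_zero.2 h }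

theorem mem_annihilator {F : LieSubmodule ℂ (Sl2V m) V} {f : V →ₗ[ℂ] ℂ} :
    (f : V.dual) ∈ annihilator F ↔ ∀ w ∈ F, f w = 0 :=
  Submodule.mem_dualAnnihilator (W := F.toSubmodule) f

/-- The quotient of annihilators is the dual of G / F, and V(b)* ≅ V(b) through the invariant form.
Composing functionals with an equivariant section realises the isomorphism. -/
theorem FactorMap.dual {F G : LieSubmodule ℂ (Sl2V m) V} {b : ℕ} (p : FactorMap F G b) :
    Nonempty (FactorMap (annihilator G) (annihilator F) b) := by
  obtain ⟨σ, hσ, hpσ, hσs⟩ := p.exists_section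
  refine ⟨{
    toFun := (dualEquiv b).symm.toLinearMap ∘ₗ LinearMap.lcomp ℂ ℂ σ ∘ₗ
      (annihilator F).toSubmodule.subtype
    le := fun f hf => mem_annihilator.2 fun w hw => mem_annihilator.1 hf w (p.le hw)
    surj := fun y => ?_
    ker := fun f => ?_
    equivariant := fun s f => ?_ }⟩
  · obtain ⟨f, hf⟩ := LinearMap.exists_extend (p := G.toSubmodule) (dualEquiv b y ∘ₗ p.toFun)
    have hfG : ∀ x : G, f x = dualEquiv b y (p.toFun x) := fun x => LinearMap.congr_fun hf x
    have hfF : f ∈ annihilator F := mem_annihilator.2 fun w hw => by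
      rw [show f w = _ from hfG ⟨w, p.le hw⟩, (p.ker _).2 hw, map_zero]
    refine ⟨⟨f, hfF⟩, ?_⟩
    change (dualEquiv b).symm (f ∘ₗ σ) = y
    rw [LinearEquiv.symm_apply_eq]
    ext z
    rw [LinearMap.comp_apply, show f (σ z) = _ from hfG ⟨σ z, hσ z⟩, hpσ]
  · obtain ⟨(f : V →ₗ[ℂ] ℂ), hf⟩ := f
    change (dualEquiv b).symm (f ∘ₗ σ) = 0 ↔ f ∈ annihilator G
    rw [LinearEquiv.map_eq_zero_iff]
    refine ⟨fun h => mem_annihilator.2 fun w hw => ?_, fun h => LinearMap.ext fun z => ?_⟩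
    · have hd : w - σ (p.toFun ⟨w, hw⟩) ∈ F := by
        refine (p.ker (⟨w, hw⟩ - ⟨σ (p.toFun ⟨w, hw⟩), hσ _⟩)).1 ?_
        rw [map_sub, hpσ, sub_self]
      have h1 := mem_annihilator.1 hf _ hd
      have h2 : f (σ (p.toFun ⟨w, hw⟩)) = 0 := LinearMap.congr_fun h _
      have h3 : f w - f (σ (p.toFun ⟨w, hw⟩)) = 0 := by
        rw [← h1, map_sub]
      rwa [h2, sub_zero] at h3
    · exact mem_annihilator.1 h _ (hσ z)
  · obtain ⟨(f : V →ₗ[ℂ] ℂ), hf⟩ := f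
    change (dualEquiv b).symm (⁅inclSl2 m s, f⁆ ∘ₗ σ) = ⁅s, (dualEquiv b).symm (f ∘ₗ σ)⁆
    rw [LinearEquiv.symm_apply_eq]
    ext z
    rw [dualEquiv_apply, invForm_lie_left, invForm_symm_apply]
    change -f ⁅inclSl2 m s, σ z⁆ = -f (σ ⁅s, z⁆)
    rw [hσs]

theorem UniserialChain.dual {a : List ℕ} {F : ℕ → LieSubmodule ℂ (Sl2V m) V}
    (c : UniserialChain V a F) :
    UniserialChain V.dual a.reverse fun i => annihilator (F (a.length - i)) where
  zero := by
    rw [Nat.sub_zero, c.top, eq_bot_iff]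
    intro f hf
    exact (LieSubmodule.mem_bot f).2
      (LinearMap.ext fun w => mem_annihilator.1 hf w (LieSubmodule.mem_top w))
  top := by
    rw [List.length_reverse, Nat.sub_self, c.zero, eq_top_iff]
    intro (f : V →ₗ[ℂ] ℂ) _
    refine mem_annihilator.2 fun w hw => ?_
    rw [(LieSubmodule.mem_bot w).1 hw]
    exact map_zero f
  factor i := by
    have hi : (i : ℕ) < a.length := by simpa using i.2
    have h := c.factor ⟨a.length - (i + 1), by omega⟩
    have hb : a.reverse.get i = a.get ⟨a.length - (i + 1), by omega⟩ := by
      simp only [List.get_eq_getElem, List.getElem_reverse]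
      congr 1
      omega
    have hs : a.length - (i + 1) + 1 = a.length - i := by omega
    simp only [hs] at h
    rw [hb]
    exact h.some.dual
  rad i hi r f hf := by
    rw [List.length_reverse] at hi
    refine mem_annihilator.2 fun w hw => ?_
    refine neg_eq_zero.2 (mem_annihilator.1 hf _ ?_)
    refine c.rad (a.length - (i + 1)) (by omega) r w ?_
    rwa [show a.length - (i + 1) + 1 = a.length - i by omega]
  not_rad i hi := by
    rw [List.length_reverse] at hi
    obtain ⟨r, x, hx, hrx⟩ := c.not_rad (a.length - (i + 2)) (by omega)
    rw [show a.length - (i + 2) + 2 = a.length - i by omega] at hx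
    -- A functional that vanishes on the lower member but not on r x witnesses `not_rad` in the
    -- dual, since (r f)(x) = -f(r x).
    obtain ⟨f, hfx, hf⟩ := Submodule.exists_dual_map_eq_bot_of_notMem
      (p := (F (a.length - (i + 2))).toSubmodule) hrx inferInstance
    refine ⟨r, f, mem_annihilator.2 fun w hw => ?_, fun hrf => ?_⟩
    · have : f w ∈ (F (a.length - (i + 2))).toSubmodule.map f := ⟨w, hw, rfl⟩
      rw [hf] at this
      exact this
    · exact hfx (neg_eq_zero.1 (mem_annihilator.1 hrf x hx))

theorem IsUniserialWith.dual (hm : 1 ≤ m) {a : List ℕ} (h : IsUniserialWith V a) :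
    IsUniserialWith V.dual a.reverse :=
  (h.2.uniserialChain hm).dual.isUniserialWith

end Dual

/-! ### A criterion in coordinates -/

section Coordinates

variable {m : ℕ} {V : FDModule.{u} (Sl2V m)} {a : List ℕ}

/-- The chain is F k = {v | πⱼ v = 0 for j ≥ k}. The hypothesis `tri` makes V(m) strictly
triangular, and `nd` says that each entry next to the diagonal is nonzero. -/
theorem isUniserialWith_of_coords (π : ∀ i : Fin a.length, V →ₗ[ℂ] Irr (a.get i))
    (inj : ∀ v, (∀ i, π i v = 0) → v = 0)
    (surj : ∀ i y, ∃ v, π i v = y ∧ ∀ j, i < j → π j v = 0)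
    (eqv : ∀ i (s : Sl2) v, π i ⁅inclSl2 m s, v⁆ = ⁅s, π i v⁆)
    (tri : ∀ i r v, (∀ j, i < j → π j v = 0) → π i ⁅inclRad m r, v⁆ = 0)
    (nd : ∀ i : Fin a.length, (i : ℕ) + 1 < a.length →
      ∃ r v, (∀ j : Fin a.length, (i : ℕ) + 1 < j → π j v = 0) ∧ π i ⁅inclRad m r, v⁆ ≠ 0) :
    IsUniserialWith V a := by
  let F : ℕ → LieSubmodule ℂ (Sl2V m) V := fun k => lieSubmoduleOfStable
    (⨅ j : {j : Fin a.length // k ≤ (j : ℕ)}, LinearMap.ker (π j)) (by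
      intro r x hx
      rw [Submodule.mem_iInf] at hx ⊢
      intro j
      exact tri j r x fun j' hj => hx ⟨j', j.2.trans hj.le⟩) (by
      intro s x hx
      rw [Submodule.mem_iInf] at hx ⊢
      intro j
      rw [LinearMap.mem_ker, eqv, LinearMap.mem_ker.1 (hx j), lie_zero])
  have hF : ∀ k x, x ∈ F k ↔ ∀ j : Fin a.length, k ≤ (j : ℕ) → π j x = 0 := by
    intro k x
    rw [mem_lieSubmoduleOfStable, Submodule.mem_iInf]
    exact ⟨fun h j hj => h ⟨j, hj⟩, fun h j => h j j.2⟩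
  have c : UniserialChain V a F := by
    refine ⟨?_, ?_, fun i => ⟨?_⟩, fun i hi r x hx => ?_, fun i hi => ?_⟩
    · rw [eq_bot_iff]
      intro x hx
      exact (LieSubmodule.mem_bot x).2 (inj x fun i => (hF 0 x).1 hx i (Nat.zero_le _))
    · rw [eq_top_iff]
      intro x _
      exact (hF _ x).2 fun j hj => absurd j.2 (by omega)
    · refine { toFun := π i ∘ₗ (F (i + 1)).toSubmodule.subtype, le := ?_, surj := ?_, ker := ?_,
               equivariant := fun s x => eqv i s x }
      · intro x hx
        exact (hF _ x).2 fun j hj => (hF _ x).1 hx j (by omega)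
      · intro y
        obtain ⟨v, hv, hv'⟩ := surj i y
        exact ⟨⟨v, (hF _ v).2 fun j hj => hv' j hj⟩, hv⟩
      · intro x
        rw [hF]
        refine ⟨fun h j hj => ?_, fun h => h i le_rfl⟩
        rcases hj.eq_or_lt with hj | hj
        · rw [← Fin.ext hj]
          exact h
        · exact (hF _ _).1 x.2 j hj
    · rw [hF] at hx ⊢
      intro j hj
      exact tri j r x fun j' hj' => hx j' (by have : (j : ℕ) < j' := hj'; omega)
    · obtain ⟨r, v, hv, hrv⟩ := nd ⟨i, by omega⟩ hi
      exact ⟨r, v, (hF _ _).2 fun j hj => hv j hj, fun h => hrv ((hF _ _).1 h _ le_rfl)⟩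
  exact c.isUniserialWith

end Coordinates

/-! ### Construction of modules of `sl(2) ⋉ V(m)` -/

section Prod

variable {M N : Type*} [AddCommGroup M] [LieRingModule Sl2 M] [AddCommGroup N]
  [LieRingModule Sl2 N]

instance : LieRingModule Sl2 (M × N) where
  bracket s x := (⁅s, x.1⁆, ⁅s, x.2⁆)
  add_lie s t x := Prod.ext (add_lie s t x.1) (add_lie s t x.2)
  lie_add s x y := Prod.ext (lie_add s x.1 y.1) (lie_add s x.2 y.2)
  leibniz_lie s t x := Prod.ext (leibniz_lie s t x.1) (leibniz_lie s t x.2)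

theorem sl2_lie_prod (s : Sl2) (x : M × N) : ⁅s, x⁆ = (⁅s, x.1⁆, ⁅s, x.2⁆) := rfl

variable [Module ℂ M] [LieModule ℂ Sl2 M] [Module ℂ N] [LieModule ℂ Sl2 N]

instance : LieModule ℂ Sl2 (M × N) where
  smul_lie t s x := Prod.ext (smul_lie t s x.1) (smul_lie t s x.2)
  lie_smul t s x := Prod.ext (lie_smul t s x.1) (lie_smul t s x.2)

end Prod

section OfAction

variable {m : ℕ} {X : Type u} [AddCommGroup X] [Module ℂ X] [LieRingModule Sl2 X]
  [LieModule ℂ Sl2 X]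

/-- The bracket of `FDModule.ofAction`. -/
@[reducible] def actionLieRingModule (R : Irr m →ₗ[ℂ] X →ₗ[ℂ] X)
    (hR : ∀ (s : Sl2) r x, ⁅s, R r x⁆ = R ⁅s, r⁆ x + R r ⁅s, x⁆)
    (hc : ∀ r r' x, R r (R r' x) = R r' (R r x)) : LieRingModule (Sl2V m) (ULift.{v} X) :=
  { bracket := fun x w => ULift.up (R x.left w.down + ⁅x.right, w.down⁆)
    add_lie := fun x y w => ULift.ext _ _ (by
      change R (x.left + y.left) w.down + ⁅x.right + y.right, w.down⁆ = _
      rw [map_add, add_lie, LinearMap.add_apply]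
      exact add_add_add_comm _ _ _ _)
    lie_add := fun x w w' => ULift.ext _ _ (by
      change R x.left (w.down + w'.down) + ⁅x.right, w.down + w'.down⁆ = _
      rw [map_add, lie_add]
      exact add_add_add_comm _ _ _ _)
    leibniz_lie := fun x y w => ULift.ext _ _ (by
      change R x.left (R y.left w.down + ⁅y.right, w.down⁆) +
        ⁅x.right, R y.left w.down + ⁅y.right, w.down⁆⁆ =
        (R (0 + ⁅x.right, y.left⁆ - ⁅y.right, x.left⁆) w.down + ⁅⁅x.right, y.right⁆, w.down⁆) +
        (R y.left (R x.left w.down + ⁅x.right, w.down⁆) +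
        ⁅y.right, R x.left w.down + ⁅x.right, w.down⁆⁆)
      rw [map_add, map_add, lie_add, lie_add, hR, hR, hc x.left y.left, zero_add, map_sub,
        LinearMap.sub_apply, leibniz_lie x.right y.right]
      abel) }

theorem actionLieModule (R : Irr m →ₗ[ℂ] X →ₗ[ℂ] X)
    (hR : ∀ (s : Sl2) r x, ⁅s, R r x⁆ = R ⁅s, r⁆ x + R r ⁅s, x⁆)
    (hc : ∀ r r' x, R r (R r' x) = R r' (R r x)) :
    @LieModule ℂ (Sl2V m) (ULift.{v} X) _ _ _ _ _ (actionLieRingModule R hR hc) :=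
  let _ := actionLieRingModule.{u, v} R hR hc
  { smul_lie := fun t x w => ULift.ext _ _ (by
      change R (t • x.left) w.down + ⁅t • x.right, w.down⁆ =
        t • (R x.left w.down + ⁅x.right, w.down⁆)
      rw [map_smul, smul_lie, LinearMap.smul_apply, smul_add])
    lie_smul := fun t x w => ULift.ext _ _ (by
      change R x.left (t • w.down) + ⁅x.right, t • w.down⁆ =
        t • (R x.left w.down + ⁅x.right, w.down⁆)
      rw [map_smul, lie_smul, smul_add]) }

variable [FiniteDimensional ℂ X]

/-- The `sl(2) ⋉ V(m)`-module given by an `sl(2)`-module with an equivariant action of `V(m)` by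
commuting operators. -/
def FDModule.ofAction (R : Irr m →ₗ[ℂ] X →ₗ[ℂ] X)
    (hR : ∀ (s : Sl2) r x, ⁅s, R r x⁆ = R ⁅s, r⁆ x + R r ⁅s, x⁆)
    (hc : ∀ r r' x, R r (R r' x) = R r' (R r x)) : FDModule.{max u v} (Sl2V m) where
  -- The lift lets the models live in any universe, as the existence statement for V(0), V(m), V(0)
  -- requires.
  carrier := ULift.{v} X
  lieRingModule := actionLieRingModule R hR hc
  lieModule := actionLieModule R hR hc

variable {R : Irr m →ₗ[ℂ] X →ₗ[ℂ] X}
  {hR : ∀ (s : Sl2) r x, ⁅s, R r x⁆ = R ⁅s, r⁆ x + R r ⁅s, x⁆}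
  {hc : ∀ r r' x, R r (R r' x) = R r' (R r x)}

/-- The underlying linear isomorphism of `FDModule.ofAction`. -/
def FDModule.ofActionEquiv : FDModule.ofAction.{u, v} R hR hc ≃ₗ[ℂ] X := ULift.moduleEquiv

theorem FDModule.ofActionEquiv_lie (x : Sl2V m) (w : FDModule.ofAction.{u, v} R hR hc) :
    FDModule.ofActionEquiv ⁅x, w⁆ =
      R x.left (FDModule.ofActionEquiv w) + ⁅x.right, FDModule.ofActionEquiv w⁆ := rfl

theorem FDModule.ofActionEquiv_lie_inclRad (r : Irr m) (w : FDModule.ofAction.{u, v} R hR hc) :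
    FDModule.ofActionEquiv ⁅inclRad m r, w⁆ = R r (FDModule.ofActionEquiv w) := by
  rw [FDModule.ofActionEquiv_lie]
  exact (congrArg (R r (FDModule.ofActionEquiv w) + ·) (zero_lie _)).trans (add_zero _)

theorem FDModule.ofActionEquiv_lie_inclSl2 (s : Sl2) (w : FDModule.ofAction.{u, v} R hR hc) :
    FDModule.ofActionEquiv ⁅inclSl2 m s, w⁆ = ⁅s, FDModule.ofActionEquiv w⁆ := by
  rw [FDModule.ofActionEquiv_lie]
  change R 0 _ + ⁅s, _⁆ = _
  rw [map_zero, LinearMap.zero_apply, zero_add]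

theorem FDModule.iso_ofAction {W : FDModule.{w} (Sl2V m)} (Φ : X →ₗ[ℂ] W)
    (hΦ : Function.Bijective Φ) (hs : ∀ (s : Sl2) x, Φ ⁅s, x⁆ = ⁅inclSl2 m s, Φ x⁆)
    (hr : ∀ r x, Φ (R r x) = ⁅inclRad m r, Φ x⁆) : W.Iso (FDModule.ofAction.{u, v} R hR hc) := by
  let e : W ≃ₗ[ℂ] FDModule.ofAction.{u, v} R hR hc :=
    (LinearEquiv.ofBijective Φ hΦ).symm ≪≫ₗ FDModule.ofActionEquiv.symm
  have he : ∀ w, e w = FDModule.ofActionEquiv.symm ((LinearEquiv.ofBijective Φ hΦ).symm w) :=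
    fun _ => rfl
  refine ⟨{ e with map_lie' := fun {x w} => ?_ }⟩
  change e ⁅x, w⁆ = ⁅x, e w⁆
  obtain ⟨y, rfl⟩ := hΦ.2 w
  apply FDModule.ofActionEquiv.injective
  have hy : ∀ y, (LinearEquiv.ofBijective Φ hΦ).symm (Φ y) = y := fun y =>
    (LinearEquiv.symm_apply_eq _).2 rfl
  have hx : ⁅x, Φ y⁆ = Φ (R x.left y + ⁅x.right, y⁆) := by
    conv_lhs => rw [eq_inclRad_add_inclSl2 x, add_lie]
    rw [map_add, hs, hr]
  rw [FDModule.ofActionEquiv_lie, he, he, hx, hy, hy, LinearEquiv.apply_symm_apply,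
    LinearEquiv.apply_symm_apply]

end OfAction

/-! ### The uniserial modules with factors `V(0), V(m), V(ℓ)` and `V(0), V(m), V(m), V(0)` -/

section Models

variable {m l : ℕ}

/-- The action of `V(m)` on `V(0) ⊕ V(m) ⊕ V(ℓ)` defined by `T`. -/
def action₃ (T : Irr m →ₗ[ℂ] Irr l →ₗ[ℂ] Irr m) :
    Irr m →ₗ[ℂ] (Irr 0 × Irr m × Irr l) →ₗ[ℂ] Irr 0 × Irr m × Irr l :=
  LinearMap.mk₂ ℂ (fun r x => (invForm₀ m r x.2.1, T r x.2.2, 0))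
    (fun r r' x => by simp) (fun t r x => by simp) (fun r x x' => by simp) (fun t r x => by simp)

theorem action₃_apply (T : Irr m →ₗ[ℂ] Irr l →ₗ[ℂ] Irr m) (r : Irr m) (x) :
    action₃ T r x = (invForm₀ m r x.2.1, T r x.2.2, 0) := rfl

/-- The module `V(0) ⊕ V(m) ⊕ V(ℓ)` defined by `T`. -/
def model₃ (T : Irr m →ₗ[ℂ] Irr l →ₗ[ℂ] Irr m) (hT : IsEquivariant T)
    (hs : ∀ r s q, invForm m s (T r q) = invForm m r (T s q)) : FDModule.{v} (Sl2V m) :=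
  FDModule.ofAction.{0, v} (action₃ T)
    (fun s r x => by
      simp only [action₃_apply, sl2_lie_prod, isEquivariant_invForm₀ s, hT s, lie_zero,
        Prod.mk_add_mk, add_zero])
    -- Two successive operators leave only B(r, T(r', q)) in V(0), so commutation is the symmetry
    -- `hs`.
    (fun r r' x => by
      simp only [action₃_apply, invForm₀_apply, hs r, map_zero])

theorem isUniserialWith_model₃ {T : Irr m →ₗ[ℂ] Irr l →ₗ[ℂ] Irr m} {hT : IsEquivariant T}
    {hs : ∀ r s q, invForm m s (T r q) = invForm m r (T s q)} (hT0 : T ≠ 0) :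
    IsUniserialWith (model₃.{v} T hT hs) [0, m, l] := by
  let e : model₃.{v} T hT hs ≃ₗ[ℂ] Irr 0 × Irr m × Irr l := FDModule.ofActionEquiv
  have hes : ∀ (s : Sl2) w, e ⁅inclSl2 m s, w⁆ = ⁅s, e w⁆ := FDModule.ofActionEquiv_lie_inclSl2
  have her : ∀ r w, e ⁅inclRad m r, w⁆ = action₃ T r (e w) := FDModule.ofActionEquiv_lie_inclRad
  let π : ∀ i : Fin [0, m, l].length, model₃.{v} T hT hs →ₗ[ℂ] Irr ([0, m, l].get i) := fun i =>
    match i with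
    | ⟨0, _⟩ => LinearMap.fst ℂ _ _ ∘ₗ e.toLinearMap
    | ⟨1, _⟩ => LinearMap.fst ℂ _ _ ∘ₗ LinearMap.snd ℂ _ _ ∘ₗ e.toLinearMap
    | ⟨2, _⟩ => LinearMap.snd ℂ _ _ ∘ₗ LinearMap.snd ℂ _ _ ∘ₗ e.toLinearMap
  refine isUniserialWith_of_coords π ?_ ?_ ?_ ?_ ?_
  · intro w hw
    exact e.map_eq_zero_iff.1 (Prod.ext (hw 0) (Prod.ext (hw 1) (hw 2)))
  · rintro ⟨_ | _ | _ | i, hi⟩ y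
    · refine ⟨e.symm (y, 0, 0), congrArg (·.1) (e.apply_symm_apply (y, 0, 0)), ?_⟩
      rintro ⟨_ | _ | _ | j, hj⟩ h
      · exact (lt_irrefl _ h).elim
      · exact congrArg (·.2.1) (e.apply_symm_apply (y, 0, 0))
      · exact congrArg (·.2.2) (e.apply_symm_apply (y, 0, 0))
      · exact absurd hj (by simp)
    · refine ⟨e.symm (0, y, 0), ?_, ?_⟩
      · exact congrArg (·.2.1) (e.apply_symm_apply (0, y, 0))
      · rintro ⟨_ | _ | _ | j, hj⟩ h
        · exact absurd h (by simp)
        · exact (lt_irrefl _ h).elim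
        · exact congrArg (·.2.2) (e.apply_symm_apply (0, y, 0))
        · exact absurd hj (by simp)
    · refine ⟨e.symm (0, 0, y), ?_, ?_⟩
      · exact congrArg (·.2.2) (e.apply_symm_apply (0, 0, y))
      · rintro ⟨_ | _ | _ | j, hj⟩ h
        · exact absurd h (by simp)
        · exact absurd h (by simp)
        · exact (lt_irrefl _ h).elim
        · exact absurd hj (by simp)
    · exact absurd hi (by simp)
  · rintro ⟨_ | _ | _ | i, hi⟩ s w
    · exact congrArg (·.1) (hes s w)
    · exact congrArg (·.2.1) (hes s w)
    · exact congrArg (·.2.2) (hes s w)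
    · exact absurd hi (by simp)
  · rintro ⟨_ | _ | _ | i, hi⟩ r w hw
    · have : (e w).2.1 = 0 := hw 1 (Nat.lt_succ_self 0)
      exact (congrArg (·.1) (her r w)).trans ((congrArg (invForm₀ m r) this).trans (map_zero _))
    · have : (e w).2.2 = 0 := hw 2 (Nat.lt_succ_self 1)
      exact (congrArg (·.2.1) (her r w)).trans ((congrArg (T r) this).trans (map_zero _))
    · exact congrArg (·.2.2) (her r w)
    · exact absurd hi (by simp)
  · rintro ⟨_ | _ | i, hi⟩ h
    · obtain ⟨r, hr⟩ := DFunLike.ne_iff.1 (invForm₀_ne_zero (m := m))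
      obtain ⟨x, hx⟩ := DFunLike.ne_iff.1 hr
      have hex := e.apply_symm_apply (0, x, 0)
      refine ⟨r, e.symm (0, x, 0), ?_, fun h => hx ?_⟩
      · rintro ⟨_ | _ | _ | j, hj⟩ h
        · exact absurd h (by simp)
        · exact absurd h (by simp)
        · exact congrArg (·.2.2) hex
        · exact absurd hj (by simp)
      · have := (congrArg (·.1) (her r _)).symm.trans h
        rwa [hex] at this
    · obtain ⟨r, hr⟩ := DFunLike.ne_iff.1 hT0
      obtain ⟨x, hx⟩ := DFunLike.ne_iff.1 hr
      have hex := e.apply_symm_apply (0, 0, x)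
      refine ⟨r, e.symm (0, 0, x), ?_, fun h => hx ?_⟩
      · rintro ⟨_ | _ | _ | j, hj⟩ h
        · exact absurd h (by simp)
        · exact absurd h (by simp)
        · exact absurd h (by simp)
        · exact absurd hj (by simp)
      · have := (congrArg (·.2.1) (her r _)).symm.trans h
        rwa [hex] at this
    · exact absurd h (by simp)

/-- The action of `V(m)` on `V(0) ⊕ V(m) ⊕ V(m) ⊕ V(0)` defined by `T` and a parameter `z`. -/
def action₄ (T : Irr m →ₗ[ℂ] Irr m →ₗ[ℂ] Irr m) (z : ℂ) :
    Irr m →ₗ[ℂ] (Irr 0 × Irr m × Irr m × Irr 0) →ₗ[ℂ] Irr 0 × Irr m × Irr m × Irr 0 :=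
  LinearMap.mk₂ ℂ (fun r x => (invForm₀ m r (x.2.1 + z • x.2.2.1), T r x.2.2.1,
      scalarMap m r x.2.2.2, 0))
    (fun r r' x => by simp) (fun t r x => by simp)
    (fun r x x' => by
      simp only [Prod.fst_add, Prod.snd_add, smul_add, map_add, Prod.mk_add_mk, add_zero]
      congr 1
      abel)
    (fun t r x => by
      simp only [Prod.smul_fst, Prod.smul_snd, smul_comm z t, ← smul_add, map_smul, Prod.smul_mk,
        smul_zero])

theorem action₄_apply (T : Irr m →ₗ[ℂ] Irr m →ₗ[ℂ] Irr m) (z : ℂ) (r : Irr m) (x) :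
    action₄ T z r x = (invForm₀ m r (x.2.1 + z • x.2.2.1), T r x.2.2.1,
      scalarMap m r x.2.2.2, 0) := rfl

/-- The module `V(0) ⊕ V(m) ⊕ V(m) ⊕ V(0)` defined by `T` and a parameter `z`. -/
def model₄ (hm : Even m) (T : Irr m →ₗ[ℂ] Irr m →ₗ[ℂ] Irr m) (hT : IsEquivariant T)
    (hs : ∀ r s q, invForm m s (T r q) = invForm m r (T s q)) (hsymm : ∀ r s, T r s = T s r)
    (z : ℂ) : FDModule.{v} (Sl2V m) :=
  FDModule.ofAction.{0, v} (action₄ T z)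
    (fun s r x => by
      simp only [action₄_apply, sl2_lie_prod, isEquivariant_invForm₀ s, hT s,
        isEquivariant_scalarMap s, lie_zero, lie_add, lie_smul, Prod.mk_add_mk, add_zero])
    -- On (a, p, q, c) the composite has components B(r, T(r', q)) + z c B(r, r') and c T(r, r').
    -- Commutation uses `hs`, the symmetry of B for even m, and that of T.
    (fun r r' x => by
      have h : ∀ r r', invForm m r r' = invForm m r' r := fun r r' => by
        rw [invForm_swap r' r, hm.neg_one_pow, one_mul]
      simp only [action₄_apply, invForm₀_apply, scalarMap_apply, map_add, map_smul, map_zero]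
      rw [hs r' r, h r r', hsymm r r'])

theorem isUniserialWith_model₄ {hm : Even m} {T : Irr m →ₗ[ℂ] Irr m →ₗ[ℂ] Irr m}
    {hT : IsEquivariant T} {hs : ∀ r s q, invForm m s (T r q) = invForm m r (T s q)}
    {hsymm : ∀ r s, T r s = T s r} (hT0 : T ≠ 0) (z : ℂ) :
    IsUniserialWith (model₄.{v} hm T hT hs hsymm z) [0, m, m, 0] := by
  let e : model₄.{v} hm T hT hs hsymm z ≃ₗ[ℂ] Irr 0 × Irr m × Irr m × Irr 0 :=
    FDModule.ofActionEquiv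
  have hes : ∀ (s : Sl2) w, e ⁅inclSl2 m s, w⁆ = ⁅s, e w⁆ := FDModule.ofActionEquiv_lie_inclSl2
  have her : ∀ r w, e ⁅inclRad m r, w⁆ = action₄ T z r (e w) := FDModule.ofActionEquiv_lie_inclRad
  let π : ∀ i : Fin [0, m, m, 0].length,
      model₄.{v} hm T hT hs hsymm z →ₗ[ℂ] Irr ([0, m, m, 0].get i) := fun i =>
    match i with
    | ⟨0, _⟩ => LinearMap.fst ℂ _ _ ∘ₗ e.toLinearMap
    | ⟨1, _⟩ => LinearMap.fst ℂ _ _ ∘ₗ LinearMap.snd ℂ _ _ ∘ₗ e.toLinearMap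
    | ⟨2, _⟩ => LinearMap.fst ℂ _ _ ∘ₗ LinearMap.snd ℂ _ _ ∘ₗ LinearMap.snd ℂ _ _ ∘ₗ e.toLinearMap
    | ⟨3, _⟩ => LinearMap.snd ℂ _ _ ∘ₗ LinearMap.snd ℂ _ _ ∘ₗ LinearMap.snd ℂ _ _ ∘ₗ e.toLinearMap
  refine isUniserialWith_of_coords π ?_ ?_ ?_ ?_ ?_
  · intro w hw
    exact e.map_eq_zero_iff.1 (Prod.ext (hw 0) (Prod.ext (hw 1) (Prod.ext (hw 2) (hw 3))))
  · rintro ⟨_ | _ | _ | _ | i, hi⟩ y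
    · have hex := e.apply_symm_apply (y, 0, 0, 0)
      refine ⟨e.symm (y, 0, 0, 0), congrArg (·.1) hex, ?_⟩
      rintro ⟨_ | _ | _ | _ | j, hj⟩ h
      · exact (lt_irrefl _ h).elim
      · exact congrArg (·.2.1) hex
      · exact congrArg (·.2.2.1) hex
      · exact congrArg (·.2.2.2) hex
      · exact absurd hj (by simp)
    · have hex := e.apply_symm_apply (0, y, 0, 0)
      refine ⟨e.symm (0, y, 0, 0), congrArg (·.2.1) hex, ?_⟩
      rintro ⟨_ | _ | _ | _ | j, hj⟩ h
      · exact absurd h (by simp)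
      · exact (lt_irrefl _ h).elim
      · exact congrArg (·.2.2.1) hex
      · exact congrArg (·.2.2.2) hex
      · exact absurd hj (by simp)
    · have hex := e.apply_symm_apply (0, 0, y, 0)
      refine ⟨e.symm (0, 0, y, 0), congrArg (·.2.2.1) hex, ?_⟩
      rintro ⟨_ | _ | _ | _ | j, hj⟩ h
      · exact absurd h (by simp)
      · exact absurd h (by simp)
      · exact (lt_irrefl _ h).elim
      · exact congrArg (·.2.2.2) hex
      · exact absurd hj (by simp)
    · have hex := e.apply_symm_apply (0, 0, 0, y)
      refine ⟨e.symm (0, 0, 0, y), congrArg (·.2.2.2) hex, ?_⟩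
      rintro ⟨_ | _ | _ | _ | j, hj⟩ h
      · exact absurd h (by simp)
      · exact absurd h (by simp)
      · exact absurd h (by simp)
      · exact (lt_irrefl _ h).elim
      · exact absurd hj (by simp)
    · exact absurd hi (by simp)
  · rintro ⟨_ | _ | _ | _ | i, hi⟩ s w
    · exact congrArg (·.1) (hes s w)
    · exact congrArg (·.2.1) (hes s w)
    · exact congrArg (·.2.2.1) (hes s w)
    · exact congrArg (·.2.2.2) (hes s w)
    · exact absurd hi (by simp)
  · rintro ⟨_ | _ | _ | _ | i, hi⟩ r w hw
    · have h1 : (e w).2.1 = 0 := hw 1 (Nat.lt_succ_self 0)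
      have h2 : (e w).2.2.1 = 0 := hw 2 (Nat.succ_pos 1)
      refine (congrArg (·.1) (her r w)).trans ?_
      change invForm₀ m r ((e w).2.1 + z • (e w).2.2.1) = 0
      rw [h1, h2, smul_zero, add_zero, map_zero]
    · have h2 : (e w).2.2.1 = 0 := hw 2 (Nat.lt_succ_self 1)
      exact (congrArg (·.2.1) (her r w)).trans ((congrArg (T r) h2).trans (map_zero _))
    · have h3 : (e w).2.2.2 = 0 := hw 3 (Nat.lt_succ_self 2)
      exact (congrArg (·.2.2.1) (her r w)).trans
        ((congrArg (scalarMap m r) h3).trans (map_zero _))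
    · exact congrArg (·.2.2.2) (her r w)
    · exact absurd hi (by simp)
  · rintro ⟨_ | _ | _ | i, hi⟩ h
    · obtain ⟨r, hr⟩ := DFunLike.ne_iff.1 (invForm₀_ne_zero (m := m))
      obtain ⟨x, hx⟩ := DFunLike.ne_iff.1 hr
      have hex := e.apply_symm_apply (0, x, 0, 0)
      refine ⟨r, e.symm (0, x, 0, 0), ?_, fun h => hx ?_⟩
      · rintro ⟨_ | _ | _ | _ | j, hj⟩ h
        · exact absurd h (by simp)
        · exact absurd h (by simp)
        · exact congrArg (·.2.2.1) hex
        · exact congrArg (·.2.2.2) hex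
        · exact absurd hj (by simp)
      · have := (congrArg (·.1) (her r _)).symm.trans h
        rw [hex] at this
        change invForm₀ m r (x + z • 0) = 0 at this
        rwa [smul_zero, add_zero] at this
    · obtain ⟨r, hr⟩ := DFunLike.ne_iff.1 hT0
      obtain ⟨x, hx⟩ := DFunLike.ne_iff.1 hr
      have hex := e.apply_symm_apply (0, 0, x, 0)
      refine ⟨r, e.symm (0, 0, x, 0), ?_, fun h => hx ?_⟩
      · rintro ⟨_ | _ | _ | _ | j, hj⟩ h
        · exact absurd h (by simp)
        · exact absurd h (by simp)
        · exact absurd h (by simp)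
        · exact congrArg (·.2.2.2) hex
        · exact absurd hj (by simp)
      · have := (congrArg (·.2.1) (her r _)).symm.trans h
        rwa [hex] at this
    · obtain ⟨r, hr⟩ := DFunLike.ne_iff.1 (scalarMap_ne_zero (m := m))
      obtain ⟨x, hx⟩ := DFunLike.ne_iff.1 hr
      have hex := e.apply_symm_apply (0, 0, 0, x)
      refine ⟨r, e.symm (0, 0, 0, x), ?_, fun h => hx ?_⟩
      · rintro ⟨_ | _ | _ | _ | j, hj⟩ h
        · exact absurd h (by simp)
        · exact absurd h (by simp)
        · exact absurd h (by simp)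
        · exact absurd h (by simp)
        · exact absurd hj (by simp)
      · have := (congrArg (·.2.2.1) (her r _)).symm.trans h
        rwa [hex] at this
    · exact absurd h (by simp)

end Models

/-! ### Adapted bases -/

/-- A `sl(2) ⋉ V(m)`-module as an `sl(2)`-module. -/
instance {m : ℕ} (V : FDModule.{u} (Sl2V m)) : LieRingModule Sl2 V :=
  LieRingModule.compLieHom V (inclSl2 m)

instance {m : ℕ} (V : FDModule.{u} (Sl2V m)) : LieModule ℂ Sl2 V :=
  LieModule.compLieHom V (inclSl2 m)

section Lift

variable {m : ℕ} {V : FDModule.{u} (Sl2V m)}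

theorem sl2_lie_eq (s : Sl2) (w : V) : ⁅s, w⁆ = ⁅inclSl2 m s, w⁆ := rfl

/-- An `sl(2)`-homomorphism `V(b) → V` that induces an isomorphism `V(b) ≅ G / F`. -/
structure IsLift {b : ℕ} (F G : LieSubmodule ℂ (Sl2V m) V) (σ : Irr b →ₗ⁅ℂ,Sl2⁆ V) : Prop where
  mem : ∀ x, σ x ∈ G
  eq_zero : ∀ x, σ x ∈ F → x = 0
  exists_sub_mem : ∀ y ∈ G, ∃ x, y - σ x ∈ F

namespace IsLift

variable {b : ℕ} {F G : LieSubmodule ℂ (Sl2V m) V} {σ : Irr b →ₗ⁅ℂ,Sl2⁆ V}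

theorem smul (h : IsLift F G σ) {t : ℂ} (ht : t ≠ 0) : IsLift F G (t • σ) where
  mem x := G.smul_mem t (h.mem x)
  eq_zero x hx := h.eq_zero x ((F.toSubmodule.smul_mem_iff ht).1 hx)
  exists_sub_mem y hy := by
    obtain ⟨x, hx⟩ := h.exists_sub_mem y hy
    refine ⟨t⁻¹ • x, ?_⟩
    rwa [map_smul, LieModuleHom.smul_apply, smul_smul, inv_mul_cancel₀ ht, one_smul]

theorem add (h : IsLift F G σ) (hFG : F ≤ G) {τ : Irr b →ₗ⁅ℂ,Sl2⁆ V} (hτ : ∀ x, τ x ∈ F) :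
    IsLift F G (σ + τ) where
  mem x := G.add_mem (h.mem x) (hFG (hτ x))
  eq_zero x hx := h.eq_zero x ((add_mem_cancel_right (hτ x)).1 hx)
  exists_sub_mem y hy := by
    obtain ⟨x, hx⟩ := h.exists_sub_mem y hy
    refine ⟨x, ?_⟩
    rw [LieModuleHom.add_apply, ← sub_sub]
    exact F.sub_mem hx (hτ x)

end IsLift

/-- Subtracting the leading component leaves an equivariant map into the previous member of a chain;
this drives the layer-by-layer decomposition. -/
theorem IsEquivariant.sub_hom {b c : ℕ} {A : Irr m →ₗ[ℂ] Irr c →ₗ[ℂ] V} (hA : IsEquivariant A)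
    {A' : Irr m →ₗ[ℂ] Irr c →ₗ[ℂ] Irr b} (hA' : IsEquivariant A') (σ : Irr b →ₗ⁅ℂ,Sl2⁆ V) :
    IsEquivariant (A - A'.compr₂ (σ : Irr b →ₗ[ℂ] V)) := by
  intro s x y
  simp only [LinearMap.sub_apply, LinearMap.compr₂_apply, LieModuleHom.coe_toLinearMap, lie_sub,
    hA s x y, ← LieModuleHom.map_lie, hA' s x y, map_add]
  abel

theorem FactorMap.exists_lift {F G : LieSubmodule ℂ (Sl2V m) V} {b : ℕ} (p : FactorMap F G b) :
    ∃ σ : Irr b →ₗ⁅ℂ,Sl2⁆ V, IsLift F G σ ∧ ∀ (c : ℕ) (A : Irr m →ₗ[ℂ] Irr c →ₗ[ℂ] V),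
      IsEquivariant A → (∀ r x, A r x ∈ G) →
        ∃ A' : Irr m →ₗ[ℂ] Irr c →ₗ[ℂ] Irr b, IsEquivariant A' ∧
          ∀ r x, A r x - σ (A' r x) ∈ F := by
  obtain ⟨σ, hσ, hpσ, hσs⟩ := p.exists_section
  have hsub : ∀ y (hy : y ∈ G), y - σ (p.toFun ⟨y, hy⟩) ∈ F := by
    intro y hy
    refine (p.ker (⟨y, hy⟩ - ⟨σ (p.toFun ⟨y, hy⟩), hσ _⟩)).1 ?_
    rw [map_sub, hpσ, sub_self]
  refine ⟨{ σ with map_lie' := fun {s x} => hσs s x }, ⟨hσ, fun x hx => ?_, fun y hy =>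
    ⟨_, hsub y hy⟩⟩, fun c A hA hAG => ?_⟩
  · rw [← hpσ x]
    exact (p.ker _).2 hx
  · refine ⟨LinearMap.mk₂ ℂ (fun r x => p.toFun ⟨A r x, hAG r x⟩) ?_ ?_ ?_ ?_, fun s r x => ?_,
      fun r x => hsub _ (hAG r x)⟩
    · intro r r' x
      rw [← map_add]
      congr 1
      exact Subtype.ext (LinearMap.congr_fun (map_add A r r') x)
    · intro t r x
      rw [← map_smul]
      congr 1
      exact Subtype.ext (LinearMap.congr_fun (map_smul A t r) x)
    · intro r x x'
      rw [← map_add]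
      congr 1
      exact Subtype.ext (map_add _ _ _)
    · intro t r x
      rw [← map_smul]
      congr 1
      exact Subtype.ext (map_smul _ _ _)
    · change ⁅s, p.toFun ⟨A r x, hAG r x⟩⁆ = p.toFun ⟨A ⁅s, r⁆ x, hAG _ _⟩ +
        p.toFun ⟨A r ⁅s, x⁆, hAG _ _⟩
      rw [← p.equivariant, ← map_add]
      congr 1
      exact Subtype.ext (hA s r x)

/-- The action of `V(m)` as a bilinear map. -/
def radAct {b : ℕ} (σ : Irr b →ₗ⁅ℂ,Sl2⁆ V) : Irr m →ₗ[ℂ] Irr b →ₗ[ℂ] V :=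
  LinearMap.mk₂ ℂ (fun r x => ⁅inclRad m r, σ x⁆)
    (fun r r' x => by rw [map_add, add_lie]) (fun t r x => by rw [map_smul, smul_lie])
    (fun r x x' => by rw [map_add, lie_add]) (fun t r x => by rw [map_smul, lie_smul])

theorem radAct_apply {b : ℕ} (σ : Irr b →ₗ⁅ℂ,Sl2⁆ V) (r : Irr m) (x : Irr b) :
    radAct σ r x = ⁅inclRad m r, σ x⁆ := rfl

theorem isEquivariant_radAct {b : ℕ} (σ : Irr b →ₗ⁅ℂ,Sl2⁆ V) : IsEquivariant (radAct σ) := by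
  intro s r x
  rw [sl2_lie_eq, radAct_apply, radAct_apply, radAct_apply, inclSl2_lie_lie, LieModuleHom.map_lie,
    sl2_lie_eq]

theorem UniserialChain.exists_lie_notMem {a : List ℕ} {F : ℕ → LieSubmodule ℂ (Sl2V m) V}
    (c : UniserialChain V a F) {i b : ℕ} (hi : i + 1 < a.length) {σ : Irr b →ₗ⁅ℂ,Sl2⁆ V}
    (hσ : IsLift (F (i + 1)) (F (i + 2)) σ) : ∃ r x, ⁅inclRad m r, σ x⁆ ∉ F i := by
  obtain ⟨r, y, hy, hry⟩ := c.not_rad i hi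
  obtain ⟨x, hx⟩ := hσ.exists_sub_mem y hy
  refine ⟨r, x, fun h => hry ?_⟩
  have := (F i).add_mem (c.rad i (by omega) r _ hx) h
  rwa [← lie_add, sub_add_cancel] at this

/-- An equivariant map `V(m) × V(ℓ) → V(0)` factors through the invariant form. -/
theorem IsEquivariant.exists_eq_invForm₀ {l : ℕ} {A : Irr m →ₗ[ℂ] Irr l →ₗ[ℂ] Irr 0}
    (hA : IsEquivariant A) :
    ∃ ξ : Irr l →ₗ⁅ℂ,Sl2⁆ Irr m, ∀ r q, A r q = invForm₀ m r (ξ q) := by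
  by_cases h0 : A = 0
  · exact ⟨0, fun r q => by rw [h0]; simp⟩
  · obtain ⟨i, hi, h⟩ := hA.exists_weight h0
    obtain rfl : i = 0 := by omega
    obtain rfl : m = l := by
      have : (m : ℂ) = l := by simpa [sub_eq_zero] using h
      exact_mod_cast this
    obtain ⟨d, rfl⟩ := hA.exists_eq_smul isEquivariant_invForm₀ invForm₀_ne_zero
    exact ⟨d • LieModuleHom.id, fun r q => by simp⟩

/-- Each component of the action is an equivariant map between irreducible modules, hence a multiple
of the given one. The multiples α and β are nonzero by `not_rad`. The last clause splits any
equivariant map into F 3 along the three lifts and serves for a fourth factor. -/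
theorem UniserialChain.exists_lifts {l : ℕ} {t : List ℕ} {F : ℕ → LieSubmodule ℂ (Sl2V m) V}
    (c : UniserialChain V (0 :: m :: l :: t) F) {T : Irr m →ₗ[ℂ] Irr l →ₗ[ℂ] Irr m}
    (hT : IsEquivariant T) (hT0 : T ≠ 0) :
    ∃ (σ₀ : Irr 0 →ₗ⁅ℂ,Sl2⁆ V) (σ₁ : Irr m →ₗ⁅ℂ,Sl2⁆ V) (σ₂ : Irr l →ₗ⁅ℂ,Sl2⁆ V) (α β : ℂ)
      (ξ : Irr l →ₗ⁅ℂ,Sl2⁆ Irr m),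
      IsLift (F 0) (F 1) σ₀ ∧ IsLift (F 1) (F 2) σ₁ ∧ IsLift (F 2) (F 3) σ₂ ∧ α ≠ 0 ∧ β ≠ 0 ∧
      (∀ r x, ⁅inclRad m r, σ₀ x⁆ = 0) ∧
      (∀ r x, ⁅inclRad m r, σ₁ x⁆ = α • σ₀ (invForm₀ m r x)) ∧
      (∀ r x, ⁅inclRad m r, σ₂ x⁆ = β • σ₁ (T r x) + σ₀ (invForm₀ m r (ξ x))) ∧
      (∀ (b : ℕ) (A : Irr m →ₗ[ℂ] Irr b →ₗ[ℂ] V), IsEquivariant A → (∀ r x, A r x ∈ F 3) →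
        ∃ (A₀ : Irr m →ₗ[ℂ] Irr b →ₗ[ℂ] Irr 0) (A₁ : Irr m →ₗ[ℂ] Irr b →ₗ[ℂ] Irr m)
          (A₂ : Irr m →ₗ[ℂ] Irr b →ₗ[ℂ] Irr l), IsEquivariant A₀ ∧ IsEquivariant A₁ ∧
          IsEquivariant A₂ ∧ ∀ r x, A r x = σ₀ (A₀ r x) + σ₁ (A₁ r x) + σ₂ (A₂ r x)) := by
  have hlen : (0 :: m :: l :: t).length = t.length + 3 := rfl
  obtain ⟨σ₀, h₀, d₀⟩ := (c.factor ⟨0, by omega⟩).some.exists_lift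
  obtain ⟨σ₁, h₁, d₁⟩ := (c.factor ⟨1, by omega⟩).some.exists_lift
  obtain ⟨σ₂, h₂, d₂⟩ := (c.factor ⟨2, by omega⟩).some.exists_lift
  have d₀' : ∀ (b : ℕ) (A : Irr m →ₗ[ℂ] Irr b →ₗ[ℂ] V), IsEquivariant A →
      (∀ r x, A r x ∈ F 1) → ∃ A₀ : Irr m →ₗ[ℂ] Irr b →ₗ[ℂ] Irr 0, IsEquivariant A₀ ∧
        ∀ r x, A r x = σ₀ (A₀ r x) := by
    intro b A hA hAF
    obtain ⟨A₀, hA₀, h⟩ := d₀ b A hA hAF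
    refine ⟨A₀, hA₀, fun r x => sub_eq_zero.1 ?_⟩
    have := h r x
    rw [c.zero] at this
    exact (LieSubmodule.mem_bot _).1 this
  have d₁' : ∀ (b : ℕ) (A : Irr m →ₗ[ℂ] Irr b →ₗ[ℂ] V), IsEquivariant A →
      (∀ r x, A r x ∈ F 2) → ∃ (A₀ : Irr m →ₗ[ℂ] Irr b →ₗ[ℂ] Irr 0)
        (A₁ : Irr m →ₗ[ℂ] Irr b →ₗ[ℂ] Irr m), IsEquivariant A₀ ∧ IsEquivariant A₁ ∧
        ∀ r x, A r x = σ₀ (A₀ r x) + σ₁ (A₁ r x) := by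
    intro b A hA hAF
    obtain ⟨A₁, hA₁, h⟩ := d₁ b A hA hAF
    obtain ⟨A₀, hA₀, h'⟩ := d₀' b _ (hA.sub_hom hA₁ σ₁) h
    exact ⟨A₀, A₁, hA₀, hA₁, fun r x => sub_eq_iff_eq_add.1 (h' r x)⟩
  have d₂' : ∀ (b : ℕ) (A : Irr m →ₗ[ℂ] Irr b →ₗ[ℂ] V), IsEquivariant A →
      (∀ r x, A r x ∈ F 3) → ∃ (A₀ : Irr m →ₗ[ℂ] Irr b →ₗ[ℂ] Irr 0)
        (A₁ : Irr m →ₗ[ℂ] Irr b →ₗ[ℂ] Irr m) (A₂ : Irr m →ₗ[ℂ] Irr b →ₗ[ℂ] Irr l),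
        IsEquivariant A₀ ∧ IsEquivariant A₁ ∧ IsEquivariant A₂ ∧
        ∀ r x, A r x = σ₀ (A₀ r x) + σ₁ (A₁ r x) + σ₂ (A₂ r x) := by
    intro b A hA hAF
    obtain ⟨A₂, hA₂, h⟩ := d₂ b A hA hAF
    obtain ⟨A₀, A₁, hA₀, hA₁, h'⟩ := d₁' b _ (hA.sub_hom hA₂ σ₂) h
    exact ⟨A₀, A₁, A₂, hA₀, hA₁, hA₂, fun r x => sub_eq_iff_eq_add.1 (h' r x)⟩
  have hr₀ : ∀ r x, ⁅inclRad m r, σ₀ x⁆ = 0 := by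
    intro r x
    have := c.rad 0 (by omega) r _ (h₀.mem x)
    rw [c.zero] at this
    exact (LieSubmodule.mem_bot _).1 this
  obtain ⟨A₀, hA₀, e₁⟩ := d₀' m (radAct σ₁) (isEquivariant_radAct σ₁)
    fun r x => c.rad 1 (by omega) r _ (h₁.mem x)
  obtain ⟨α, rfl⟩ := hA₀.exists_eq_smul isEquivariant_invForm₀ invForm₀_ne_zero
  obtain ⟨C₀, C₁, hC₀, hC₁, e₂⟩ := d₁' l (radAct σ₂) (isEquivariant_radAct σ₂)
    fun r x => c.rad 2 (by omega) r _ (h₂.mem x)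
  obtain ⟨β, rfl⟩ := hC₁.exists_eq_smul hT hT0
  obtain ⟨ξ, hξ⟩ := hC₀.exists_eq_invForm₀
  have e₁' : ∀ r x, ⁅inclRad m r, σ₁ x⁆ = α • σ₀ (invForm₀ m r x) := by
    intro r x
    rw [← radAct_apply, e₁, LinearMap.smul_apply, LinearMap.smul_apply, map_smul]
  have e₂' : ∀ r x, ⁅inclRad m r, σ₂ x⁆ = β • σ₁ (T r x) + σ₀ (invForm₀ m r (ξ x)) := by
    intro r x
    rw [← radAct_apply, e₂, LinearMap.smul_apply, LinearMap.smul_apply, map_smul, hξ, add_comm]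
  refine ⟨σ₀, σ₁, σ₂, α, β, ξ, h₀, h₁, h₂, ?_, ?_, hr₀, e₁', e₂', d₂'⟩
  · rintro rfl
    obtain ⟨r, x, h⟩ := c.exists_lie_notMem (i := 0) (by omega) h₁
    refine h ?_
    rw [e₁', zero_smul]
    exact (F 0).zero_mem
  · rintro rfl
    obtain ⟨r, x, h⟩ := c.exists_lie_notMem (i := 1) (by omega) h₂
    refine h ?_
    rw [e₂', zero_smul, zero_add]
    exact h₀.mem _

theorem UniserialChain.exists_normal_form₃ {l : ℕ} {t : List ℕ}
    {F : ℕ → LieSubmodule ℂ (Sl2V m) V} (c : UniserialChain V (0 :: m :: l :: t) F)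
    {T : Irr m →ₗ[ℂ] Irr l →ₗ[ℂ] Irr m} (hT : IsEquivariant T) (hT0 : T ≠ 0) :
    ∃ (σ₀ : Irr 0 →ₗ⁅ℂ,Sl2⁆ V) (σ₁ : Irr m →ₗ⁅ℂ,Sl2⁆ V) (σ₂ : Irr l →ₗ⁅ℂ,Sl2⁆ V),
      IsLift (F 0) (F 1) σ₀ ∧ IsLift (F 1) (F 2) σ₁ ∧ IsLift (F 2) (F 3) σ₂ ∧
      (∀ r x, ⁅inclRad m r, σ₀ x⁆ = 0) ∧
      (∀ r x, ⁅inclRad m r, σ₁ x⁆ = σ₀ (invForm₀ m r x)) ∧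
      (∀ r x, ⁅inclRad m r, σ₂ x⁆ = σ₁ (T r x)) := by
  obtain ⟨σ₀, σ₁, σ₂, α, β, ξ, h₀, h₁, h₂, hα, hβ, e₀, e₁, e₂, -⟩ := c.exists_lifts hT hT0
  -- The term -α⁻¹ σ₁ ∘ ξ cancels the component of the action from V(ℓ) to V(0); the scalings absorb
  -- α and β.
  refine ⟨(α * β) • σ₀, β • σ₁, σ₂ + (-α⁻¹) • σ₁.comp ξ, h₀.smul (mul_ne_zero hα hβ), h₁.smul hβ,
    h₂.add (c.covBy (i := 2) (by simp)).le fun x => (F 2).smul_mem _ (h₁.mem _),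
    fun r x => ?_, fun r x => ?_, fun r x => ?_⟩
  · rw [LieModuleHom.smul_apply, lie_smul, e₀, smul_zero]
  · rw [LieModuleHom.smul_apply, LieModuleHom.smul_apply, lie_smul, e₁, smul_smul, mul_comm]
  · rw [LieModuleHom.add_apply, LieModuleHom.smul_apply, LieModuleHom.smul_apply, lie_add,
      lie_smul, e₂, LieModuleHom.comp_apply, e₁, smul_smul, neg_mul, inv_mul_cancel₀ hα]
    module

theorem UniserialChain.exists_normal_form₄ (hm : 1 ≤ m) {F : ℕ → LieSubmodule ℂ (Sl2V m) V}
    (c : UniserialChain V [0, m, m, 0] F) {T : Irr m →ₗ[ℂ] Irr m →ₗ[ℂ] Irr m}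
    (hT : IsEquivariant T) (hT0 : T ≠ 0) :
    ∃ (σ₀ : Irr 0 →ₗ⁅ℂ,Sl2⁆ V) (σ₁ σ₂ : Irr m →ₗ⁅ℂ,Sl2⁆ V) (σ₃ : Irr 0 →ₗ⁅ℂ,Sl2⁆ V) (z : ℂ),
      IsLift (F 0) (F 1) σ₀ ∧ IsLift (F 1) (F 2) σ₁ ∧ IsLift (F 2) (F 3) σ₂ ∧
      IsLift (F 3) (F 4) σ₃ ∧
      (∀ r x, ⁅inclRad m r, σ₀ x⁆ = 0) ∧
      (∀ r x, ⁅inclRad m r, σ₁ x⁆ = σ₀ (invForm₀ m r x)) ∧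
      (∀ r x, ⁅inclRad m r, σ₂ x⁆ = σ₁ (T r x) + z • σ₀ (invForm₀ m r x)) ∧
      (∀ r x, ⁅inclRad m r, σ₃ x⁆ = σ₂ (scalarMap m r x)) := by
  obtain ⟨σ₀, σ₁, σ₂, α, β, ξ, h₀, h₁, h₂, hα, hβ, e₀, e₁, e₂, hdec⟩ := c.exists_lifts hT hT0
  obtain ⟨d, hd⟩ : ∃ d : ℂ, ∀ r x, invForm₀ m r (ξ x) = d • invForm₀ m r x := by
    have : IsEquivariant ((invForm₀ m).compl₂ (ξ : Irr m →ₗ[ℂ] Irr m)) := by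
      intro s r x
      simp only [LinearMap.compl₂_apply, LieModuleHom.coe_toLinearMap, LieModuleHom.map_lie]
      exact isEquivariant_invForm₀ s r (ξ x)
    obtain ⟨d, hd⟩ := this.exists_eq_smul isEquivariant_invForm₀ invForm₀_ne_zero
    exact ⟨d, fun r x => LinearMap.congr_fun₂ hd r x⟩
  obtain ⟨σ₃, h₃, -⟩ := (c.factor ⟨3, by simp⟩).some.exists_lift
  obtain ⟨A₀, A₁, A₂, hA₀, hA₁, hA₂, e₃⟩ := hdec 0 (radAct σ₃) (isEquivariant_radAct σ₃)
    fun r x => c.rad 3 (by simp) r _ (h₃.mem x)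
  -- A nonzero equivariant map V(m) × V(0) → V(0) would make m a weight of V(0), which m ≥ 1
  -- excludes.
  have hA₀0 : A₀ = 0 := by
    by_contra h
    obtain ⟨i, hi, h⟩ := hA₀.exists_weight h
    obtain rfl : i = 0 := by omega
    have : (m : ℂ) = 0 := by simpa using h
    have : m = 0 := by exact_mod_cast this
    omega
  obtain ⟨ε, rfl⟩ := hA₁.exists_eq_smul isEquivariant_scalarMap scalarMap_ne_zero
  obtain ⟨γ, rfl⟩ := hA₂.exists_eq_smul isEquivariant_scalarMap scalarMap_ne_zero
  have e₃' : ∀ r x, ⁅inclRad m r, σ₃ x⁆ = ε • σ₁ (scalarMap m r x) + γ • σ₂ (scalarMap m r x) := by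
    intro r x
    rw [← radAct_apply, e₃, hA₀0]
    simp
  have hγ : γ ≠ 0 := by
    rintro rfl
    obtain ⟨r, x, h⟩ := c.exists_lie_notMem (i := 2) (by simp) h₃
    refine h ?_
    rw [e₃', zero_smul, add_zero]
    exact (F 2).smul_mem _ (h₁.mem _)
  have h3 : γ * β * α ≠ 0 := mul_ne_zero (mul_ne_zero hγ hβ) hα
  -- The new σ₂ is dictated by the action on σ₃, so no freedom remains to cancel the B-term on it.
  -- Its coefficient γ d + ε α, measured against the rescaled σ₀, is z.
  refine ⟨(γ * β * α) • σ₀, (γ * β) • σ₁, γ • σ₂ + ε • σ₁, σ₃, (γ * d + ε * α) / (γ * β * α),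
    h₀.smul h3, h₁.smul (mul_ne_zero hγ hβ),
    (h₂.smul hγ).add (c.covBy (i := 2) (by simp)).le fun x => (F 2).smul_mem _ (h₁.mem _),
    h₃, fun r x => ?_, fun r x => ?_, fun r x => ?_, fun r x => ?_⟩
  · rw [LieModuleHom.smul_apply, lie_smul, e₀, smul_zero]
  · rw [LieModuleHom.smul_apply, LieModuleHom.smul_apply, lie_smul, e₁, smul_smul]
  · simp only [LieModuleHom.add_apply, LieModuleHom.smul_apply, lie_add, lie_smul, e₁, e₂, hd,
      map_smul, smul_smul, div_mul_cancel₀ _ h3]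
    module
  · rw [e₃', LieModuleHom.add_apply, LieModuleHom.smul_apply, LieModuleHom.smul_apply, add_comm]

end Lift

/-! ### Classification -/

section Classification

variable {m : ℕ} {V : FDModule.{u} (Sl2V m)}

theorem UniserialChain.iso_model₃ {l : ℕ} {F : ℕ → LieSubmodule ℂ (Sl2V m) V}
    (c : UniserialChain V [0, m, l] F) {T : Irr m →ₗ[ℂ] Irr l →ₗ[ℂ] Irr m}
    (hT : IsEquivariant T) (hs : ∀ r s q, invForm m s (T r q) = invForm m r (T s q))
    (hT0 : T ≠ 0) : V.Iso (model₃.{v} T hT hs) := by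
  obtain ⟨σ₀, σ₁, σ₂, h₀, h₁, h₂, e₀, e₁, e₂⟩ := c.exists_normal_form₃ hT hT0
  let Φ : Irr 0 × Irr m × Irr l →ₗ[ℂ] V :=
    (σ₀ : Irr 0 →ₗ[ℂ] V).coprod ((σ₁ : Irr m →ₗ[ℂ] V).coprod (σ₂ : Irr l →ₗ[ℂ] V))
  have hΦ : ∀ x, Φ x = σ₀ x.1 + (σ₁ x.2.1 + σ₂ x.2.2) := fun _ => rfl
  have le₁ : F 1 ≤ F 2 := c.mono (by omega) (by simp)
  have le₀ : F 0 ≤ F 1 := c.mono (by omega) (by simp)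
  refine FDModule.iso_ofAction Φ ⟨?_, ?_⟩ ?_ ?_
  · refine (injective_iff_map_eq_zero Φ).2 fun x hx => ?_
    rw [hΦ] at hx
    have x₂ : x.2.2 = 0 := by
      refine h₂.eq_zero _ ?_
      rw [← add_assoc] at hx
      rw [eq_neg_of_add_eq_zero_right hx]
      exact (F 2).neg_mem ((F 2).add_mem (le₁ (h₀.mem _)) (h₁.mem _))
    rw [x₂, map_zero, add_zero] at hx
    have x₁ : x.2.1 = 0 := by
      refine h₁.eq_zero _ ?_
      rw [eq_neg_of_add_eq_zero_right hx]
      exact (F 1).neg_mem (h₀.mem _)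
    rw [x₁, map_zero, add_zero] at hx
    exact Prod.ext (h₀.eq_zero _ (by rw [hx]; exact (F 0).zero_mem)) (Prod.ext x₁ x₂)
  · intro w
    obtain ⟨x₂, hx₂⟩ := h₂.exists_sub_mem w (c.top.ge (LieSubmodule.mem_top w))
    obtain ⟨x₁, hx₁⟩ := h₁.exists_sub_mem _ hx₂
    obtain ⟨x₀, hx₀⟩ := h₀.exists_sub_mem _ hx₁
    rw [c.zero, LieSubmodule.mem_bot] at hx₀
    refine ⟨(x₀, x₁, x₂), ?_⟩
    rw [hΦ, ← sub_eq_zero, ← neg_eq_zero, ← hx₀]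
    abel
  · intro s x
    rw [hΦ, hΦ, lie_add, lie_add, ← sl2_lie_eq, ← sl2_lie_eq, ← sl2_lie_eq, sl2_lie_prod,
      sl2_lie_prod, LieModuleHom.map_lie, LieModuleHom.map_lie, LieModuleHom.map_lie]
  · intro r x
    rw [hΦ, hΦ, lie_add, lie_add, e₀, e₁, e₂, action₃_apply, map_zero, add_zero, zero_add]

theorem UniserialChain.iso_model₄ (hm : 1 ≤ m) {F : ℕ → LieSubmodule ℂ (Sl2V m) V}
    (c : UniserialChain V [0, m, m, 0] F) (heven : Even m) {T : Irr m →ₗ[ℂ] Irr m →ₗ[ℂ] Irr m}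
    (hT : IsEquivariant T) (hs : ∀ r s q, invForm m s (T r q) = invForm m r (T s q))
    (hsymm : ∀ r s, T r s = T s r) (hT0 : T ≠ 0) :
    ∃ z, V.Iso (model₄.{v} heven T hT hs hsymm z) := by
  obtain ⟨σ₀, σ₁, σ₂, σ₃, z, h₀, h₁, h₂, h₃, e₀, e₁, e₂, e₃⟩ := c.exists_normal_form₄ hm hT hT0
  refine ⟨z, ?_⟩
  let Φ : Irr 0 × Irr m × Irr m × Irr 0 →ₗ[ℂ] V :=
    (σ₀ : Irr 0 →ₗ[ℂ] V).coprod ((σ₁ : Irr m →ₗ[ℂ] V).coprod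
      ((σ₂ : Irr m →ₗ[ℂ] V).coprod (σ₃ : Irr 0 →ₗ[ℂ] V)))
  have hΦ : ∀ x, Φ x = σ₀ x.1 + (σ₁ x.2.1 + (σ₂ x.2.2.1 + σ₃ x.2.2.2)) := fun _ => rfl
  have le₂ : F 2 ≤ F 3 := c.mono (by omega) (by simp)
  have le₁ : F 1 ≤ F 2 := c.mono (by omega) (by simp)
  refine FDModule.iso_ofAction Φ ⟨?_, ?_⟩ ?_ ?_
  · refine (injective_iff_map_eq_zero Φ).2 fun x hx => ?_
    rw [hΦ] at hx
    have x₃ : x.2.2.2 = 0 := by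
      refine h₃.eq_zero _ ?_
      rw [← add_assoc, ← add_assoc] at hx
      rw [eq_neg_of_add_eq_zero_right hx]
      exact (F 3).neg_mem ((F 3).add_mem ((F 3).add_mem (le₂ (le₁ (h₀.mem _))) (le₂ (h₁.mem _)))
        (h₂.mem _))
    rw [x₃, map_zero, add_zero] at hx
    have x₂ : x.2.2.1 = 0 := by
      refine h₂.eq_zero _ ?_
      rw [← add_assoc] at hx
      rw [eq_neg_of_add_eq_zero_right hx]
      exact (F 2).neg_mem ((F 2).add_mem (le₁ (h₀.mem _)) (h₁.mem _))
    rw [x₂, map_zero, add_zero] at hx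
    have x₁ : x.2.1 = 0 := by
      refine h₁.eq_zero _ ?_
      rw [eq_neg_of_add_eq_zero_right hx]
      exact (F 1).neg_mem (h₀.mem _)
    rw [x₁, map_zero, add_zero] at hx
    exact Prod.ext (h₀.eq_zero _ (by rw [hx]; exact (F 0).zero_mem))
      (Prod.ext x₁ (Prod.ext x₂ x₃))
  · intro w
    obtain ⟨x₃, hx₃⟩ := h₃.exists_sub_mem w (c.top.ge (LieSubmodule.mem_top w))
    obtain ⟨x₂, hx₂⟩ := h₂.exists_sub_mem _ hx₃
    obtain ⟨x₁, hx₁⟩ := h₁.exists_sub_mem _ hx₂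
    obtain ⟨x₀, hx₀⟩ := h₀.exists_sub_mem _ hx₁
    rw [c.zero, LieSubmodule.mem_bot] at hx₀
    refine ⟨(x₀, x₁, x₂, x₃), ?_⟩
    rw [hΦ, ← sub_eq_zero, ← neg_eq_zero, ← hx₀]
    abel
  · intro s x
    simp only [hΦ, lie_add, ← sl2_lie_eq, sl2_lie_prod, LieModuleHom.map_lie]
  · intro r x
    simp only [hΦ, lie_add, e₀, e₁, e₂, e₃, action₄_apply, map_zero, add_zero, zero_add, map_add,
      map_smul]
    abel

/-- A uniserial module with factors `V(0), V(m), V(0)` forces the invariant form on `V(m)` to be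
symmetric. -/
theorem UniserialChain.even {F : ℕ → LieSubmodule ℂ (Sl2V m) V}
    (c : UniserialChain V [0, m, 0] F) : Even m := by
  obtain ⟨σ₀, σ₁, σ₂, h₀, h₁, h₂, e₀, e₁, e₂⟩ :=
    c.exists_normal_form₃ isEquivariant_scalarMap scalarMap_ne_zero
  have hsymm : ∀ r s, invForm m r s = invForm m s r := by
    intro r s
    -- With T the scalar multiplication, r s sends the top vector to σ₀(B(r, s)), so commutation
    -- forces B to be symmetric.
    have h := inclRad_lie_lie r s (σ₂ (Irr.vec 0 0))
    rw [e₂, e₂, e₁, e₁, scalarMap_vec, scalarMap_vec, ← sub_eq_zero, ← map_sub] at h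
    have h' := h₀.eq_zero _ (by rw [h]; exact (F 0).zero_mem)
    rw [invForm₀_apply, invForm₀_apply, ← sub_smul, smul_eq_zero, sub_eq_zero] at h'
    exact h'.resolve_right (Irr.vec_ne_zero le_rfl)
  by_contra hodd
  have h1 := invForm_swap (Irr.vec m 0) (Irr.vec m m)
  rw [hsymm, (Nat.not_even_iff_odd.1 hodd).neg_one_pow] at h1
  exact invForm_vec (by linear_combination h1 / 2)

/-- A homomorphism from `V(m)`, `m ≥ 1`, with a nonzero vector mapped to an invariant is zero. -/
theorem Irr.hom_apply_eq_zero (hm : 1 ≤ m) {Y : Type*} [AddCommGroup Y] [Module ℂ Y]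
    [LieRingModule Sl2 Y] {D : Irr m →ₗ[ℂ] Y} (hD : ∀ (s : Sl2) p, D ⁅s, p⁆ = ⁅s, D p⁆)
    {p₀ : Irr m} (hp₀ : p₀ ≠ 0) (hinv : ∀ s : Sl2, ⁅s, D p₀⁆ = 0) (p : Irr m) : D p = 0 := by
  -- K consists of the vectors with invariant image. It is a submodule containing p₀, so it is
  -- everything; D then kills h v₀ = m v₀, and hence v₀.
  let K : Submodule ℂ (Irr m) :=
    { carrier := {p | ∀ s : Sl2, D ⁅s, p⁆ = 0}
      add_mem' := fun {p q} hp hq s => by rw [lie_add, map_add, hp s, hq s, add_zero]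
      zero_mem' := fun s => by rw [lie_zero, map_zero]
      smul_mem' := fun t p hp s => by rw [lie_smul, map_smul, hp s, smul_zero] }
  have hK : ∀ (t : Sl2), ∀ p ∈ K, ⁅t, p⁆ ∈ K := by
    intro t p hp s
    rw [hD, hp t, lie_zero]
  have hKtop : K = ⊤ := by
    refine Irr.eq_top_of_ne_bot (hK slE) (hK slF) fun hbot => hp₀ ?_
    rw [← Submodule.mem_bot ℂ, ← hbot]
    intro s
    rw [hD, hinv]
  have hker : LinearMap.ker D = ⊤ := by
    refine Irr.eq_top_of_vec_zero_mem (fun p _ => ?_) ?_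
    · exact (hKtop ▸ Submodule.mem_top : p ∈ K) slF
    · have h := (hKtop ▸ Submodule.mem_top : Irr.vec m 0 ∈ K) slH
      rw [Irr.h_vec, map_smul, smul_eq_zero] at h
      refine h.resolve_left ?_
      rw [Nat.cast_zero, mul_zero, sub_zero]
      exact Nat.cast_ne_zero.2 (by omega)
  exact LinearMap.mem_ker.1 (hker ▸ Submodule.mem_top)

/-- The image of the top invariant vector determines a scalar c. Applying V(m) repeatedly carries c
down to every layer, and comparing the B-terms on the third summand then gives z = z'. -/
theorem eq_of_intertwines_action₄ (hm : 1 ≤ m) {T : Irr m →ₗ[ℂ] Irr m →ₗ[ℂ] Irr m} (hT0 : T ≠ 0)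
    {z z' : ℂ} {ψ : (Irr 0 × Irr m × Irr m × Irr 0) →ₗ[ℂ] (Irr 0 × Irr m × Irr m × Irr 0)}
    (hψ : Function.Injective ψ) (hψr : ∀ r x, ψ (action₄ T z r x) = action₄ T z' r (ψ x))
    (hψs : ∀ (s : Sl2) x, ψ ⁅s, x⁆ = ⁅s, ψ x⁆) : z = z' := by
  have hinv : ∀ p : Irr m, (∀ s : Sl2, ⁅s, p⁆ = 0) → p = 0 := by
    intro p hp
    by_contra hne
    exact hne (Irr.hom_apply_eq_zero hm (D := LinearMap.id) (fun _ _ => rfl) hne hp p)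
  have hu : ∀ s : Sl2, ⁅s, ψ (0, 0, 0, Irr.vec 0 0)⁆ = 0 := by
    intro s
    have h : ⁅s, ((0, 0, 0, Irr.vec 0 0) : Irr 0 × Irr m × Irr m × Irr 0)⁆ = 0 := by
      simp only [sl2_lie_prod, lie_zero, Irr.lie_zero_right]
      rfl
    rw [← hψs, h, map_zero]
  have hu₁ : (ψ (0, 0, 0, Irr.vec 0 0)).2.1 = 0 := hinv _ fun s => congrArg (·.2.1) (hu s)
  have hu₂ : (ψ (0, 0, 0, Irr.vec 0 0)).2.2.1 = 0 := hinv _ fun s => congrArg (·.2.2.1) (hu s)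
  set c : ℂ := Irr.coord 0 0 (ψ (0, 0, 0, Irr.vec 0 0)).2.2.2
  have h₂ : ∀ r, ψ (0, 0, r, 0) = (0, 0, c • r, 0) := by
    intro r
    have h := hψr r (0, 0, 0, Irr.vec 0 0)
    rw [action₄_apply, action₄_apply, hu₁, hu₂] at h
    rw [scalarMap_vec] at h
    simpa only [scalarMap_apply, smul_zero, add_zero, map_zero] using h
  have h₁ : ∀ s r, ψ (z • invForm₀ m s r, T s r, 0, 0) =
      ((z' * c) • invForm₀ m s r, c • T s r, 0, 0) := by
    intro s r
    have h := hψr s (0, 0, r, 0)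
    rw [action₄_apply, action₄_apply, h₂] at h
    simpa only [zero_add, map_smul, map_zero, smul_smul] using h
  obtain ⟨s₀, hs₀⟩ := DFunLike.ne_iff.1 hT0
  obtain ⟨r₀, hr₀⟩ := DFunLike.ne_iff.1 hs₀
  have hr₀ : T s₀ r₀ ≠ 0 := hr₀
  have h₀ : ψ (Irr.vec 0 0, 0, 0, 0) = (c • Irr.vec 0 0, 0, 0, 0) := by
    obtain ⟨t, ht⟩ : ∃ t, invForm m t (T s₀ r₀) ≠ 0 := by
      by_contra! hcon
      refine hr₀ (eq_of_invForm fun y => ?_)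
      rw [invForm_swap y, hcon, mul_zero, map_zero, LinearMap.zero_apply]
    have h := hψr t (z • invForm₀ m s₀ r₀, T s₀ r₀, 0, 0)
    rw [action₄_apply, action₄_apply, h₁] at h
    simp only [smul_zero, add_zero, map_zero, map_smul, invForm₀_apply] at h
    have h' : invForm m t (T s₀ r₀) • ψ (Irr.vec 0 0, 0, 0, 0) =
        invForm m t (T s₀ r₀) • (c • Irr.vec 0 0, 0, 0, 0) := by
      rw [← map_smul]
      simpa only [Prod.smul_mk, smul_zero, smul_comm c] using h
    exact smul_right_injective _ ht h'
  have hc : c ≠ 0 := by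
    intro hc
    rw [hc, zero_smul] at h₀
    have h := congrArg (·.1) (hψ (h₀.trans (map_zero ψ).symm))
    exact Irr.vec_ne_zero le_rfl h
  let ι : Irr m →ₗ[ℂ] Irr 0 × Irr m × Irr m × Irr 0 :=
    LinearMap.inr ℂ _ _ ∘ₗ LinearMap.inl ℂ _ _
  have hι : ∀ p, ι p = (0, p, 0, 0) := fun _ => rfl
  -- D measures how far ψ is from the scalar c on the second summand. It sends T(s, r) to the
  -- invariant vector (z' - z) c B(s, r) v₀ of the first summand; as some T(s, r) is nonzero, D
  -- vanishes.
  let D : Irr m →ₗ[ℂ] Irr 0 × Irr m × Irr m × Irr 0 := ψ ∘ₗ ι - c • ι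
  have hDs : ∀ (s : Sl2) p, D ⁅s, p⁆ = ⁅s, D p⁆ := by
    intro s p
    have h : ι ⁅s, p⁆ = ⁅s, ι p⁆ := by simp only [hι, sl2_lie_prod, lie_zero]
    change ψ (ι ⁅s, p⁆) - c • ι ⁅s, p⁆ = ⁅s, ψ (ι p) - c • ι p⁆
    rw [h, hψs, lie_sub, lie_smul]
  have hDT : ∀ s r, D (T s r) = (((z' - z) * c * invForm m s r) • Irr.vec 0 0, 0, 0, 0) := by
    intro s r
    have h := h₁ s r
    have hsplit : (z • invForm₀ m s r, T s r, 0, 0) = (z * invForm m s r) •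
        ((Irr.vec 0 0, 0, 0, 0) : Irr 0 × Irr m × Irr m × Irr 0) + ι (T s r) := by
      rw [hι, invForm₀_apply]
      simp only [Prod.smul_mk, smul_zero, Prod.mk_add_mk, add_zero, zero_add, smul_smul]
    rw [hsplit, map_add, map_smul, h₀, ← eq_sub_iff_add_eq'] at h
    change ψ (ι (T s r)) - c • ι (T s r) = _
    rw [h, hι, invForm₀_apply]
    simp only [Prod.smul_mk, smul_zero, Prod.mk_sub_mk, sub_zero, sub_self, smul_smul,
      ← sub_smul]
    refine Prod.ext ?_ (Prod.ext rfl (sub_zero _))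
    exact congrArg (· • Irr.vec 0 0) (by ring)
  have hD0 := Irr.hom_apply_eq_zero hm hDs hr₀ fun s => by
    rw [hDT]
    simp only [sl2_lie_prod, lie_zero, Irr.lie_zero_right]
    rfl
  have h := congrArg (·.1) ((hDT (Irr.vec m 0) (Irr.vec m m)).symm.trans (hD0 _))
  have h' := (smul_eq_zero.1 h).resolve_right (Irr.vec_ne_zero le_rfl)
  simp only [mul_eq_zero, hc, invForm_vec, or_false, sub_eq_zero] at h'
  exact h'.symm

/-- The parameter `z` is an invariant. -/
theorem eq_of_model₄_iso (hm : 1 ≤ m) {heven : Even m} {T : Irr m →ₗ[ℂ] Irr m →ₗ[ℂ] Irr m}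
    {hT : IsEquivariant T} {hs : ∀ r s q, invForm m s (T r q) = invForm m r (T s q)}
    {hsymm : ∀ r s, T r s = T s r} (hT0 : T ≠ 0) {z z' : ℂ}
    (h : (model₄.{v} heven T hT hs hsymm z).Iso (model₄.{v} heven T hT hs hsymm z')) : z = z' := by
  obtain ⟨φ⟩ := h
  have hφ : ∀ (x : Sl2V m) w, φ ⁅x, w⁆ = ⁅x, φ w⁆ := fun x w => φ.toLieModuleHom.map_lie x w
  let e : model₄.{v} heven T hT hs hsymm z ≃ₗ[ℂ] Irr 0 × Irr m × Irr m × Irr 0 :=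
    FDModule.ofActionEquiv
  let e' : model₄.{v} heven T hT hs hsymm z' ≃ₗ[ℂ] Irr 0 × Irr m × Irr m × Irr 0 :=
    FDModule.ofActionEquiv
  let ψ : (Irr 0 × Irr m × Irr m × Irr 0) →ₗ[ℂ] (Irr 0 × Irr m × Irr m × Irr 0) :=
    e'.toLinearMap ∘ₗ (φ : model₄.{v} heven T hT hs hsymm z →ₗ[ℂ]
      model₄.{v} heven T hT hs hsymm z') ∘ₗ e.symm.toLinearMap
  have hψinj : Function.Injective ψ := e'.injective.comp (φ.injective.comp e.symm.injective)
  have hψr : ∀ r x, ψ (action₄ T z r x) = action₄ T z' r (ψ x) := by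
    intro r x
    have h1 : e.symm (action₄ T z r x) = ⁅inclRad m r, e.symm x⁆ := by
      rw [LinearEquiv.symm_apply_eq]
      exact ((FDModule.ofActionEquiv_lie_inclRad r (e.symm x)).trans
        (congrArg (action₄ T z r) (e.apply_symm_apply x))).symm
    change e' (φ (e.symm (action₄ T z r x))) = action₄ T z' r (e' (φ (e.symm x)))
    rw [h1, hφ]
    exact FDModule.ofActionEquiv_lie_inclRad r _
  have hψs : ∀ (s : Sl2) x, ψ ⁅s, x⁆ = ⁅s, ψ x⁆ := by
    intro s x
    have h1 : e.symm ⁅s, x⁆ = ⁅inclSl2 m s, e.symm x⁆ := by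
      rw [LinearEquiv.symm_apply_eq]
      exact ((FDModule.ofActionEquiv_lie_inclSl2 s (e.symm x)).trans
        (congrArg (⁅s, ·⁆) (e.apply_symm_apply x))).symm
    change e' (φ (e.symm ⁅s, x⁆)) = ⁅s, e' (φ (e.symm x))⁆
    rw [h1, hφ]
    exact FDModule.ofActionEquiv_lie_inclSl2 s _
  exact eq_of_intertwines_action₄ hm hT0 hψinj hψr hψs

end Classification

/-! ### Assembly of the theorem -/

theorem existsUniqueUniserial₃ {m l : ℕ} (hm : 1 ≤ m) (hl : l ≤ 2 * m)
    (hlm : l ≡ 2 * m [MOD 4]) : ExistsUniqueUniserial.{u} m [0, m, l] := by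
  obtain ⟨T, hT, hT0, hs⟩ := exists_symmetric_map hl hlm
  exact ⟨model₃.{0} T hT hs, isUniserialWith_model₃ hT0,
    fun W hW => (hW.2.uniserialChain hm).iso_model₃ hT hs hT0⟩

theorem exists_isUniserialWith₃ {m l : ℕ} (hl : l ≤ 2 * m) (hlm : l ≡ 2 * m [MOD 4]) :
    ∃ W : FDModule.{u} (Sl2V m), IsUniserialWith W [0, m, l] := by
  obtain ⟨T, hT, hT0, hs⟩ := exists_symmetric_map hl hlm
  exact ⟨model₃ T hT hs, isUniserialWith_model₃ hT0⟩

/-- All models share one underlying space, and `action₄ T z` is `action₄ T 0` plus z times the map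
from the third summand to the first given by B; a fixed basis of that space is transported. -/
theorem model₄_matrix_affine {m : ℕ} (hm : Even m) {T : Irr m →ₗ[ℂ] Irr m →ₗ[ℂ] Irr m}
    (hT : IsEquivariant T) (hs : ∀ r s q, invForm m s (T r q) = invForm m r (T s q))
    (hsymm : ∀ r s, T r s = T s r) :
    ∃ (d : ℕ) (A C : Sl2V m → Matrix (Fin d) (Fin d) ℂ)
      (b : ∀ z, Module.Basis (Fin d) ℂ (model₄.{v} hm T hT hs hsymm z)),
      ∀ (z : ℂ) (x : Sl2V m),
        LinearMap.toMatrix (b z) (b z)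
          (LieModule.toEnd ℂ (Sl2V m) (model₄.{v} hm T hT hs hsymm z) x) = A x + z • C x := by
  let b := Module.finBasis ℂ (Irr 0 × Irr m × Irr m × Irr 0)
  let N : Irr m → (Irr 0 × Irr m × Irr m × Irr 0) →ₗ[ℂ] Irr 0 × Irr m × Irr m × Irr 0 := fun r =>
    LinearMap.inl ℂ _ _ ∘ₗ invForm₀ m r ∘ₗ LinearMap.fst ℂ _ _ ∘ₗ LinearMap.snd ℂ _ _ ∘ₗ
      LinearMap.snd ℂ _ _
  let e : ∀ z, model₄.{v} hm T hT hs hsymm z ≃ₗ[ℂ] Irr 0 × Irr m × Irr m × Irr 0 := fun _ =>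
    FDModule.ofActionEquiv
  have he : ∀ z (x : Sl2V m) w, e z ⁅x, w⁆ = action₄ T z x.left (e z w) + ⁅x.right, e z w⁆ :=
    fun _ => FDModule.ofActionEquiv_lie
  refine ⟨_, fun x => LinearMap.toMatrix b b (action₄ T 0 x.left + LieModule.toEnd ℂ Sl2 _ x.right),
    fun x => LinearMap.toMatrix b b (N x.left),
    fun z => b.map (e z).symm, fun z x => ?_⟩
  rw [← map_smul, ← map_add]
  ext i j
  rw [LinearMap.toMatrix_apply, LinearMap.toMatrix_apply]
  change b.repr (e z ⁅x, (e z).symm (b j)⁆) i = _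
  rw [he, LinearEquiv.apply_symm_apply, LinearMap.add_apply, LinearMap.add_apply,
    LinearMap.smul_apply, LieModule.toEnd_apply_apply, add_right_comm]
  refine congrArg (fun w => b.repr (w + ⁅x.right, b j⁆) i) ?_
  change _ = action₄ T 0 x.left (b j) + z • (invForm₀ m x.left (b j).2.2.1, 0)
  rw [action₄_apply, action₄_apply, zero_smul, add_zero, Prod.smul_mk, smul_zero, Prod.mk_add_mk,
    add_zero, map_add, map_smul]

theorem mainTheorem12 (m : ℕ) (hm : 1 ≤ m) :
    -- the factors `V(0), V(m), V(ℓ)`, and the dual module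
    (∀ ℓ : ℕ, ℓ ≤ 2 * m → ℓ ≡ 2 * m [MOD 4] →
      ExistsUniqueUniserial.{u} m [0, m, ℓ] ∧
      ∀ W : FDModule.{u} (Sl2V m), IsUniserialWith W [0, m, ℓ] →
        IsUniserialWith W.dual [ℓ, m, 0]) ∧
    -- the factors `V(0), V(m), V(0)`: existence, and unique existence, exactly for even `m`
    ((∃ W : FDModule.{u} (Sl2V m), IsUniserialWith W [0, m, 0]) ↔ Even m) ∧
    (ExistsUniqueUniserial.{u} m [0, m, 0] ↔ Even m) ∧
    -- the factors `V(0), V(m), V(m), V(0)`: a complete irredundant family `M z`, `z ∈ ℂ`, whose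
    -- matrices in suitable bases depend on `z` by an affine map
    (m ≡ 0 [MOD 4] →
      ∃ M : ℂ → FDModule.{0} (Sl2V m),
        (∀ z, IsUniserialWith (M z) [0, m, m, 0]) ∧
        (∀ z z', (M z).Iso (M z') → z = z') ∧
        (∀ W : FDModule.{u} (Sl2V m), IsUniserialWith W [0, m, m, 0] → ∃ z, W.Iso (M z)) ∧
        ∃ (d : ℕ) (A C : Sl2V m → Matrix (Fin d) (Fin d) ℂ)
          (b : ∀ z, Module.Basis (Fin d) ℂ (M z)),
          ∀ (z : ℂ) (x : Sl2V m),
            LinearMap.toMatrix (b z) (b z) (LieModule.toEnd ℂ (Sl2V m) (M z) x) =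
              A x + z • C x) := by
  -- For even m the factors V(0), V(m), V(0) are the case ℓ = 0 of the first part.
  have h0 : Even m → 0 ≡ 2 * m [MOD 4] := by
    rintro ⟨k, rfl⟩
    exact (Nat.modEq_zero_iff_dvd.2 ⟨k, by ring⟩).symm
  refine ⟨fun ℓ hℓ hℓm => ⟨existsUniqueUniserial₃ hm hℓ hℓm, fun W hW => hW.dual hm⟩,
    ⟨fun ⟨W, hW⟩ => (hW.2.uniserialChain hm).even,
      fun h => exists_isUniserialWith₃ (Nat.zero_le _) (h0 h)⟩,
    ⟨fun ⟨V, hV, _⟩ => (hV.2.uniserialChain hm).even,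
      fun h => existsUniqueUniserial₃ hm (Nat.zero_le _) (h0 h)⟩, fun h4 => ?_⟩
  have heven : Even m :=
    even_iff_two_dvd.2 (dvd_trans (by norm_num) (Nat.modEq_zero_iff_dvd.1 h4))
  -- This is the congruence for ℓ = m, which provides the symmetric product T on V(m).
  have hmm : m ≡ 2 * m [MOD 4] := h4.trans (h4.mul_left 2).symm
  obtain ⟨T, hT, hT0, hs⟩ := exists_symmetric_map (m := m) (by omega) hmm
  have hsymm : ∀ r s, T r s = T s r := symmetric_of_trilinear hT hT0 hs
  exact ⟨fun z => model₄ heven T hT hs hsymm z, isUniserialWith_model₄ hT0,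
    fun z z' h => eq_of_model₄_iso hm hT0 h,
    fun W hW => (hW.2.uniserialChain hm).iso_model₄ hm heven hT hs hsymm hT0,
    model₄_matrix_affine heven hT hs hsymm⟩
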